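/- Let $k\ge 1$, $N\ge 0$ be integers and let $\alpha>0$, $C_M$, $C_R$, $\sigma$ be real numbers. There is a constant $C>0$, depending only on $k,N,\alpha,C_M,C_R,\sigma$ (in particular independent of $t$, of the final time $T$, of the mesh and its size $h$, and of the solution), such that the following holds. Let $x\in\mathbb R^3$, $\delta>0$, and let $Y^\delta=x+\delta(0,1)^3$. Let $M,R:\mathbb R^3\to\mathbb R^{3N\times 3N}$ be such that $y\mapsto M(y/\delta)$ and $y\mapsto R(y/\delta)$ are measurable on $Y^\delta$ and, for almost every $y\in Y^\delta$: $M(y/\delta)$ is symmetric with $\alpha|\Phi|^2\le M(y/\delta)\Phi\cdot\Phi\le C_M|\Phi|^2$ for all $\Phi\in\mathbb R^{3N}$; and $R(y/\delta)$ is positive semi-definite (not necessarily symmetric) with spectral norm at most $C_R$. Let $V=H^1_{\mathrm{per}}(Y^\delta;\mathbb R^N)$ be the space of periodic functions in $H^1(Y^\delta;\mathbb R^N)$ with mean zero, let $\nabla\phi\in\mathbb R^{3N}$ be the componentwise gradient, and put $$m(\phi,\psi)=\int_{Y^\delta}M(y/\delta)\nabla\phi\cdot\nabla\psi\,dy,\qquad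 r(\phi,\psi)=\int_{Y^\delta}R(y/\delta)\nabla\phi\cdot\nabla\psi\,dy,\qquad \|\phi\|_m=m(\phi,\phi)^{1/2}.$$ Let $T>0$ and let $\overline w\in C^1([0,T];H^{k+1}(Y^\delta;\mathbb R^N))$ with $\overline w(t)\in V$ solve the Sobolev equation $$m(\partial_t\overline w(t),v)+r(\overline w(t),v)=0\qquad\text{for all }v\in V,\ t\in[0,T].$$ Let $\mathcal T_h$ be a triangulation of $Y^\delta$ into finitely many closed parallelepipeds with pairwise disjoint interiors, such that each face of an element either lies in $\partial Y^\delta$ or is a face of another element. Let $h$ be the largest diameter of an element, and suppose that $\mathcal T_h$ is shape regular: every element $K$ contains a ball of diameter $d_K>0$ with $\operatorname{diam}K\le\sigma d_K$. Let $V^h\subseteq V$ be the periodic Lagrange finite element space, that is, the functions in $V$ each of whose components is on every element a polynomial of degree at most $k$ in each variable. Let $w^h:[0,T]\to V^h$ be differentiable with $$m(\partial_t w^h(t),v^h)+r(w^h(t),v^h)=0\qquad\text{for all }v^h\in V^h,\ t\in[0,T].$$ (a) If $w^h(0)$ is the finite element approximation of $\overline w(0)$, i.e. $m(w^h(0),v^h)=m(\overline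 w(0),v^h)$ for all $v^h\in V^h$, then for all $t\in[0,T]$ $$\|\overline w(t)-w^h(t)\|_m\le C h^k\Big[|\overline w(0)|_{H^{k+1}(Y^\delta)}+|\overline w(t)|_{H^{k+1}(Y^\delta)}+\int_0^t|\overline w(s)|_{H^{k+1}(Y^\delta)}\,ds\Big].$$ (b) For an arbitrary initial value $w^h(0)\in V^h$ one has, for all $t\in[0,T]$, $$\|\overline w(t)-w^h(t)\|_m\le\|\overline w(0)-w^h(0)\|_m+C h^k\Big[|\overline w(0)|_{H^{k+1}(Y^\delta)}+|\overline w(t)|_{H^{k+1}(Y^\delta)}+\int_0^t|\overline w(s)|_{H^{k+1}(Y^\delta)}\,ds\Big].$$ Here $|u|_{H^{k+1}}=\big(\sum_{|\beta|=k+1}\|\partial^\beta u\|_{L^2}^2\big)^{1/2}$. Since $C$ does not depend on $t$ or $T$, there is no exponential growth in time. -/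

import Mathlib

open MeasureTheory Set
open scoped ContDiff Matrix

noncomputable section

/-- Three-dimensional Euclidean space. -/
abbrev E3 : Type := EuclideanSpace ℝ (Fin 3)

/-! ### Partial derivatives of smooth functions, weak derivatives, Sobolev spaces -/

/-- Classical partial derivative in the `i`-th coordinate direction. -/
def partialD (i : Fin 3) (φ : E3 → ℝ) : E3 → ℝ :=
  fun y => fderiv ℝ φ y (EuclideanSpace.single i 1)

/-- Classical partial derivative `∂^β φ` for a multi-index `β`. -/
def iterPartialD (β : Fin 3 → ℕ) (φ : E3 → ℝ) : E3 → ℝ :=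
  (partialD 0)^[β 0] ((partialD 1)^[β 1] ((partialD 2)^[β 2] φ))

/-- `g` is the weak derivative `∂^β u` in the open set `D`:
`∫_D (∂^β φ) u = (-1)^|β| ∫_D φ g` for all test functions `φ ∈ C_c^∞(D)`. -/
def IsWeakDeriv {N : ℕ} (D : Set E3) (β : Fin 3 → ℕ) (u g : E3 → EuclideanSpace ℝ (Fin N)) :
    Prop :=
  ∀ φ : E3 → ℝ, ContDiff ℝ ∞ φ → HasCompactSupport φ → tsupport φ ⊆ D →
    ∫ y in D, iterPartialD β φ y • u y = (-1 : ℝ) ^ (∑ i, β i) • ∫ y in D, φ y • g y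

/-- Multi-indices of order at most `m`. -/
abbrev MultiIndex (m : ℕ) : Type := {β : Fin 3 → ℕ // ∑ i, β i ≤ m}

instance MultiIndex.instFinite (m : ℕ) : Finite (MultiIndex m) := by
  refine Finite.of_injective (β := Fin 3 → Fin (m + 1))
    (fun b i => ⟨b.1 i, Nat.lt_succ_of_le ((Finset.single_le_sum
      (f := b.1) (fun _ _ => Nat.zero_le _) (Finset.mem_univ i)).trans b.2)⟩) ?_
  intro a b h
  apply Subtype.ext
  funext i
  simpa using congrArg Fin.val (congrFun h i)

instance MultiIndex.instFintype (m : ℕ) : Fintype (MultiIndex m) := Fintype.ofFinite _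

/-- The multi-index `0`. -/
def MultiIndex.zero (m : ℕ) : MultiIndex m := ⟨0, by simp⟩

/-- The multi-index of `∂_i`. -/
def MultiIndex.single (i : Fin 3) : MultiIndex 1 := ⟨Pi.single i 1, by simp⟩

theorem contDiff_partialD {φ : E3 → ℝ} (h : ContDiff ℝ ∞ φ) (i : Fin 3) :
    ContDiff ℝ ∞ (partialD i φ) := by
  have h1 : ContDiff ℝ ∞ (fderiv ℝ φ) := h.fderiv_right (by simp)
  exact h1.clm_apply contDiff_const

theorem hasCompactSupport_partialD {φ : E3 → ℝ} (h : HasCompactSupport φ) (i : Fin 3) :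
    HasCompactSupport (partialD i φ) :=
  h.fderiv_apply (𝕜 := ℝ) (EuclideanSpace.single i 1)

theorem smooth_iterate_partialD {φ : E3 → ℝ} (h : ContDiff ℝ ∞ φ ∧ HasCompactSupport φ)
    (i : Fin 3) (n : ℕ) :
    ContDiff ℝ ∞ ((partialD i)^[n] φ) ∧ HasCompactSupport ((partialD i)^[n] φ) := by
  induction n with
  | zero => exact h
  | succ n ih =>
    rw [Function.iterate_succ_apply']
    exact ⟨contDiff_partialD ih.1 i, hasCompactSupport_partialD ih.2 i⟩

theorem smooth_iterPartialD {φ : E3 → ℝ} (h : ContDiff ℝ ∞ φ ∧ HasCompactSupport φ)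
    (β : Fin 3 → ℕ) :
    ContDiff ℝ ∞ (iterPartialD β φ) ∧ HasCompactSupport (iterPartialD β φ) :=
  smooth_iterate_partialD (smooth_iterate_partialD (smooth_iterate_partialD h 2 _) 1 _) 0 _

theorem integrable_smul_Lp {N : ℕ} (D : Set E3) {φ : E3 → ℝ}
    (h : ContDiff ℝ ∞ φ ∧ HasCompactSupport φ)
    (u : Lp (EuclideanSpace ℝ (Fin N)) 2 (volume.restrict D)) :
    Integrable (fun y => φ y • u y) (volume.restrict D) := by
  have h1 : MemLp φ 2 (volume.restrict D) := h.1.continuous.memLp_of_hasCompactSupport h.2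
  exact memLp_one_iff_integrable.1 ((Lp.memLp u).smul h1)

/-- The space of all families `(u_β)_{|β| ≤ m}` of `L²(D; ℝ^N)` functions, with the norm
`(∑_β ‖u_β‖²)^{1/2}`. -/
abbrev JetSpace (D : Set E3) (m N : ℕ) : Type :=
  PiLp 2 (fun _ : MultiIndex m => Lp (EuclideanSpace ℝ (Fin N)) 2 (volume.restrict D))

/-- The Sobolev space `H^m(D; ℝ^N)` with its Hilbert norm `(∑_{|β| ≤ m} ‖∂^β u‖²)^{1/2}`: a
function `u` is represented by the family `(∂^β u)_{|β| ≤ m}` of its weak derivatives, which it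
determines. -/
def SobolevSpace (D : Set E3) (m N : ℕ) : Submodule ℝ (JetSpace D m N) where
  carrier := {F | ∀ β : MultiIndex m, IsWeakDeriv D β.1 (F (MultiIndex.zero m)) (F β)}
  zero_mem' := by
    intro β φ _ _ _
    have h : ∀ ψ : E3 → ℝ, ∫ y in D, ψ y • (⇑(0 : Lp (EuclideanSpace ℝ (Fin N)) 2
        (volume.restrict D)) : E3 → EuclideanSpace ℝ (Fin N)) y = 0 := by
      intro ψ
      apply integral_eq_zero_of_ae
      filter_upwards [Lp.coeFn_zero (EuclideanSpace ℝ (Fin N)) 2 (volume.restrict D)] with y hy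
      rw [hy]
      simp
    simp only [PiLp.zero_apply, h, smul_zero]
  add_mem' := by
    intro F G hF hG β φ h1 h2 h3
    have key : ∀ ψ : E3 → ℝ, ContDiff ℝ ∞ ψ ∧ HasCompactSupport ψ →
        ∀ u v : Lp (EuclideanSpace ℝ (Fin N)) 2 (volume.restrict D),
        ∫ y in D, ψ y • (⇑(u + v) : E3 → EuclideanSpace ℝ (Fin N)) y
          = (∫ y in D, ψ y • u y) + ∫ y in D, ψ y • v y := by
      intro ψ hψ u v
      rw [← integral_add (integrable_smul_Lp D hψ u) (integrable_smul_Lp D hψ v)]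
      apply integral_congr_ae
      filter_upwards [Lp.coeFn_add u v] with y hy
      rw [hy, Pi.add_apply, smul_add]
    simp only [PiLp.add_apply]
    rw [key _ (smooth_iterPartialD ⟨h1, h2⟩ _), key _ ⟨h1, h2⟩, hF β φ h1 h2 h3,
      hG β φ h1 h2 h3, smul_add]
  smul_mem' := by
    intro c F hF β φ h1 h2 h3
    have key : ∀ ψ : E3 → ℝ,
        ∀ u : Lp (EuclideanSpace ℝ (Fin N)) 2 (volume.restrict D),
        ∫ y in D, ψ y • (⇑(c • u) : E3 → EuclideanSpace ℝ (Fin N)) y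
          = c • ∫ y in D, ψ y • u y := by
      intro ψ u
      rw [← integral_smul]
      apply integral_congr_ae
      filter_upwards [Lp.coeFn_smul c u] with y hy
      simp only [hy, Pi.smul_apply]
      rw [smul_comm]
    simp only [PiLp.smul_apply]
    rw [key, key, hF β φ h1 h2 h3, smul_comm]

/-- The `L²(D; ℝ^N)` function underlying an element of `H^m(D; ℝ^N)`. -/
def sobolevFn {D : Set E3} {m N : ℕ} (u : SobolevSpace D m N) :
    E3 → EuclideanSpace ℝ (Fin N) :=
  u.1 (MultiIndex.zero m)

/-- The embedding `H^m(D; ℝ^N) → H^l(D; ℝ^N)`, `l ≤ m`. -/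
def sobolevEmbed {D : Set E3} {l m N : ℕ} (h : l ≤ m) (u : SobolevSpace D m N) :
    SobolevSpace D l N :=
  ⟨WithLp.toLp 2 (fun β : MultiIndex l => u.1 ⟨β.1, β.2.trans h⟩),
    fun β => u.2 ⟨β.1, β.2.trans h⟩⟩

/-- The seminorm `|u|_{H^m} = (∑_{|β| = m} ‖∂^β u‖²)^{1/2}`. -/
def sobolevSeminorm {D : Set E3} {m N : ℕ} (u : SobolevSpace D m N) : ℝ :=
  √(∑ β : MultiIndex m, if ∑ i, β.1 i = m then ‖u.1 β‖ ^ 2 else 0)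

/-- The weak partial derivative `∂_i u` of `u ∈ H^1(D; ℝ^N)`. -/
def weakPartial {D : Set E3} {N : ℕ} (i : Fin 3) (u : SobolevSpace D 1 N) :
    E3 → EuclideanSpace ℝ (Fin N) :=
  u.1 (MultiIndex.single i)

/-- The componentwise gradient `∇u(y) ∈ ℝ^{3N}`, whose entry `(c, i)` is `∂_i u_c(y)`. -/
def grad {D : Set E3} {N : ℕ} (u : SobolevSpace D 1 N) (y : E3) : Fin N × Fin 3 → ℝ :=
  fun p => weakPartial p.2 u y p.1

/-! ### The cell problem -/

/-- The sampling domain `x + δ (0,1)³`. -/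
def samplingDomain (x : E3) (δ : ℝ) : Set E3 :=
  {y | ∀ i, x i < y i ∧ y i < x i + δ}

/-- The space `H^1_per(x + δ(0,1)³; ℝ^N)` of periodic `H^1` functions with mean zero. Equality of
the traces on opposite faces is expressed by Green's formula without boundary terms against smooth
periodic functions. -/
def periodicH1 (x : E3) (δ : ℝ) (N : ℕ) : Set (SobolevSpace (samplingDomain x δ) 1 N) :=
  {u | (∫ y in samplingDomain x δ, sobolevFn u y = 0) ∧
    ∀ φ : E3 → ℝ, ContDiff ℝ ∞ φ →
      (∀ (y : E3) (j : Fin 3), φ (y + EuclideanSpace.single j δ) = φ y) →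
      ∀ i : Fin 3, ∫ y in samplingDomain x δ, partialD i φ y • sobolevFn u y
        = -∫ y in samplingDomain x δ, φ y • weakPartial i u y}

/-- The bilinear form `∫_D A(y) ∇u(y) · ∇v(y) dy`. -/
def gradForm {D : Set E3} {N : ℕ} (A : E3 → Matrix (Fin N × Fin 3) (Fin N × Fin 3) ℝ)
    (u v : SobolevSpace D 1 N) : ℝ :=
  ∫ y in D, (A y *ᵥ grad u y) ⬝ᵥ grad v y

/-- The energy norm `(∫_D A(y) ∇u(y) · ∇u(y) dy)^{1/2}`. -/
def energyNorm {D : Set E3} {N : ℕ} (A : E3 → Matrix (Fin N × Fin 3) (Fin N × Fin 3) ℝ)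
    (u : SobolevSpace D 1 N) : ℝ :=
  √(gradForm A u u)

/-- The coefficient `y ↦ A(y/δ)`. -/
def rescale {N : ℕ} (δ : ℝ) (A : E3 → Matrix (Fin N × Fin 3) (Fin N × Fin 3) ℝ) :
    E3 → Matrix (Fin N × Fin 3) (Fin N × Fin 3) ℝ :=
  fun y => A (δ⁻¹ • y)

/-- `A` is measurable on `D` and, almost everywhere in `D`, symmetric with
`α|Φ|² ≤ A(y)Φ·Φ ≤ C|Φ|²` for all `Φ`. -/
def IsEllipticCoeff {N : ℕ} (D : Set E3) (α C : ℝ)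
    (A : E3 → Matrix (Fin N × Fin 3) (Fin N × Fin 3) ℝ) : Prop :=
  (∀ p q, AEMeasurable (fun y => A y p q) (volume.restrict D)) ∧
  ∀ᵐ y ∂(volume.restrict D), (A y).IsSymm ∧
    ∀ Φ : Fin N × Fin 3 → ℝ, α * (Φ ⬝ᵥ Φ) ≤ (A y *ᵥ Φ) ⬝ᵥ Φ ∧ (A y *ᵥ Φ) ⬝ᵥ Φ ≤ C * (Φ ⬝ᵥ Φ)

/-- `A` is measurable on `D` and, almost everywhere in `D`, positive semi-definite (not
necessarily symmetric) with spectral norm at most `C`. -/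
def IsDampingCoeff {N : ℕ} (D : Set E3) (C : ℝ)
    (A : E3 → Matrix (Fin N × Fin 3) (Fin N × Fin 3) ℝ) : Prop :=
  (∀ p q, AEMeasurable (fun y => A y p q) (volume.restrict D)) ∧
  ∀ᵐ y ∂(volume.restrict D), ‖Matrix.toEuclideanCLM (𝕜 := ℝ) (A y)‖ ≤ C ∧
    ∀ Φ : Fin N × Fin 3 → ℝ, 0 ≤ (A y *ᵥ Φ) ⬝ᵥ Φ

/-- `w ∈ C¹([0,T]; H^{k+1})` solves the Sobolev equation
`m(∂_t w(t), v) + r(w(t), v) = 0` for all `v ∈ H^1_per` and `t ∈ [0,T]`,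
where `w(t) ∈ H^1_per`. -/
def IsRegularSobolevSolution {N k : ℕ} (x : E3) (δ T : ℝ)
    (A B : E3 → Matrix (Fin N × Fin 3) (Fin N × Fin 3) ℝ)
    (w : ℝ → SobolevSpace (samplingDomain x δ) (k + 1) N) : Prop :=
  ContDiffOn ℝ 1 w (Icc 0 T) ∧
  ∀ t ∈ Icc 0 T, sobolevEmbed (Nat.le_add_left 1 k) (w t) ∈ periodicH1 x δ N ∧
    ∀ v ∈ periodicH1 x δ N,
      gradForm A (sobolevEmbed (Nat.le_add_left 1 k) (derivWithin w (Icc 0 T) t)) v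
        + gradForm B (sobolevEmbed (Nat.le_add_left 1 k) (w t)) v = 0

/-! ### Triangulations and Lagrange finite elements -/

/-- A closed non-degenerate parallelepiped in `ℝ³`, given by a vertex and three edge vectors. -/
structure Parallelepiped where
  base : E3
  edge : Fin 3 → E3
  indep : LinearIndependent ℝ edge

namespace Parallelepiped

/-- The points of the parallelepiped. -/
def carrier (K : Parallelepiped) : Set E3 :=
  {y | ∃ s : Fin 3 → ℝ, (∀ i, s i ∈ Icc (0 : ℝ) 1) ∧ y = K.base + ∑ i, s i • K.edge i}

/-- The two-dimensional face on which the `i`-th local coordinate is `0` (`b = false`) or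
`1` (`b = true`). -/
def face (K : Parallelepiped) (i : Fin 3) (b : Bool) : Set E3 :=
  {y | ∃ s : Fin 3 → ℝ, (∀ j, s j ∈ Icc (0 : ℝ) 1) ∧ s i = (if b then 1 else 0) ∧
    y = K.base + ∑ j, s j • K.edge j}

end Parallelepiped

/-- A triangulation of `D` into adjacent parallelepipeds: finitely many elements that cover the
closure of `D`, with pairwise disjoint interiors, such that each face of an element either lies
in the boundary of `D` or is a face of another element. -/
structure Triangulation (D : Set E3) where
  cells : Finset Parallelepiped
  cover : (⋃ K ∈ cells, K.carrier) = closure D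
  disjoint : ∀ K ∈ cells, ∀ K' ∈ cells, K ≠ K' →
    Disjoint (interior K.carrier) (interior K'.carrier)
  adjacent : ∀ K ∈ cells, ∀ i b, K.face i b ⊆ frontier D ∨
    ∃ K' ∈ cells, K' ≠ K ∧ ∃ i' b', K.face i b = K'.face i' b'

/-- The mesh size `h`, the maximal diameter of the elements. -/
def Triangulation.meshSize {D : Set E3} (𝒯 : Triangulation D) : ℝ :=
  sSup ((fun K : Parallelepiped => Metric.diam K.carrier) '' (𝒯.cells : Set Parallelepiped))

/-- Shape regularity with parameter `σ`: every element `K` contains a ball whose diameter `2ρ`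
satisfies `diam K ≤ σ · 2ρ`. -/
def Triangulation.IsShapeRegular {D : Set E3} (𝒯 : Triangulation D) (σ : ℝ) : Prop :=
  ∀ K ∈ 𝒯.cells, ∃ (c : E3) (ρ : ℝ), 0 < ρ ∧ Metric.closedBall c ρ ⊆ K.carrier ∧
    Metric.diam K.carrier ≤ σ * (2 * ρ)

/-- The Lagrange finite element space of degree `k` with periodic boundary conditions: the
functions in `H^1_per` (componentwise) that coincide on every element with a polynomial of degree
at most `k` in each of the three variables. -/
def lagrangeSpace {x : E3} {δ : ℝ} (𝒯 : Triangulation (samplingDomain x δ)) (k N : ℕ) :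
    Set (SobolevSpace (samplingDomain x δ) 1 N) :=
  {u | u ∈ periodicH1 x δ N ∧ ∀ K ∈ 𝒯.cells, ∃ p : Fin N → MvPolynomial (Fin 3) ℝ,
    (∀ c i, (p c).degreeOf i ≤ k) ∧
    ∀ᵐ y ∂(volume.restrict (samplingDomain x δ)), y ∈ K.carrier →
      ∀ c, sobolevFn u y c = MvPolynomial.eval (fun i => y i) (p c)}

/-- `wh : [0,T] → V^h` is differentiable in time and solves the semi-discrete Sobolev equation
`m(∂_t wh(t), v) + r(wh(t), v) = 0` for all `v ∈ V^h` and `t ∈ [0,T]`. -/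
def IsSemiDiscreteSolution {N : ℕ} {x : E3} {δ : ℝ} (k : ℕ) (T : ℝ)
    (A B : E3 → Matrix (Fin N × Fin 3) (Fin N × Fin 3) ℝ)
    (𝒯 : Triangulation (samplingDomain x δ))
    (wh : ℝ → SobolevSpace (samplingDomain x δ) 1 N) : Prop :=
  DifferentiableOn ℝ wh (Icc 0 T) ∧
  ∀ t ∈ Icc 0 T, wh t ∈ lagrangeSpace 𝒯 k N ∧
    ∀ v ∈ lagrangeSpace 𝒯 k N,
      gradForm A (derivWithin wh (Icc 0 T) t) v + gradForm B (wh t) v = 0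

end

noncomputable section

open Filter
open scoped ENNReal NNReal Topology

/-! ### Galerkin error estimates in an abstract Hilbert space. -/

section AbstractEnergy

open InnerProductSpace

variable {Γ : Type*} [NormedAddCommGroup Γ] [InnerProductSpace ℝ Γ]

/-! The error is split by the `m`-orthogonal projection `P` onto the closure of the discrete
gradients. All estimates take place in the Hilbert space `GradSpace` of square integrable fields.
There pointwise ellipticity makes `m` coercive, so only gradients matter and no Poincaré inequality
on the sampling domain is needed.

Let `W` and `Wh` be the gradients of the exact and the discrete solution, `ρ = W - P W` and `θ = P W
- Wh`. Testing the difference of the two equations with `θ` gives `m(θ', θ) = -r(ρ, θ) - r(θ, θ)`,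
because `ρ'` is `m`-orthogonal to `θ`. Since `r` is positive semi-definite, the last term can be
dropped, and the derivative of `‖θ‖_m²` is at most `2 (K/α) ‖ρ‖_m ‖θ‖_m`. The right-hand side is
only linear in `‖θ‖_m`, so `‖θ(t)‖_m ≤ ‖θ(0)‖_m + (K/α) ∫ ‖ρ‖_m`, without an exponential. In (a)
`θ(0) = 0`; in (b) Pythagoras bounds `‖θ(0)‖_m` by the initial error. This is
`galerkin_energy_estimate`.

It remains to bound `‖ρ‖_m`, a best approximation error, by `C h^k |W|`; this is
`exists_lagrange_approx`, proved by nodal interpolation. Four facts carry it.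

Geometry: the adjacency condition forces every cell of a cube to be an axis-parallel box
(`exists_coord_edge_eq_zero`) and the mesh to be a tensor product grid (`interval_eq_or_disjoint`).
Hence tensor product interpolants match across faces.

Local estimate: on the unit cube, Poincaré's inequality and the embedding of `H²` into the
continuous functions give a Bramble–Hilbert lemma (`exists_bramble_hilbert`). Scaling transfers it
to boxes, and shape regularity pays for their anisotropy (`exists_boxInterp_estimate`).

Density: on a convex domain, mollification combined with a contraction yields smooth approximations
up to the boundary (`exists_smooth_tendsto`). Since `k + 1 ≥ 2`, they converge uniformly, which
defines the nodal values.

Periodicity: the uniform limit agrees on opposite faces (`eq_on_opposite_faces`), so its piecewise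
interpolant satisfies Green's formula without boundary terms and lies, up to a constant, in the
periodic finite element space (`exists_mem_lagrangeSpace`). -/

theorem bilin_cauchySchwarz {m : Γ →L[ℝ] Γ →L[ℝ] ℝ} (hsymm : ∀ F G, m F G = m G F)
    (hpos : ∀ F, 0 ≤ m F F) (F G : Γ) : m F G ≤ √(m F F) * √(m G G) := by
  have h : (m F G) ^ 2 ≤ m F F * m G G := by
    have h0 : ∀ t : ℝ, 0 ≤ m G G * (t * t) + (2 * m F G) * t + m F F := fun t => by
      have := hpos (F + t • G)
      simp only [map_add, map_smul, _root_.add_apply, _root_.smul_apply,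
        smul_eq_mul, hsymm G F] at this
      linarith
    have := discrim_le_zero h0
    simp only [discrim] at this
    nlinarith
  rw [← Real.sqrt_mul (hpos F)]
  exact Real.le_sqrt_of_sq_le h

theorem sqrt_bilin_add_le {m : Γ →L[ℝ] Γ →L[ℝ] ℝ} (hsymm : ∀ F G, m F G = m G F)
    (hpos : ∀ F, 0 ≤ m F F) (F G : Γ) :
    √(m (F + G) (F + G)) ≤ √(m F F) + √(m G G) := by
  apply Real.sqrt_le_iff.2 ⟨by positivity, ?_⟩
  have h := bilin_cauchySchwarz hsymm hpos F G
  have h1 := Real.sq_sqrt (hpos F)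
  have h2 := Real.sq_sqrt (hpos G)
  simp only [map_add, _root_.add_apply, hsymm G F]
  nlinarith

/-- The Galerkin projection onto the closure of a subspace. -/
theorem exists_galerkin_projection [CompleteSpace Γ] {m : Γ →L[ℝ] Γ →L[ℝ] ℝ} {α : ℝ}
    (hα : 0 < α) (hcoer : ∀ F, α * ‖F‖ ^ 2 ≤ m F F) (S : Submodule ℝ Γ) [CompleteSpace S] :
    ∃ P : Γ →L[ℝ] Γ, (∀ F, P F ∈ S) ∧ ∀ F, ∀ G ∈ S, m (P F) G = m F G := by
  let B : S →L[ℝ] S →L[ℝ] ℝ := m.bilinearComp S.subtypeL S.subtypeL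
  have hB : IsCoercive B := ⟨α, hα, fun u => by
    have := hcoer (u : Γ)
    simp only [B, ContinuousLinearMap.bilinearComp_apply, Submodule.subtypeL_apply]
    calc α * ‖u‖ * ‖u‖ = α * ‖(u : Γ)‖ ^ 2 := by rw [Submodule.coe_norm]; ring
      _ ≤ _ := this⟩
  -- Lax–Milgram on `S`: represent `m F` by its Riesz vector, project that vector to `S`, and invert
  -- the form restricted to `S`.
  let Q : Γ →L[ℝ] S := (hB.continuousLinearEquivOfBilin.symm : S →L[ℝ] S) ∘L
    (S.orthogonalProjectionOnto ∘L continuousLinearMapOfBilin (𝕜 := ℝ) m)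
  refine ⟨S.subtypeL ∘L Q, fun F => (Q F).2, fun F G hG => ?_⟩
  have h := hB.continuousLinearEquivOfBilin_apply (Q F) ⟨G, hG⟩
  simp only [B, ContinuousLinearMap.bilinearComp_apply, Submodule.subtypeL_apply] at h
  rw [ContinuousLinearMap.comp_apply, Submodule.subtypeL_apply, ← h]
  simp only [Q, ContinuousLinearMap.comp_apply, ContinuousLinearEquiv.coe_coe,
    ContinuousLinearEquiv.apply_symm_apply]
  rw [Submodule.inner_orthogonalProjectionOnto_eq_of_mem_right,
    continuousLinearMapOfBilin_apply]

theorem hasDerivWithinAt_bilin_self {m : Γ →L[ℝ] Γ →L[ℝ] ℝ} (hsymm : ∀ F G, m F G = m G F)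
    {f : ℝ → Γ} {f' : Γ} {s : Set ℝ} {t : ℝ} (hf : HasDerivWithinAt f f' s t) :
    HasDerivWithinAt (fun t => m (f t) (f t)) (2 * m f' (f t)) s t := by
  have := (m.hasFDerivAt.comp_hasDerivWithinAt t hf).clm_apply hf
  refine this.congr_deriv ?_
  change m f' (f t) + m (f t) f' = _
  rw [hsymm (f t) f']
  ring

/-- A differential inequality of Gronwall type without exponential growth. -/
theorem sqrt_le_add_integral {φ φ' g : ℝ → ℝ} {T : ℝ}
    (hφ : ∀ t ∈ Icc 0 T, HasDerivWithinAt φ (φ' t) (Icc 0 T) t) (hpos : ∀ t, 0 ≤ φ t)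
    (hg : ContinuousOn g (Icc 0 T)) (hg0 : ∀ t ∈ Icc 0 T, 0 ≤ g t)
    (hle : ∀ t ∈ Icc 0 T, φ' t ≤ 2 * g t * √(φ t)) {t : ℝ} (ht : t ∈ Icc 0 T) :
    √(φ t) ≤ √(φ 0) + ∫ s in (0 : ℝ)..t, g s := by
  -- The square root is not differentiable at zeros of `φ`, so it is shifted by `ε`. Then `√(ε + φ)
  -- - ∫ g` has nonpositive derivative, and `ε → 0` at the end.
  have key : ∀ ε > 0, √(ε + φ t) ≤ √(ε + φ 0) + ∫ s in (0 : ℝ)..t, g s := by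
    intro ε hε
    have h0T : (0 : ℝ) ≤ T := ht.1.trans ht.2
    have hint : IntervalIntegrable g volume 0 T := by
      apply ContinuousOn.intervalIntegrable; rwa [uIcc_of_le h0T]
    have hmono : AntitoneOn (fun t => √(ε + φ t) - ∫ s in (0 : ℝ)..t, g s) (Icc 0 T) := by
      have hder : ∀ t ∈ interior (Icc 0 T), HasDerivAt
          (fun t => √(ε + φ t) - ∫ s in (0 : ℝ)..t, g s)
          (φ' t / (2 * √(ε + φ t)) - g t) t := by
        intro s hs
        rw [interior_Icc] at hs
        have hnhds : Icc 0 T ∈ nhds s := Icc_mem_nhds hs.1 hs.2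
        have h1 : HasDerivAt φ (φ' s) s := (hφ s (Ioo_subset_Icc_self hs)).hasDerivAt hnhds
        have h2 : HasDerivAt (fun t => √(ε + φ t)) (φ' s / (2 * √(ε + φ s))) s :=
          (h1.const_add ε).sqrt (by linarith [hpos s])
        refine h2.sub ?_
        apply intervalIntegral.integral_hasDerivAt_right
        · exact hint.mono_set (by
            rw [uIcc_of_le h0T, uIcc_of_le hs.1.le]; exact Icc_subset_Icc_right hs.2.le)
        · exact hg.stronglyMeasurableAtFilter_nhdsWithin measurableSet_Icc s |>.filter_mono
            (by rw [nhdsWithin_eq_nhds.2 hnhds])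
        · exact hg.continuousAt hnhds
      apply antitoneOn_of_deriv_nonpos (convex_Icc 0 T)
      · apply ContinuousOn.sub
        · apply Real.continuous_sqrt.comp_continuousOn
          exact continuousOn_const.add fun s hs => (hφ s hs).continuousWithinAt
        · have := intervalIntegral.continuousOn_primitive_interval (μ := volume) (f := g)
            (a := 0) (b := T) (by rw [uIcc_of_le h0T]; exact hg.integrableOn_Icc)
          rwa [uIcc_of_le h0T] at this
      · exact fun s hs => (hder s hs).differentiableAt.differentiableWithinAt
      · intro s hs
        rw [(hder s hs).deriv]
        have hs' := interior_subset hs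
        have hp : 0 < √(ε + φ s) := Real.sqrt_pos.2 (by linarith [hpos s])
        rw [sub_nonpos, div_le_iff₀ (by positivity)]
        calc φ' s ≤ 2 * g s * √(φ s) := hle s hs'
          _ ≤ 2 * g s * √(ε + φ s) := by
            have := hg0 s hs'
            gcongr
            linarith
          _ = _ := by ring
    have := hmono (left_mem_Icc.2 h0T) ht ht.1
    simp only [intervalIntegral.integral_same] at this
    linarith
  have hc : ∀ a : ℝ, Filter.Tendsto (fun ε => √(ε + a)) (nhdsWithin 0 (Ioi 0)) (nhds √a) := by
    intro a
    have : Continuous fun ε => √(ε + a) := by fun_prop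
    simpa using (this.tendsto 0).mono_left nhdsWithin_le_nhds
  exact le_of_tendsto_of_tendsto (hc _) ((hc _).add_const _)
    (eventually_nhdsWithin_of_forall fun ε hε => key ε hε)

/-- Energy estimate for the Galerkin approximation of a Sobolev equation. -/
theorem galerkin_energy_estimate [CompleteSpace Γ] {m r : Γ →L[ℝ] Γ →L[ℝ] ℝ} {α K T : ℝ}
    (hα : 0 < α) (hK : 0 ≤ K) (hsymm : ∀ F G, m F G = m G F) (hcoer : ∀ F, α * ‖F‖ ^ 2 ≤ m F F)
    (hr : ∀ F, 0 ≤ r F F) (hrb : ∀ F G, |r F G| ≤ K * ‖F‖ * ‖G‖) (S₀ : Submodule ℝ Γ)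
    {W W' Wh Wh' : ℝ → Γ} (hW : ∀ t ∈ Icc 0 T, HasDerivWithinAt W (W' t) (Icc 0 T) t)
    (hWh : ∀ t ∈ Icc 0 T, HasDerivWithinAt Wh (Wh' t) (Icc 0 T) t)
    (hWeq : ∀ t ∈ Icc 0 T, ∀ v ∈ S₀, m (W' t) v + r (W t) v = 0)
    (hWhS : ∀ t ∈ Icc 0 T, Wh t ∈ S₀)
    (hWheq : ∀ t ∈ Icc 0 T, ∀ v ∈ S₀, m (Wh' t) v + r (Wh t) v = 0)
    {g : ℝ → ℝ} (hg : ContinuousOn g (Icc 0 T))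
    (happ : ∀ t ∈ Icc 0 T, ∃ v ∈ S₀, √(m (W t - v) (W t - v)) ≤ g t) :
    ((∀ v ∈ S₀, m (Wh 0) v = m (W 0) v) → ∀ t ∈ Icc 0 T,
      √(m (W t - Wh t) (W t - Wh t)) ≤ g t + K / α * ∫ s in (0 : ℝ)..t, g s) ∧
    ∀ t ∈ Icc 0 T, √(m (W t - Wh t) (W t - Wh t)) ≤ √(m (W 0 - Wh 0) (W 0 - Wh 0)) +
      (g t + K / α * ∫ s in (0 : ℝ)..t, g s) := by
  have hpos : ∀ F, 0 ≤ m F F := fun F => le_trans (by positivity) (hcoer F)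
  -- Both equations are continuous in the test vector and so extend from `S₀` to its closure.
  have ext : ∀ (a b : Γ →L[ℝ] ℝ), (∀ v ∈ S₀, a v + b v = 0) →
      ∀ v ∈ S₀.topologicalClosure, a v + b v = 0 := by
    intro a b h v hv
    have hcl : IsClosed {v | a v + b v = 0} := isClosed_eq (by fun_prop) continuous_const
    exact (closure_minimal (s := (S₀ : Set Γ)) (fun v hv => h v hv) hcl)
      (by rwa [← Submodule.topologicalClosure_coe])
  -- Passing to the closure supplies the completeness needed for the projection, without knowing
  -- that `S₀` is finite-dimensional.
  set S := S₀.topologicalClosure with hS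
  have hSle : S₀ ≤ S := S₀.le_topologicalClosure
  have : CompleteSpace S := S₀.isClosed_topologicalClosure.completeSpace_coe
  obtain ⟨P, hPS, hP⟩ := exists_galerkin_projection hα hcoer S
  have hPo : ∀ F, ∀ G ∈ S, m (F - P F) G = 0 := fun F G hG => by
    rw [map_sub, _root_.sub_apply, hP F G hG, sub_self]
  have pyth : ∀ F, ∀ G ∈ S, m (F - G) (F - G) = m (F - P F) (F - P F)
      + m (P F - G) (P F - G) := by
    intro F G hG
    have h1 : F - G = (F - P F) + (P F - G) := by abel
    have h2 := hPo F (P F - G) (S.sub_mem (hPS F) hG)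
    have h3 := hsymm (F - P F) (P F - G)
    rw [h1]
    generalize F - P F = a at *
    generalize P F - G = b at *
    simp only [map_add, _root_.add_apply]
    linarith
  -- By Pythagoras `P` is the best approximation in the energy norm, hence no worse than the given
  -- `v`.
  have hρ : ∀ t ∈ Icc 0 T, √(m (W t - P (W t)) (W t - P (W t))) ≤ g t := by
    intro t ht
    obtain ⟨v, hv, hvg⟩ := happ t ht
    refine le_trans (Real.sqrt_le_sqrt ?_) hvg
    rw [pyth (W t) v (hSle hv)]
    linarith [hpos (P (W t) - v)]
  have hg0 : ∀ t ∈ Icc 0 T, 0 ≤ g t := fun t ht => (Real.sqrt_nonneg _).trans (hρ t ht)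
  have hn : ∀ F, ‖F‖ ≤ √(m F F) / √α := by
    intro F
    rw [le_div_iff₀ (Real.sqrt_pos.2 hα)]
    apply Real.le_sqrt_of_sq_le
    rw [mul_pow, Real.sq_sqrt hα.le, mul_comm]
    exact hcoer F
  set θ : ℝ → Γ := fun t => P (W t) - Wh t with hθ
  have hθS : ∀ t ∈ Icc 0 T, θ t ∈ S := fun t ht => S.sub_mem (hPS _) (hSle (hWhS t ht))
  have hθd : ∀ t ∈ Icc 0 T, HasDerivWithinAt θ (P (W' t) - Wh' t) (Icc 0 T) t := fun t ht =>
    (P.hasFDerivAt.comp_hasDerivWithinAt t (hW t ht)).sub (hWh t ht)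
  have main : ∀ t ∈ Icc 0 T, √(m (θ t) (θ t)) ≤ √(m (θ 0) (θ 0)) +
      K / α * ∫ s in (0 : ℝ)..t, g s := by
    intro t ht
    rw [← intervalIntegral.integral_const_mul]
    refine sqrt_le_add_integral (φ := fun t => m (θ t) (θ t)) (g := fun s => K / α * g s)
      (fun t ht => hasDerivWithinAt_bilin_self hsymm (hθd t ht)) (fun t => hpos _)
      (continuousOn_const.mul hg) (fun s hs => mul_nonneg (by positivity) (hg0 s hs)) ?_ ht
    intro s hs
    have e1 := ext (m (W' s)) (r (W s)) (hWeq s hs) (θ s) (hθS s hs)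
    have e2 := ext (m (Wh' s)) (r (Wh s)) (hWheq s hs) (θ s) (hθS s hs)
    have e3 := hP (W' s) (θ s) (hθS s hs)
    -- Splitting `W - Wh = ρ + θ` isolates `r(θ, θ) ≥ 0`, the term that is discarded below. This is
    -- what avoids exponential growth.
    have e4 : r (W s) (θ s) - r (Wh s) (θ s) = r (W s - P (W s)) (θ s) + r (θ s) (θ s) := by
      rw [hθ]; simp only [map_sub, _root_.sub_apply]; ring
    have e5 := (abs_le.1 (hrb (W s - P (W s)) (θ s))).1
    have e6 : K * ‖W s - P (W s)‖ * ‖θ s‖ ≤ K / α * g s * √(m (θ s) (θ s)) := by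
      calc K * ‖W s - P (W s)‖ * ‖θ s‖
          ≤ K * (g s / √α) * (√(m (θ s) (θ s)) / √α) := by
            gcongr
            · exact mul_nonneg hK (div_nonneg (hg0 s hs) (Real.sqrt_nonneg _))
            · exact (hn _).trans (by gcongr; exact hρ s hs)
            · exact hn _
        _ = K / α * g s * √(m (θ s) (θ s)) := by
            have h' : √α ≠ 0 := (Real.sqrt_pos.2 hα).ne'
            field_simp
            rw [Real.sq_sqrt hα.le]
            field_simp
    have e7 : m (P (W' s) - Wh' s) (θ s) = m (P (W' s)) (θ s) - m (Wh' s) (θ s) := by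
      rw [map_sub m, _root_.sub_apply]
    rw [e7, e3]
    linarith [hr (θ s)]
  have tri : ∀ t ∈ Icc 0 T, √(m (W t - Wh t) (W t - Wh t)) ≤ g t + √(m (θ t) (θ t)) := by
    intro t ht
    have := sqrt_bilin_add_le hsymm hpos (W t - P (W t)) (θ t)
    rw [show W t - P (W t) + θ t = W t - Wh t by simp [hθ]] at this
    linarith [hρ t ht]
  refine ⟨fun h0 t ht => ?_, fun t ht => ?_⟩
  · have hz : (0 : ℝ) ∈ Icc 0 T := ⟨le_rfl, ht.1.trans ht.2⟩
    have e := ext (m (Wh 0)) (-(m (W 0))) (fun v hv => by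
      rw [_root_.neg_apply, h0 v hv]; ring) (θ 0) (hθS 0 hz)
    rw [_root_.neg_apply] at e
    -- The initial value solves the same variational problem as `P (W 0)`, and `θ 0` is an
    -- admissible test vector.
    have : m (θ 0) (θ 0) = 0 := by
      have e3 := hP (W 0) (θ 0) (hθS 0 hz)
      have : m (θ 0) (θ 0) = m (P (W 0)) (θ 0) - m (Wh 0) (θ 0) := by
        rw [← _root_.sub_apply, ← map_sub]
      linarith
    have h1 := main t ht
    rw [this, Real.sqrt_zero] at h1
    linarith [tri t ht]
  · have hz : (0 : ℝ) ∈ Icc 0 T := ⟨le_rfl, ht.1.trans ht.2⟩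
    have : √(m (θ 0) (θ 0)) ≤ √(m (W 0 - Wh 0) (W 0 - Wh 0)) := by
      apply Real.sqrt_le_sqrt
      rw [pyth (W 0) (Wh 0) (hSle (hWhS 0 hz))]
      linarith [hpos (W 0 - P (W 0))]
    linarith [tri t ht, main t ht]

end AbstractEnergy

/-! ### The space of gradients -/

/-- The space of all square integrable gradient fields `(F_i)_{i<3}`. -/
abbrev GradSpace (D : Set E3) (N : ℕ) : Type :=
  PiLp 2 (fun _ : Fin 3 => Lp (EuclideanSpace ℝ (Fin N)) 2 (volume.restrict D))

/-- The pointwise values of a gradient field. -/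
def gradFn {D : Set E3} {N : ℕ} (F : GradSpace D N) (y : E3) : Fin N × Fin 3 → ℝ :=
  fun p => F p.2 y p.1

/-- The gradient of an element of `H^m`, `m ≥ 1`, as a bounded operator. -/
def gradL {D : Set E3} {m N : ℕ} (h : 1 ≤ m) : SobolevSpace D m N →L[ℝ] GradSpace D N :=
  (PiLp.continuousLinearEquiv 2 ℝ (fun _ : Fin 3 => Lp (EuclideanSpace ℝ (Fin N)) 2
    (volume.restrict D))).symm.toContinuousLinearMap ∘L
    ContinuousLinearMap.pi fun i =>
      (PiLp.proj 2 (𝕜 := ℝ) (fun _ : MultiIndex m => Lp (EuclideanSpace ℝ (Fin N)) 2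
        (volume.restrict D)) ⟨(MultiIndex.single i).1, (MultiIndex.single i).2.trans h⟩) ∘L
        (SobolevSpace D m N).subtypeL

theorem gradFn_gradL {D : Set E3} {N : ℕ} (u : SobolevSpace D 1 N) :
    gradFn (gradL le_rfl u) = grad u := rfl

theorem gradL_sobolevEmbed {D : Set E3} {m N : ℕ} (h : 1 ≤ m) (u : SobolevSpace D m N) :
    gradL le_rfl (sobolevEmbed h u) = gradL h u := rfl

/-- The components of a gradient field. -/
def gradComp {D : Set E3} {N : ℕ} (p : Fin N × Fin 3) :
    GradSpace D N →L[ℝ] Lp ℝ 2 (volume.restrict D) :=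
  (EuclideanSpace.proj p.1 : EuclideanSpace ℝ (Fin N) →L[ℝ] ℝ).compLpL 2 (volume.restrict D) ∘L
    PiLp.proj 2 (𝕜 := ℝ) (fun _ : Fin 3 => Lp (EuclideanSpace ℝ (Fin N)) 2
        (volume.restrict D)) p.2

theorem coeFn_gradComp {D : Set E3} {N : ℕ} (p : Fin N × Fin 3) (F : GradSpace D N) :
    gradComp p F =ᵐ[volume.restrict D] fun y => gradFn F y p :=
  ContinuousLinearMap.coeFn_compLpL _ _

theorem norm_gradComp_le {D : Set E3} {N : ℕ} (p : Fin N × Fin 3) (F : GradSpace D N) :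
    ‖gradComp p F‖ ≤ ‖F‖ := by
  have h1 : ‖(EuclideanSpace.proj p.1 : EuclideanSpace ℝ (Fin N) →L[ℝ] ℝ)‖ ≤ 1 := by
    apply ContinuousLinearMap.opNorm_le_bound _ zero_le_one
    intro x
    rw [one_mul]
    exact PiLp.norm_apply_le x p.1
  calc ‖gradComp p F‖ ≤ ‖(EuclideanSpace.proj p.1 : EuclideanSpace ℝ (Fin N) →L[ℝ] ℝ)‖ *
        ‖F p.2‖ := ContinuousLinearMap.norm_compLp_le _ _
    _ ≤ 1 * ‖F‖ := by gcongr; exact PiLp.norm_apply_le F p.2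
    _ = ‖F‖ := one_mul _

theorem norm_sq_gradSpace {D : Set E3} {N : ℕ} (F : GradSpace D N) :
    ‖F‖ ^ 2 = ∑ p, ‖gradComp p F‖ ^ 2 := by
  have hL2 : ∀ f : Lp ℝ 2 (volume.restrict D), ‖f‖ ^ 2 = ∫ y in D, f y ^ 2 := fun f => by
    rw [← real_inner_self_eq_norm_sq, L2.inner_def]
    simp [sq]
  rw [PiLp.norm_sq_eq_of_L2, Fintype.sum_prod_type_right]
  refine Finset.sum_congr rfl fun i _ => ?_
  rw [← real_inner_self_eq_norm_sq, L2.inner_def]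
  simp_rw [hL2]
  rw [← integral_finsetSum]
  · apply integral_congr_ae
    have := fun c : Fin N => coeFn_gradComp (c, i) F
    filter_upwards [ae_all_iff.2 this] with y hy
    rw [real_inner_self_eq_norm_sq, EuclideanSpace.norm_sq_eq]
    refine Finset.sum_congr rfl fun c _ => ?_
    rw [hy c, Real.norm_eq_abs, sq_abs]
    rfl
  · intro c _
    exact (Lp.memLp (gradComp (c, i) F)).integrable_sq

/-- A matrix field with bounded measurable entries defines a bounded bilinear form. -/
theorem exists_coeffForm {D : Set E3} {N : ℕ} {A : E3 → Matrix (Fin N × Fin 3) (Fin N × Fin 3) ℝ}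
    (hA : ∀ p q, AEMeasurable (fun y => A y p q) (volume.restrict D)) {c : ℝ} (hc : 0 ≤ c)
    (hb : ∀ᵐ y ∂(volume.restrict D), ∀ p q, |A y p q| ≤ c) :
    ∃ b : GradSpace D N →L[ℝ] GradSpace D N →L[ℝ] ℝ,
      (∀ F G, b F G = ∫ y in D, (A y *ᵥ gradFn F y) ⬝ᵥ gradFn G y) ∧
      ∀ F G, |b F G| ≤ ((N * 3) * (N * 3) * c) * ‖F‖ * ‖G‖ := by
  have hmem : ∀ p q, MemLp (fun y => A y p q) ∞ (volume.restrict D) := fun p q =>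
    memLp_top_of_bound (hA p q).aestronglyMeasurable c (by
      filter_upwards [hb] with y hy using hy p q)
  let a : ∀ p q, Lp ℝ ∞ (volume.restrict D) := fun p q => (hmem p q).toLp
  let μL := (ContinuousLinearMap.mul ℝ ℝ).holderL (volume.restrict D) ∞ 2 2
  have hμ : ∀ p q f, ‖μL (a p q) f‖ ≤ c * ‖f‖ := by
    intro p q f
    have h1 : ‖a p q‖ ≤ c := by
      rw [Lp.norm_toLp]
      refine ENNReal.toReal_le_of_le_ofReal hc ?_
      rw [eLpNorm_exponent_top]
      exact eLpNormEssSup_le_of_ae_bound (by filter_upwards [hb] with y hy using hy p q)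
    calc ‖μL (a p q) f‖ ≤ ‖ContinuousLinearMap.mul ℝ ℝ‖ * ‖a p q‖ * ‖f‖ :=
          ContinuousLinearMap.norm_holder_apply_apply_le _ _ _
      _ ≤ 1 * c * ‖f‖ := by
          gcongr
          exact ContinuousLinearMap.opNorm_mul_le ℝ ℝ
      _ = c * ‖f‖ := by rw [one_mul]
  -- Each entry acts by multiplication `L^∞ × L² → L²`; the form is the sum of the `(3N)²` resulting
  -- inner products, which explains the factor in the bound.
  let b : GradSpace D N →L[ℝ] GradSpace D N →L[ℝ] ℝ := ∑ p, ∑ q,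
    (innerSL ℝ : Lp ℝ 2 (volume.restrict D) →L[ℝ] _ →L[ℝ] ℝ).bilinearComp
      (μL (a p q) ∘L gradComp q) (gradComp p)
  have hbapp : ∀ F G, b F G = ∑ p, ∑ q, inner ℝ (μL (a p q) (gradComp q F)) (gradComp p G) := by
    intro F G
    simp [b]
  refine ⟨b, fun F G => ?_, fun F G => ?_⟩
  · rw [hbapp]
    simp_rw [L2.inner_def]
    have hint : ∀ p q, Integrable (fun y => inner ℝ ((μL (a p q) (gradComp q F) : E3 → ℝ) y)
        (gradComp p G y)) (volume.restrict D) := fun p q => L2.integrable_inner _ _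
    simp_rw [← integral_finsetSum _ (fun q _ => hint _ q)]
    rw [← integral_finsetSum _ (fun p _ => integrable_finsetSum _ (fun q _ => hint p q))]
    apply integral_congr_ae
    have h1 := fun p => coeFn_gradComp p F
    have h2 := fun p => coeFn_gradComp p G
    have h3 : ∀ p q, (μL (a p q) (gradComp q F) : E3 → ℝ) =ᵐ[volume.restrict D]
        fun y => a p q y * gradComp q F y := fun p q =>
      (ContinuousLinearMap.mul ℝ ℝ).coeFn_holder _ _
    have h4 : ∀ p q, (a p q : E3 → ℝ) =ᵐ[volume.restrict D] fun y => A y p q :=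
      fun p q => (hmem p q).coeFn_toLp
    filter_upwards [ae_all_iff.2 h1, ae_all_iff.2 h2,
      ae_all_iff.2 fun p => ae_all_iff.2 (h3 p),
      ae_all_iff.2 fun p => ae_all_iff.2 (h4 p)] with y e1 e2 e3 e4
    simp only [dotProduct, Matrix.mulVec]
    refine Finset.sum_congr rfl fun p _ => ?_
    rw [Finset.sum_mul]
    refine Finset.sum_congr rfl fun q _ => ?_
    rw [e3, e4, e1, e2, real_inner_comm]
    simp
  · rw [hbapp]
    calc |∑ p, ∑ q, inner ℝ (μL (a p q) (gradComp q F)) (gradComp p G)|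
        ≤ ∑ p : Fin N × Fin 3, ∑ q : Fin N × Fin 3, c * ‖F‖ * ‖G‖ := by
          refine (Finset.abs_sum_le_sum_abs _ _).trans (Finset.sum_le_sum fun p _ => ?_)
          refine (Finset.abs_sum_le_sum_abs _ _).trans (Finset.sum_le_sum fun q _ => ?_)
          refine (abs_real_inner_le_norm _ _).trans ?_
          gcongr
          · exact (hμ _ _ _).trans (by gcongr; exact norm_gradComp_le _ _)
          · exact norm_gradComp_le _ _
      _ = _ := by simp; ring

/-! ### The finite element space as a subspace -/

theorem samplingDomain_eq_preimage (x : E3) (δ : ℝ) :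
    samplingDomain x δ = ⋂ i : Fin 3, {y : E3 | x i < y i} ∩ {y | y i < x i + δ} := by
  ext y; simp [samplingDomain]

theorem isOpen_samplingDomain (x : E3) (δ : ℝ) : IsOpen (samplingDomain x δ) := by
  rw [samplingDomain_eq_preimage]
  exact isOpen_iInter_of_finite fun i =>
    (isOpen_lt continuous_const (by fun_prop)).inter (isOpen_lt (by fun_prop) continuous_const)

theorem isBounded_samplingDomain (x : E3) (δ : ℝ) : Bornology.IsBounded (samplingDomain x δ) := by
  have h : (WithLp.ofLp '' samplingDomain x δ : Set (Fin 3 → ℝ)) ⊆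
      Icc (fun i => x i) (fun i => x i + δ) := by
    rintro _ ⟨y, hy, rfl⟩
    exact ⟨fun i => (hy i).1.le, fun i => (hy i).2.le⟩
  have h2 := (isCompact_Icc (a := fun i => x i) (b := fun i => x i + δ)).image
    (PiLp.continuous_toLp 2 (fun _ : Fin 3 => ℝ))
  refine h2.isBounded.subset ?_
  intro y hy
  exact ⟨WithLp.ofLp y, h ⟨y, hy, rfl⟩, rfl⟩

instance isFiniteMeasure_samplingDomain (x : E3) (δ : ℝ) :
    IsFiniteMeasure (volume.restrict (samplingDomain x δ)) :=
  ⟨by rw [Measure.restrict_apply_univ]; exact (isBounded_samplingDomain x δ).measure_lt_top⟩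

theorem memLp_of_continuous {x : E3} {δ : ℝ} {ψ : E3 → ℝ} (h : Continuous ψ) (p : ℝ≥0∞) :
    MemLp ψ p (volume.restrict (samplingDomain x δ)) := by
  obtain ⟨C, hC⟩ := (isBounded_samplingDomain x δ).isCompact_closure.exists_bound_of_continuousOn
    h.continuousOn
  refine (memLp_top_of_bound h.aestronglyMeasurable C ?_).mono_exponent le_top
  filter_upwards [ae_restrict_mem (isOpen_samplingDomain x δ).measurableSet] with y hy
  exact hC y (subset_closure hy)

/-- Periodic test functions have no compact support; boundedness of the cube takes its place. -/
theorem integrable_continuous_smul_Lp {x : E3} {δ : ℝ} {N : ℕ} {ψ : E3 → ℝ} (h : Continuous ψ)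
    (u : Lp (EuclideanSpace ℝ (Fin N)) 2 (volume.restrict (samplingDomain x δ))) :
    Integrable (fun y => ψ y • u y) (volume.restrict (samplingDomain x δ)) :=
  memLp_one_iff_integrable.1 ((Lp.memLp u).smul (memLp_of_continuous h 2))

theorem integral_smul_add_Lp {x : E3} {δ : ℝ} {N : ℕ} {ψ : E3 → ℝ} (h : Continuous ψ)
    (u v : Lp (EuclideanSpace ℝ (Fin N)) 2 (volume.restrict (samplingDomain x δ))) :
    ∫ y in samplingDomain x δ, ψ y • (⇑(u + v) : E3 → EuclideanSpace ℝ (Fin N)) y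
      = (∫ y in samplingDomain x δ, ψ y • u y) + ∫ y in samplingDomain x δ, ψ y • v y := by
  rw [← integral_add (integrable_continuous_smul_Lp h u) (integrable_continuous_smul_Lp h v)]
  apply integral_congr_ae
  filter_upwards [Lp.coeFn_add u v] with y hy
  rw [hy, Pi.add_apply, smul_add]

theorem integral_smul_smul_Lp {x : E3} {δ : ℝ} {N : ℕ} (ψ : E3 → ℝ) (c : ℝ)
    (u : Lp (EuclideanSpace ℝ (Fin N)) 2 (volume.restrict (samplingDomain x δ))) :
    ∫ y in samplingDomain x δ, ψ y • (⇑(c • u) : E3 → EuclideanSpace ℝ (Fin N)) y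
      = c • ∫ y in samplingDomain x δ, ψ y • u y := by
  rw [← integral_smul]
  apply integral_congr_ae
  filter_upwards [Lp.coeFn_smul c u] with y hy
  simp only [hy, Pi.smul_apply]
  rw [smul_comm]

theorem integral_smul_zero_Lp {x : E3} {δ : ℝ} {N : ℕ} (ψ : E3 → ℝ) :
    ∫ y in samplingDomain x δ, ψ y • (⇑(0 : Lp (EuclideanSpace ℝ (Fin N)) 2
      (volume.restrict (samplingDomain x δ))) : E3 → EuclideanSpace ℝ (Fin N)) y = 0 := by
  simpa using integral_smul_smul_Lp (N := N) (x := x) (δ := δ) ψ 0 0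

/-- `H^1_per` as a subspace of `H^1`. -/
def periodicH1Submodule (x : E3) (δ : ℝ) (N : ℕ) :
    Submodule ℝ (SobolevSpace (samplingDomain x δ) 1 N) where
  carrier := periodicH1 x δ N
  zero_mem' := by
    refine ⟨?_, fun φ _ _ i => ?_⟩
    · have := integral_smul_zero_Lp (N := N) (x := x) (δ := δ) (fun _ => 1)
      simp only [one_smul] at this
      exact this
    · have h1 := integral_smul_zero_Lp (N := N) (x := x) (δ := δ) (partialD i φ)
      have h2 := integral_smul_zero_Lp (N := N) (x := x) (δ := δ) φ
      rw [show -∫ y in samplingDomain x δ, φ y • weakPartial i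
        (0 : SobolevSpace (samplingDomain x δ) 1 N) y = 0 from neg_eq_zero.2 h2]
      exact h1
  add_mem' := by
    rintro u v ⟨hu, hu'⟩ ⟨hv, hv'⟩
    refine ⟨?_, fun φ h1 h2 i => ?_⟩
    · have := integral_smul_add_Lp (ψ := fun _ => 1) continuous_const
        (u.1 (MultiIndex.zero 1)) (v.1 (MultiIndex.zero 1))
      simp only [one_smul] at this
      change ∫ y in _, (⇑(u.1 (MultiIndex.zero 1) + v.1 (MultiIndex.zero 1)) : E3 → _) y = 0
      rw [this]
      exact (congrArg₂ (· + ·) hu hv).trans (add_zero 0)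
    · have e1 := integral_smul_add_Lp (contDiff_partialD h1 i).continuous
        (u.1 (MultiIndex.zero 1)) (v.1 (MultiIndex.zero 1))
      have e2 := integral_smul_add_Lp h1.continuous
        (u.1 (MultiIndex.single i)) (v.1 (MultiIndex.single i))
      refine e1.trans (Eq.trans ?_ (congrArg Neg.neg e2).symm)
      rw [neg_add]
      exact congrArg₂ (· + ·) (hu' φ h1 h2 i) (hv' φ h1 h2 i)
  smul_mem' := by
    rintro c u ⟨hu, hu'⟩
    refine ⟨?_, fun φ h1 h2 i => ?_⟩
    · have := integral_smul_smul_Lp (fun _ => 1) c (u.1 (MultiIndex.zero 1))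
      simp only [one_smul] at this
      change ∫ y in _, (⇑(c • u.1 (MultiIndex.zero 1)) : E3 → _) y = 0
      rw [this]
      exact (congrArg (c • ·) hu).trans (smul_zero c)
    · have e1 := integral_smul_smul_Lp (partialD i φ) c (u.1 (MultiIndex.zero 1))
      have e2 := integral_smul_smul_Lp φ c (u.1 (MultiIndex.single i))
      refine e1.trans (Eq.trans ?_ (congrArg Neg.neg e2).symm)
      rw [← smul_neg]
      exact congrArg (c • ·) (hu' φ h1 h2 i)

/-- The finite element space as a subspace of `H^1`. -/
def lagrangeSubmodule {x : E3} {δ : ℝ} (𝒯 : Triangulation (samplingDomain x δ)) (k N : ℕ) :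
    Submodule ℝ (SobolevSpace (samplingDomain x δ) 1 N) where
  carrier := lagrangeSpace 𝒯 k N
  zero_mem' := by
    refine ⟨(periodicH1Submodule x δ N).zero_mem, fun K _ => ⟨fun _ => 0, by simp, ?_⟩⟩
    filter_upwards [Lp.coeFn_zero (EuclideanSpace ℝ (Fin N)) 2
      (volume.restrict (samplingDomain x δ))] with y hy _ c
    change (⇑(0 : Lp (EuclideanSpace ℝ (Fin N)) 2 (volume.restrict (samplingDomain x δ))) :
      E3 → _) y c = _
    rw [hy]
    simp
  add_mem' := by
    rintro u v ⟨hu, hu'⟩ ⟨hv, hv'⟩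
    refine ⟨(periodicH1Submodule x δ N).add_mem hu hv, fun K hK => ?_⟩
    obtain ⟨p, hp, hpe⟩ := hu' K hK
    obtain ⟨q, hq, hqe⟩ := hv' K hK
    refine ⟨fun c => p c + q c, fun c i => (MvPolynomial.degreeOf_add_le _ _ _).trans
      (max_le (hp c i) (hq c i)), ?_⟩
    filter_upwards [hpe, hqe, Lp.coeFn_add (u.1 (MultiIndex.zero 1)) (v.1 (MultiIndex.zero 1))]
      with y h1 h2 h3 hy c
    change (⇑(u.1 (MultiIndex.zero 1) + v.1 (MultiIndex.zero 1)) : E3 → _) y c = _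
    rw [h3, map_add, ← h1 hy c, ← h2 hy c]
    rfl
  smul_mem' := by
    rintro a u ⟨hu, hu'⟩
    refine ⟨(periodicH1Submodule x δ N).smul_mem a hu, fun K hK => ?_⟩
    obtain ⟨p, hp, hpe⟩ := hu' K hK
    refine ⟨fun c => MvPolynomial.C a * p c, fun c i =>
      (MvPolynomial.degreeOf_C_mul_le _ _ _).trans (hp c i), ?_⟩
    filter_upwards [hpe, Lp.coeFn_smul a (u.1 (MultiIndex.zero 1))] with y h1 h3 hy c
    change (⇑(a • u.1 (MultiIndex.zero 1)) : E3 → _) y c = _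
    rw [h3, map_mul, MvPolynomial.eval_C, ← h1 hy c]
    rfl

/-! ### Triangulations of a cube consist of axis-parallel boxes -/

namespace Parallelepiped

/-- The basis formed by the edges. -/
def basis (K : Parallelepiped) : Module.Basis (Fin 3) ℝ E3 :=
  basisOfLinearIndependentOfCardEqFinrank K.indep (by simp)

@[simp]
theorem basis_apply (K : Parallelepiped) (i : Fin 3) : K.basis i = K.edge i := by
  simp [basis]

theorem repr_edge (K : Parallelepiped) (j l : Fin 3) :
    K.basis.repr (K.edge j) l = if j = l then 1 else 0 := by
  rw [← basis_apply, Module.Basis.repr_self, Finsupp.single_apply]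

/-- The local coordinates. -/
def coord (K : Parallelepiped) (y : E3) (i : Fin 3) : ℝ := K.basis.repr (y - K.base) i

theorem coord_add_smul (K : Parallelepiped) (y v : E3) (t : ℝ) (i : Fin 3) :
    K.coord (y + t • v) i = K.coord y i + t * K.basis.repr v i := by
  simp [coord, add_sub_right_comm]

theorem continuous_coord (K : Parallelepiped) (i : Fin 3) : Continuous fun y => K.coord y i := by
  have : Continuous (K.basis.coord i) := LinearMap.continuous_of_finiteDimensional _
  exact this.comp (continuous_id.sub continuous_const)

theorem coord_param (K : Parallelepiped) (s : Fin 3 → ℝ) :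
    K.coord (K.base + ∑ i, s i • K.edge i) = s := by
  funext i
  simp only [coord, add_sub_cancel_left, ← basis_apply]
  rw [Module.Basis.repr_sum_self]

theorem param_coord (K : Parallelepiped) (y : E3) :
    K.base + ∑ i, K.coord y i • K.edge i = y := by
  simp only [coord, ← basis_apply]
  rw [Module.Basis.sum_repr]
  abel

theorem mem_carrier_iff (K : Parallelepiped) (y : E3) :
    y ∈ K.carrier ↔ ∀ i, K.coord y i ∈ Icc (0 : ℝ) 1 := by
  constructor
  · rintro ⟨s, hs, rfl⟩ i
    rw [coord_param]; exact hs i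
  · intro h
    exact ⟨K.coord y, h, (K.param_coord y).symm⟩

theorem mem_face_iff (K : Parallelepiped) (i : Fin 3) (b : Bool) (y : E3) :
    y ∈ K.face i b ↔ (∀ j, K.coord y j ∈ Icc (0 : ℝ) 1) ∧ K.coord y i = if b then 1 else 0 := by
  constructor
  · rintro ⟨s, hs, hb, rfl⟩
    rw [coord_param]; exact ⟨hs, hb⟩
  · intro h
    exact ⟨K.coord y, h.1, h.2, (K.param_coord y).symm⟩

theorem mem_interior_carrier (K : Parallelepiped) {y : E3}
    (h : ∀ i, K.coord y i ∈ Ioo (0 : ℝ) 1) : y ∈ interior K.carrier := by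
  have ho : IsOpen (⋂ i, {y | K.coord y i ∈ Ioo (0 : ℝ) 1}) :=
    isOpen_iInter_of_finite fun i => isOpen_Ioo.preimage (K.continuous_coord i)
  refine interior_maximal (fun z hz => ?_) ho (mem_iInter.2 h)
  rw [mem_carrier_iff]
  exact fun i => Ioo_subset_Icc_self (mem_iInter.1 hz i)

/-- The centre of a face. -/
def faceCenter (K : Parallelepiped) (i : Fin 3) (b : Bool) : E3 :=
  K.base + ∑ j, (if j = i then (if b then 1 else 0) else 1 / 2 : ℝ) • K.edge j

theorem coord_faceCenter (K : Parallelepiped) (i : Fin 3) (b : Bool) (j : Fin 3) :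
    K.coord (K.faceCenter i b) j = if j = i then (if b then 1 else 0) else 1 / 2 := by
  rw [faceCenter, coord_param]

/-- The central symmetry describes the centre of a face through its point set alone, so that two
parametrizations of one face can be compared. -/
theorem reflect_mem_face (K : Parallelepiped) (i : Fin 3) (b : Bool) {y : E3}
    (hy : y ∈ K.face i b) : K.faceCenter i b + (-1 : ℝ) • (y - K.faceCenter i b) ∈ K.face i b := by
  rw [mem_face_iff] at hy ⊢
  have h : ∀ j, K.coord (K.faceCenter i b + (-1 : ℝ) • (y - K.faceCenter i b)) j =
      2 * K.coord (K.faceCenter i b) j - K.coord y j := by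
    intro j
    rw [coord_add_smul]
    simp only [coord, map_sub, Finsupp.coe_sub, Pi.sub_apply]
    ring
  simp only [h, coord_faceCenter]
  refine ⟨fun j => ?_, by rw [hy.2]; cases b <;> norm_num⟩
  by_cases hj : j = i
  · subst hj
    rw [hy.2]
    cases b <;> norm_num
  · have := hy.1 j
    simp only [hj, if_false]
    constructor <;> linarith [this.1, this.2]

theorem faceCenter_add_mem_face (K : Parallelepiped) {i j : Fin 3} (b : Bool) (hj : j ≠ i)
    {t : ℝ} (ht : |t| ≤ 1 / 2) : K.faceCenter i b + t • K.edge j ∈ K.face i b := by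
  rw [abs_le] at ht
  rw [mem_face_iff]
  simp only [coord_add_smul, coord_faceCenter, repr_edge]
  refine ⟨fun l => ?_, by simp [hj]⟩
  by_cases hl : l = i
  · subst hl
    rw [if_neg hj]
    cases b <;> simp
  · rw [if_neg hl]
    by_cases hjl : j = l
    · subst hjl; simp only [if_true]; constructor <;> linarith
    · rw [if_neg hjl]; norm_num

theorem faceCenter_mem_face (K : Parallelepiped) (i : Fin 3) (b : Bool) :
    K.faceCenter i b ∈ K.face i b := by
  obtain ⟨j, hj⟩ := exists_ne i
  simpa using K.faceCenter_add_mem_face b hj (t := 0) (by norm_num)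

theorem face_subset_carrier (K : Parallelepiped) (i : Fin 3) (b : Bool) :
    K.face i b ⊆ K.carrier := fun y hy => by
  rw [mem_face_iff] at hy; rw [mem_carrier_iff]; exact hy.1

/-- A face that is shared by two parallelepipeds has the same centre in both. -/
theorem coord_faceCenter_of_face_eq {K K' : Parallelepiped} {i i' : Fin 3} {b b' : Bool}
    (h : K.face i b = K'.face i' b') {j : Fin 3} (hj : j ≠ i') :
    K'.coord (K.faceCenter i b) j = 1 / 2 := by
  -- Reflecting a point with `j`-th coordinate `1/2 + s` in the other centre `c` gives coordinate `2
  -- c_j - (1/2 + s)`, which must lie in `[0,1]`. The choices `s = ±1/2` force `c_j = 1/2`.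
  have key : ∀ s : ℝ, |s| ≤ 1 / 2 →
      K'.faceCenter i' b' + s • K'.edge j ∈ K'.face i' b' →
      2 * K'.coord (K.faceCenter i b) j - (1 / 2 + s) ∈ Icc (0 : ℝ) 1 := by
    intro s _ hm
    have h1 := K.reflect_mem_face i b (h ▸ hm)
    rw [h, mem_face_iff] at h1
    have h2 := h1.1 j
    have h3 : K'.coord (K'.faceCenter i' b' + s • K'.edge j) j = 1 / 2 + s := by
      rw [coord_add_smul, coord_faceCenter, if_neg hj, repr_edge]
      simp
    have h4 : K'.basis.repr (K'.faceCenter i' b' + s • K'.edge j - K.faceCenter i b) j =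
        1 / 2 + s - K'.coord (K.faceCenter i b) j := by
      rw [← h3]
      simp only [coord, map_sub, Finsupp.coe_sub, Pi.sub_apply]
      ring
    rw [coord_add_smul, h4] at h2
    constructor <;> linarith [h2.1, h2.2]
  have e1 := key (1 / 2) (by rw [abs_of_pos] <;> norm_num)
    (K'.faceCenter_add_mem_face b' hj (by rw [abs_of_pos] <;> norm_num))
  have e2 := key (-(1 / 2)) (by rw [abs_neg, abs_of_pos] <;> norm_num)
    (K'.faceCenter_add_mem_face b' hj (by rw [abs_neg, abs_of_pos] <;> norm_num))
  apply le_antisymm <;> linarith [e1.1, e2.2]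

/-- Two parallelepipeds with a common face that lie on the same side of it overlap. -/
theorem interior_inter_nonempty {K K' : Parallelepiped} {i i' : Fin 3} {b b' : Bool}
    (h : K.face i b = K'.face i' b') {ℓ : E3 →ₗ[ℝ] ℝ} (hℓ : ∀ j ≠ i, ℓ (K.edge j) = 0)
    (hℓ' : ∀ j ≠ i', ℓ (K'.edge j) = 0)
    (hs : (if b then -1 else 1 : ℝ) * ℓ (K.edge i) < 0)
    (hs' : (if b' then -1 else 1 : ℝ) * ℓ (K'.edge i') < 0) :
    (interior K.carrier ∩ interior K'.carrier).Nonempty := by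
  -- The common interior point is found by moving a little from the face centre `f` in the direction
  -- `d` pointing into `K`.
  set f := K.faceCenter i b with hf
  set d := (if b then -1 else 1 : ℝ) • K.edge i with hd
  have hfm : f ∈ K'.face i' b' := h ▸ K.faceCenter_mem_face i b
  rw [mem_face_iff] at hfm
  have hlim : ∀ c r : ℝ, Filter.Tendsto (fun t => c + t * r) (nhdsWithin 0 (Ioi 0)) (nhds c) := by
    intro c r
    have : Continuous fun t : ℝ => c + t * r := by fun_prop
    simpa using (this.tendsto 0).mono_left nhdsWithin_le_nhds
  -- A local coordinate starting at `1/2` stays in `(0,1)` for small times; one starting at `0` or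
  -- `1` enters it if its speed has the right sign.
  have hev : ∀ c r : ℝ, ∀ b : Bool, (c = 1 / 2 ∨ (c = if b then 1 else 0) ∧
      0 < (if b then -1 else 1 : ℝ) * r) →
      ∀ᶠ t in nhdsWithin (0 : ℝ) (Ioi 0), c + t * r ∈ Ioo (0 : ℝ) 1 := by
    intro c r b hc
    rcases hc with rfl | ⟨rfl, hr⟩
    · exact (hlim _ r).eventually (Ioo_mem_nhds (by norm_num) (by norm_num))
    · have h1 := (hlim (if b then 1 else 0) r).eventually
        (Ioo_mem_nhds (a := -1) (b := 2) (by split_ifs <;> norm_num) (by split_ifs <;> norm_num))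
      have h2 := (hlim 0 r).eventually
        (Ioo_mem_nhds (a := -1) (b := 1) (by norm_num) (by norm_num))
      filter_upwards [h1, h2, self_mem_nhdsWithin] with t ht ht2 ht0
      have ht0 : 0 < t := ht0
      cases b
      · simp only [Bool.false_eq_true, if_false, one_mul, zero_add, mem_Ioo] at *
        exact ⟨by positivity, ht2.2⟩
      · simp only [if_true, mem_Ioo, zero_add, neg_mul, one_mul] at *
        constructor
        · linarith [ht2.1]
        · nlinarith
  have e1 : ∀ j, ∀ᶠ t in nhdsWithin (0 : ℝ) (Ioi 0), K.coord (f + t • d) j ∈ Ioo (0 : ℝ) 1 := by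
    intro j
    simp only [coord_add_smul]
    apply hev _ _ b
    rw [hf, coord_faceCenter]
    by_cases hj : j = i
    · subst hj
      right
      refine ⟨by simp, ?_⟩
      rw [hd, map_smul, Finsupp.smul_apply, repr_edge]
      cases b <;> simp
    · left; rw [if_neg hj]
  have e2 : ∀ j, ∀ᶠ t in nhdsWithin (0 : ℝ) (Ioi 0), K'.coord (f + t • d) j ∈ Ioo (0 : ℝ) 1 := by
    intro j
    simp only [coord_add_smul]
    apply hev _ _ b'
    by_cases hj : j = i'
    · subst hj
      right
      refine ⟨hfm.2, ?_⟩
      -- Only the edge of `K'` transversal to the face is seen by `ℓ`. As `ℓ` decreases along `d`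
      -- and along the inward edge of `K'`, the direction `d` also points into `K'`.
      have h1 : ℓ d = K'.basis.repr d j * ℓ (K'.edge j) := by
        conv_lhs => rw [← K'.basis.sum_repr d]
        rw [map_sum, Finset.sum_eq_single j]
        · simp
        · intro l _ hl
          rw [map_smul, basis_apply, hℓ' l hl, smul_zero]
        · simp
      have h2 : ℓ d < 0 := by rw [hd, map_smul]; exact hs
      rw [h1] at h2
      cases b'
      · simp only [Bool.false_eq_true, if_false, one_mul] at *
        by_contra hc
        push Not at hc
        linarith [mul_nonneg_of_nonpos_of_nonpos hc hs'.le]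
      · simp only [if_true, neg_mul, one_mul] at *
        by_contra hc
        push Not at hc
        linarith [mul_nonneg (show 0 ≤ K'.basis.repr d j by linarith)
          (show 0 ≤ ℓ (K'.edge j) by linarith)]
    · left; exact coord_faceCenter_of_face_eq h hj
  obtain ⟨t, h1, h2⟩ := ((Filter.eventually_all.2 e1).and (Filter.eventually_all.2 e2)).exists
  exact ⟨f + t • d, K.mem_interior_carrier h1, K'.mem_interior_carrier h2⟩

end Parallelepiped

/-- The closed box `∏ [a_i, b_i]`. -/
def cbox (a b : Fin 3 → ℝ) : Set E3 := {y | ∀ i, y i ∈ Icc (a i) (b i)}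

/-- The open box `∏ (a_i, b_i)`. -/
def obox (a b : Fin 3 → ℝ) : Set E3 := {y | ∀ i, y i ∈ Ioo (a i) (b i)}

theorem samplingDomain_eq_obox (x : E3) (δ : ℝ) :
    samplingDomain x δ = obox (fun i => x i) (fun i => x i + δ) := rfl

theorem isOpen_obox (a b : Fin 3 → ℝ) : IsOpen (obox a b) := by
  have : obox a b = ⋂ i : Fin 3, {y : E3 | y i ∈ Ioo (a i) (b i)} := by ext y; simp [obox]
  rw [this]
  exact isOpen_iInter_of_finite fun i => isOpen_Ioo.preimage (by fun_prop)

theorem isClosed_cbox (a b : Fin 3 → ℝ) : IsClosed (cbox a b) := by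
  have : cbox a b = ⋂ i : Fin 3, {y : E3 | y i ∈ Icc (a i) (b i)} := by ext y; simp [cbox]
  rw [this]
  exact isClosed_iInter fun i => isClosed_Icc.preimage (by fun_prop)

theorem obox_subset_cbox (a b : Fin 3 → ℝ) : obox a b ⊆ cbox a b :=
  fun _ hy i => Ioo_subset_Icc_self (hy i)

theorem obox_subset_interior_cbox (a b : Fin 3 → ℝ) : obox a b ⊆ interior (cbox a b) :=
  interior_maximal (obox_subset_cbox a b) (isOpen_obox a b)

theorem closure_obox {a b : Fin 3 → ℝ} (h : ∀ i, a i < b i) : closure (obox a b) = cbox a b := by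
  apply subset_antisymm
  · exact closure_minimal (obox_subset_cbox a b) (isClosed_cbox a b)
  · intro y hy
    let c : E3 := WithLp.toLp 2 fun i => (a i + b i) / 2
    -- Contracting towards the centre `c` moves any point of the closed box into the open one.
    have hlim : Filter.Tendsto (fun t : ℝ => y + t • (c - y)) (nhdsWithin 0 (Ioi 0)) (nhds y) := by
      have : Continuous fun t : ℝ => y + t • (c - y) := by fun_prop
      simpa using (this.tendsto 0).mono_left nhdsWithin_le_nhds
    refine mem_closure_of_tendsto hlim ?_
    filter_upwards [Ioo_mem_nhdsGT (show (0 : ℝ) < 1 by norm_num)] with t ht i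
    have h1 := hy i
    have h2 := h i
    have hc : (y + t • (c - y)) i = (1 - t) * y i + t * ((a i + b i) / 2) := by
      simp [c]; ring
    rw [hc]
    constructor
    · nlinarith [h1.1, ht.1, ht.2]
    · nlinarith [h1.2, ht.1, ht.2]

theorem closure_samplingDomain (x : E3) {δ : ℝ} (hδ : 0 < δ) :
    closure (samplingDomain x δ) = cbox (fun i => x i) (fun i => x i + δ) := by
  rw [samplingDomain_eq_obox, closure_obox]
  intro i; linarith

/-! ### Cells of a triangulated cube have axis-parallel edges. -/

namespace Triangulation

variable {x : E3} {δ : ℝ}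

theorem carrier_subset (𝒯 : Triangulation (samplingDomain x δ)) (hδ : 0 < δ) {K : Parallelepiped}
    (hK : K ∈ 𝒯.cells) : K.carrier ⊆ cbox (fun i => x i) (fun i => x i + δ) := by
  rw [← closure_samplingDomain x hδ, ← 𝒯.cover]
  exact subset_biUnion_of_mem (u := fun K : Parallelepiped => K.carrier) hK

/-- Every pair of edges of a cell is orthogonal to a coordinate direction. -/
theorem exists_coord_edge_eq_zero (𝒯 : Triangulation (samplingDomain x δ)) (hδ : 0 < δ)
    {K : Parallelepiped} (hK : K ∈ 𝒯.cells) (i : Fin 3) :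
    ∃ m : Fin 3, ∀ j ≠ i, K.edge j m = 0 := by
  classical
  -- `ℓ` vanishes on the two edges other than `i`. The aim is to show that some coordinate function
  -- is a multiple of `ℓ`.
  set ℓ : E3 →ₗ[ℝ] ℝ := K.basis.coord i with hℓ
  have hℓi : ℓ (K.edge i) = 1 := by rw [hℓ, Module.Basis.coord_apply, K.repr_edge, if_pos rfl]
  have hℓj : ∀ j ≠ i, ℓ (K.edge j) = 0 := fun j hj => by
    rw [hℓ, Module.Basis.coord_apply, K.repr_edge, if_neg hj]
  let val : Parallelepiped × Fin 3 × Bool → ℝ := fun q => ℓ (q.1.faceCenter q.2.1 q.2.2)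
  let S : Finset (Parallelepiped × Fin 3 × Bool) :=
    (𝒯.cells ×ˢ Finset.univ).filter fun q => ∀ j ≠ q.2.1, ℓ (q.1.edge j) = 0
  have hS : S.Nonempty := ⟨(K, i, false), by
    simp only [S, Finset.mem_filter, Finset.mem_product, Finset.mem_univ, and_true]
    exact ⟨hK, hℓj⟩⟩
  -- Among all faces of all cells that are parallel to the kernel of `ℓ`, take one on which `ℓ` is
  -- largest; it turns out to lie in the boundary of the cube.
  obtain ⟨⟨K', i', b'⟩, hq, hmax⟩ := S.exists_max_image val hS
  have memS : ∀ {L : Parallelepiped} {l : Fin 3} {b : Bool}, (L, l, b) ∈ S ↔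
      L ∈ 𝒯.cells ∧ ∀ j ≠ l, ℓ (L.edge j) = 0 := by
    intro L l b
    simp only [S, Finset.mem_filter, Finset.mem_product, Finset.mem_univ, and_true]
  obtain ⟨hK', hℓ'⟩ := memS.1 hq
  have hne : ∀ {L : Parallelepiped} {l : Fin 3}, (∀ j ≠ l, ℓ (L.edge j) = 0) → ℓ (L.edge l) ≠ 0 := by
    intro L l hl h0
    have : ℓ = 0 := L.basis.ext fun j => by
      rw [L.basis_apply]
      by_cases hj : j = l
      · subst hj; simpa using h0
      · simpa using hl j hj
    rw [this] at hℓi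
    simp at hℓi
  have hopp : ∀ (L : Parallelepiped) (l : Fin 3) (b : Bool),
      L.faceCenter l (!b) = L.faceCenter l b + (if b then -1 else 1 : ℝ) • L.edge l := by
    intro L l b
    simp only [Parallelepiped.faceCenter, add_assoc, add_right_inj]
    have : (if b then -1 else 1 : ℝ) • L.edge l =
        ∑ j, (if j = l then (if b then -1 else 1 : ℝ) else 0) • L.edge j := by simp
    rw [this, ← Finset.sum_add_distrib]
    refine Finset.sum_congr rfl fun j _ => ?_
    rw [← add_smul]
    congr 1
    by_cases hj : j = l <;> cases b <;> simp [hj]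
  -- The opposite face of the same cell also competes in the maximum, so `ℓ` decreases from a
  -- maximal face into its cell.
  have hdir : ∀ {L : Parallelepiped} {l : Fin 3} {b : Bool}, (L, l, b) ∈ S →
      val (L, l, b) = val (K', i', b') → (if b then -1 else 1 : ℝ) * ℓ (L.edge l) < 0 := by
    intro L l b hL hv
    have h1 := hmax (L, l, !b) (memS.2 (memS.1 hL))
    rw [← hv] at h1
    simp only [val] at h1
    rw [hopp, map_add, map_smul, smul_eq_mul] at h1
    have h2 : (if b then -1 else 1 : ℝ) * ℓ (L.edge l) ≠ 0 :=
      mul_ne_zero (by split_ifs <;> norm_num) (hne (memS.1 hL).2)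
    exact lt_of_le_of_ne (by linarith) h2
  have hfr : K'.face i' b' ⊆ frontier (samplingDomain x δ) := by
    rcases 𝒯.adjacent K' hK' i' b' with h | ⟨K'', hK'', hKK, i'', b'', hface⟩
    · exact h
    exfalso
    -- If the maximal face were shared, then `ℓ` would be constant on it, the neighbour would have
    -- it as a maximal face too, and both cells would lie on the same side and overlap.
    have hconst : ∀ y ∈ K'.face i' b', ℓ y = val (K', i', b') := by
      intro y hy
      rw [Parallelepiped.mem_face_iff] at hy
      have : ∀ z, ℓ z = ℓ K'.base + ∑ j, K'.coord z j * ℓ (K'.edge j) := by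
        intro z
        conv_lhs => rw [← K'.param_coord z]
        simp
      simp only [val]
      rw [this, this (K'.faceCenter i' b')]
      congr 1
      refine Finset.sum_congr rfl fun j _ => ?_
      by_cases hj : j = i'
      · subst hj; rw [hy.2, K'.coord_faceCenter, if_pos rfl]
      · rw [hℓ' j hj, mul_zero, mul_zero]
    have hℓ'' : ∀ j ≠ i'', ℓ (K''.edge j) = 0 := by
      intro j hj
      have h1 := hconst _ (hface ▸ K''.faceCenter_mem_face i'' b'')
      have h2 := hconst _ (hface ▸ K''.faceCenter_add_mem_face b'' hj (t := 1 / 2)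
        (by rw [abs_of_pos] <;> norm_num))
      rw [map_add, map_smul, smul_eq_mul] at h2
      linarith
    have hS'' : (K'', i'', b'') ∈ S := memS.2 ⟨hK'', hℓ''⟩
    have := Parallelepiped.interior_inter_nonempty hface hℓ' hℓ'' (hdir hq rfl)
      (hdir hS'' (hconst _ (hface ▸ K''.faceCenter_mem_face i'' b'')))
    exact this.not_disjoint (𝒯.disjoint K' hK' K'' hK'' (Ne.symm hKK))
  set f := K'.faceCenter i' b' with hf
  have hf1 : f ∈ frontier (samplingDomain x δ) := hfr (K'.faceCenter_mem_face i' b')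
  have hf2 : f ∉ samplingDomain x δ := by
    rw [(isOpen_samplingDomain x δ).frontier_eq] at hf1
    exact hf1.2
  have hsub : K'.face i' b' ⊆ cbox (fun i => x i) (fun i => x i + δ) :=
    (K'.face_subset_carrier i' b').trans (𝒯.carrier_subset hδ hK')
  have hfc := hsub (K'.faceCenter_mem_face i' b')
  -- The face centre lies in the closed cube but not in the open one, so one of its coordinates is
  -- extremal.
  have : ∃ m, f m = x m ∨ f m = x m + δ := by
    by_contra hcon
    push Not at hcon
    exact hf2 fun m => ⟨lt_of_le_of_ne (hfc m).1 (Ne.symm (hcon m).1),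
      lt_of_le_of_ne (hfc m).2 (hcon m).2⟩
  obtain ⟨m, hm⟩ := this
  -- Going half an edge forwards and backwards from `f` stays in the cube, although the `m`-th
  -- coordinate is already extremal at `f`.
  have hedge : ∀ j ≠ i', K'.edge j m = 0 := by
    intro j hj
    have h1 := hsub (K'.faceCenter_add_mem_face b' hj (t := 1 / 2)
        (by rw [abs_of_pos] <;> norm_num)) m
    have h2 := hsub (K'.faceCenter_add_mem_face b' hj (t := -(1 / 2))
        (by rw [abs_neg, abs_of_pos] <;> norm_num)) m
    rw [← hf] at h1 h2
    simp only [PiLp.add_apply, PiLp.smul_apply, smul_eq_mul, mem_Icc] at h1 h2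
    rcases hm with hm | hm <;> linarith [h1.1, h1.2, h2.1, h2.2]
  refine ⟨m, fun j hj => ?_⟩
  set c : E3 →ₗ[ℝ] ℝ := (EuclideanSpace.proj m : E3 →L[ℝ] ℝ).toLinearMap with hc
  -- The `m`-th coordinate and `ℓ` both vanish on the two edges spanning the face, hence are
  -- proportional. So the `m`-th coordinate vanishes wherever `ℓ` does, in particular on the edges
  -- of the original `K`.
  have : c = (K'.edge i' m / ℓ (K'.edge i')) • ℓ := K'.basis.ext fun l => by
    rw [K'.basis_apply]
    by_cases hl : l = i'
    · subst hl
      simp [hc, div_mul_cancel₀ _ (hne hℓ')]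
    · simp [hc, hedge l hl, hℓ' l hl]
  have h2 := LinearMap.congr_fun this (K.edge j)
  simpa [hc, hℓj j hj] using h2

end Triangulation

/-- The face `{y_i = v}` of the box `∏ [a_i, b_i]`. -/
def boxFace (a b : Fin 3 → ℝ) (i : Fin 3) (v : ℝ) : Set E3 :=
  cbox (Function.update a i v) (Function.update b i v)

theorem mem_boxFace {a b : Fin 3 → ℝ} {i : Fin 3} {v : ℝ} (hv : v ∈ Icc (a i) (b i)) {y : E3} :
    y ∈ boxFace a b i v ↔ y ∈ cbox a b ∧ y i = v := by
  constructor
  · intro h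
    have hi := h i
    simp only [Function.update_self, Icc_self, mem_singleton_iff] at hi
    refine ⟨fun j => ?_, hi⟩
    by_cases hj : j = i
    · subst hj; rw [hi]; exact hv
    · simpa [Function.update_of_ne hj] using h j
  · rintro ⟨h, hi⟩ j
    by_cases hj : j = i
    · subst hj; simp [hi]
    · simpa [Function.update_of_ne hj] using h j

theorem cbox_injective {a b a' b' : Fin 3 → ℝ} (h : ∀ i, a i ≤ b i) (h' : ∀ i, a' i ≤ b' i)
    (he : cbox a b = cbox a' b') : a = a' ∧ b = b' := by
  have h1 : (WithLp.toLp 2 a : E3) ∈ cbox a' b' := he ▸ fun i => ⟨le_rfl, h i⟩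
  have h2 : (WithLp.toLp 2 b : E3) ∈ cbox a' b' := he ▸ fun i => ⟨h i, le_rfl⟩
  have h3 : (WithLp.toLp 2 a' : E3) ∈ cbox a b := he ▸ fun i => ⟨le_rfl, h' i⟩
  have h4 : (WithLp.toLp 2 b' : E3) ∈ cbox a b := he ▸ fun i => ⟨h' i, le_rfl⟩
  exact ⟨funext fun i => le_antisymm (h3 i).1 (h1 i).1,
    funext fun i => le_antisymm (h2 i).2 (h4 i).2⟩

/-- For two cells sharing a face this yields the same normal direction, the same position and the
same cross section. The direction is determined because it is the only one in which the face is
degenerate. -/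
theorem boxFace_injective {a b a' b' : Fin 3 → ℝ} {i i' : Fin 3} {v v' : ℝ} (h : ∀ i, a i < b i)
    (h' : ∀ i, a' i < b' i) (he : boxFace a b i v = boxFace a' b' i' v') :
    i = i' ∧ v = v' ∧ ∀ j ≠ i, a' j = a j ∧ b' j = b j := by
  have hle : ∀ {a b : Fin 3 → ℝ} (i : Fin 3) (v : ℝ), (∀ i, a i < b i) →
      ∀ j, Function.update a i v j ≤ Function.update b i v j := by
    intro a b i v h j
    by_cases hj : j = i
    · subst hj; simp
    · simpa [Function.update_of_ne hj] using (h j).le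
  obtain ⟨e1, e2⟩ := cbox_injective (hle i v h) (hle i' v' h') he
  have hi : i = i' := by
    by_contra hne
    have f1 := congrFun e1 i
    have f2 := congrFun e2 i
    simp only [Function.update_self, Function.update_of_ne hne] at f1 f2
    linarith [h' i]
  subst hi
  refine ⟨rfl, by simpa using congrFun e1 i, fun j hj => ?_⟩
  have f1 := congrFun e1 j
  have f2 := congrFun e2 j
  simp only [Function.update_of_ne hj] at f1 f2
  exact ⟨f1.symm, f2.symm⟩

/-- The parallelepiped `K` is the box `∏ [a_i, b_i]`. -/
structure Parallelepiped.IsBox (K : Parallelepiped) (a b : Fin 3 → ℝ) : Prop where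
  lt : ∀ i, a i < b i
  carrier_eq : K.carrier = cbox a b
  exists_face : ∀ i v, v = a i ∨ v = b i → ∃ j c, K.face j c = boxFace a b i v
  face_eq : ∀ j c, ∃ i v, (v = a i ∨ v = b i) ∧ K.face j c = boxFace a b i v

/-- The hypothesis assigns to each edge `i` a coordinate `π i` that vanishes on the other two edges.
Every coordinate is nonzero on some edge, so `π` is injective, hence a permutation, and edge `i` is
parallel to the axis `π i`. -/
theorem Parallelepiped.exists_isBox (K : Parallelepiped)
    (h : ∀ i, ∃ m : Fin 3, ∀ j ≠ i, K.edge j m = 0) : ∃ a b, K.IsBox a b := by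
  choose π hπ using h
  have hspan : ∀ m : Fin 3, ∃ j, K.edge j m ≠ 0 := by
    intro m
    by_contra hcon
    push Not at hcon
    have : (EuclideanSpace.proj m : E3 →L[ℝ] ℝ).toLinearMap = 0 := K.basis.ext fun j => by
      rw [K.basis_apply]; simpa using hcon j
    have := LinearMap.congr_fun this (EuclideanSpace.single m 1)
    simp at this
  have hinj : Function.Injective π := by
    intro i i' hii
    by_contra hne
    obtain ⟨j, hj⟩ := hspan (π i)
    by_cases hji : j = i
    · subst hji; exact hj (hii ▸ hπ i' j hne)
    · exact hj (hπ i j hji)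
  let e : Fin 3 ≃ Fin 3 := Equiv.ofBijective π hinj.bijective_of_finite
  let c : Fin 3 → ℝ := fun m => K.edge (e.symm m) m
  have hz : ∀ m j, j ≠ e.symm m → K.edge j m = 0 := by
    intro m j hj
    have := hπ (e.symm m) j hj
    rwa [show π (e.symm m) = m from e.apply_symm_apply m] at this
  have hc : ∀ m, c m ≠ 0 := by
    intro m
    obtain ⟨j, hj⟩ := hspan m
    by_cases h : j = e.symm m
    · subst h; exact hj
    · exact absurd (hz m j h) hj
  have hy : ∀ (y : E3) m, y m = K.base m + K.coord y (e.symm m) * c m := by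
    intro y m
    have : y m = (K.base + ∑ i, K.coord y i • K.edge i) m := by rw [K.param_coord]
    rw [this, PiLp.add_apply, WithLp.ofLp_sum, Finset.sum_apply, Finset.sum_eq_single (e.symm m)]
    · simp [c]
    · intro j _ hj
      simp [hz m j hj]
    · simp
  -- An edge may point in the negative direction of its axis, hence the minimum and maximum.
  let a : Fin 3 → ℝ := fun m => min (K.base m) (K.base m + c m)
  let b : Fin 3 → ℝ := fun m => max (K.base m) (K.base m + c m)
  have hlt : ∀ m, a m < b m := by
    intro m
    simp only [a, b, min_lt_max, ne_eq]
    intro h0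
    exact hc m (by linarith)
  have hIcc : ∀ (y : E3) m, K.coord y (e.symm m) ∈ Icc (0 : ℝ) 1 ↔ y m ∈ Icc (a m) (b m) := by
    intro y m
    rw [hy y m]
    simp only [a, b]
    generalize K.coord y (e.symm m) = s
    rcases lt_or_gt_of_ne (hc m) with h | h
    · rw [min_eq_right (by linarith), max_eq_left (by linarith)]
      constructor
      · rintro ⟨h1, h2⟩; constructor <;> nlinarith
      · rintro ⟨h1, h2⟩; constructor <;> nlinarith
    · rw [min_eq_left (by linarith), max_eq_right (by linarith)]
      constructor
      · rintro ⟨h1, h2⟩; constructor <;> nlinarith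
      · rintro ⟨h1, h2⟩; constructor <;> nlinarith
  have hcar : ∀ y : E3, (∀ j, K.coord y j ∈ Icc (0 : ℝ) 1) ↔ y ∈ cbox a b := by
    intro y
    rw [← e.symm.forall_congr_right]
    exact forall_congr' fun m => hIcc y m
  have hface : ∀ m (t : Bool), K.face (e.symm m) t =
      boxFace a b m (if t then K.base m + c m else K.base m) := by
    intro m t
    ext y
    rw [K.mem_face_iff, hcar, mem_boxFace]
    · refine and_congr Iff.rfl ?_
      rw [hy y m]
      cases t
      · simp [hc m]
      · simp [hc m]
    · cases t <;> simp [a, b]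
  refine ⟨a, b, hlt, ?_, ?_, ?_⟩
  · ext y; rw [K.mem_carrier_iff, hcar]
  · intro i v hv
    have : v = K.base i ∨ v = K.base i + c i := by
      simp only [a, b] at hv
      rcases le_total (K.base i) (K.base i + c i) with h | h
      · rwa [min_eq_left h, max_eq_right h] at hv
      · rw [min_eq_right h, max_eq_left h] at hv; exact hv.symm
    rcases this with h | h
    · exact ⟨e.symm i, false, by rw [hface, h]; simp⟩
    · exact ⟨e.symm i, true, by rw [hface, h]; simp⟩
  · intro j t
    refine ⟨e j, if t then K.base (e j) + c (e j) else K.base (e j), ?_, ?_⟩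
    · simp only [a, b]
      rcases le_total (K.base (e j)) (K.base (e j) + c (e j)) with h | h
      · rw [min_eq_left h, max_eq_right h]; cases t <;> simp
      · rw [min_eq_right h, max_eq_left h]; cases t <;> simp
    · rw [← hface, e.symm_apply_apply]

/-! ### The mesh is a tensor product grid. -/

namespace Triangulation

variable {x : E3} {δ : ℝ}

theorem exists_boxes (𝒯 : Triangulation (samplingDomain x δ)) (hδ : 0 < δ) :
    ∃ lo hi : Parallelepiped → Fin 3 → ℝ, ∀ K ∈ 𝒯.cells, K.IsBox (lo K) (hi K) := by
  have : ∀ K : Parallelepiped, ∃ a b, K ∈ 𝒯.cells → K.IsBox a b := by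
    intro K
    by_cases hK : K ∈ 𝒯.cells
    · obtain ⟨a, b, h⟩ := K.exists_isBox fun i => 𝒯.exists_coord_edge_eq_zero hδ hK i
      exact ⟨a, b, fun _ => h⟩
    · exact ⟨0, 0, fun h => absurd h hK⟩
  choose lo hi h using this
  exact ⟨lo, hi, h⟩

section Boxes

variable {𝒯 : Triangulation (samplingDomain x δ)} {lo hi : Parallelepiped → Fin 3 → ℝ}

theorem le_lo_and_hi_le (hδ : 0 < δ) (hbox : ∀ K ∈ 𝒯.cells, K.IsBox (lo K) (hi K))
    {K : Parallelepiped} (hK : K ∈ 𝒯.cells) (i : Fin 3) : x i ≤ lo K i ∧ hi K i ≤ x i + δ := by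
  have h := 𝒯.carrier_subset hδ hK
  rw [(hbox K hK).carrier_eq] at h
  have h1 : (WithLp.toLp 2 (lo K) : E3) ∈ cbox (lo K) (hi K) :=
    fun i => ⟨le_rfl, ((hbox K hK).lt i).le⟩
  have h2 : (WithLp.toLp 2 (hi K) : E3) ∈ cbox (lo K) (hi K) :=
    fun i => ⟨((hbox K hK).lt i).le, le_rfl⟩
  exact ⟨(h h1 i).1, (h h2 i).2⟩

/-- A point of the closed box of `K'` is a limit of points of its open box. If it lies in the open
box of `K`, the two interiors meet. -/
theorem eq_of_obox_inter_cbox (hbox : ∀ K ∈ 𝒯.cells, K.IsBox (lo K) (hi K))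
    {K K' : Parallelepiped} (hK : K ∈ 𝒯.cells) (hK' : K' ∈ 𝒯.cells)
    (h : (obox (lo K) (hi K) ∩ cbox (lo K') (hi K')).Nonempty) : K = K' := by
  by_contra hne
  obtain ⟨y, hy, hy'⟩ := h
  rw [← closure_obox (hbox K' hK').lt] at hy'
  obtain ⟨z, hz, hz'⟩ := mem_closure_iff.1 hy' _ (isOpen_obox _ _) hy
  have hd := 𝒯.disjoint K hK K' hK' hne
  rw [(hbox K hK).carrier_eq, (hbox K' hK').carrier_eq] at hd
  exact hd.le_bot ⟨obox_subset_interior_cbox _ _ hz, obox_subset_interior_cbox _ _ hz'⟩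

/-- Across a face in the interior of the cube there is an element with the same cross section. -/
theorem exists_neighbour (hδ : 0 < δ) (hbox : ∀ K ∈ 𝒯.cells, K.IsBox (lo K) (hi K))
    {K : Parallelepiped} (hK : K ∈ 𝒯.cells) {i : Fin 3} {v : ℝ} (hv : v = lo K i ∨ v = hi K i)
    (hv' : v ∈ Ioo (x i) (x i + δ)) :
    ∃ K' ∈ 𝒯.cells, K' ≠ K ∧ (∀ j ≠ i, lo K' j = lo K j ∧ hi K' j = hi K j) ∧
      (v = lo K' i ∨ v = hi K' i) := by
  have hb := hbox K hK
  obtain ⟨j, c, hjc⟩ := hb.exists_face i v hv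
  have hvI : v ∈ Icc (lo K i) (hi K i) := by
    rcases hv with rfl | rfl
    · exact ⟨le_rfl, (hb.lt i).le⟩
    · exact ⟨(hb.lt i).le, le_rfl⟩
  rcases 𝒯.adjacent K hK j c with h | ⟨K', hK', hne, j', c', he⟩
  · exfalso
    -- The centre of the face lies in the open cube, so the face is not contained in the boundary.
    let y : E3 := WithLp.toLp 2 (Function.update (fun m => (lo K m + hi K m) / 2) i v)
    have hy : y ∈ K.face j c := by
      rw [hjc, mem_boxFace hvI]
      refine ⟨fun m => ?_, by simp [y]⟩
      by_cases hm : m = i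
      · subst hm; simpa [y] using hvI
      · have := hb.lt m
        simp only [y, Function.update_of_ne hm]
        constructor <;> linarith
    have h2 := h hy
    rw [(isOpen_samplingDomain x δ).frontier_eq] at h2
    refine h2.2 fun m => ?_
    by_cases hm : m = i
    · subst hm; simpa [y] using hv'
    · have := hb.lt m
      have := le_lo_and_hi_le hδ hbox hK m
      simp only [y, Function.update_of_ne hm]
      constructor <;> linarith
  · obtain ⟨i', v', hvv, he'⟩ := (hbox K' hK').face_eq j' c'
    rw [hjc, he'] at he
    obtain ⟨rfl, rfl, h3⟩ := boxFace_injective hb.lt (hbox K' hK').lt he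
    exact ⟨K', hK', hne, h3, hvv⟩

/-- If two different elements have the same cross section, then they do not overlap in the
remaining direction. -/
theorem hi_le_lo_of_same_section (hbox : ∀ K ∈ 𝒯.cells, K.IsBox (lo K) (hi K))
    {K K' : Parallelepiped} (hK : K ∈ 𝒯.cells) (hK' : K' ∈ 𝒯.cells) (hne : K' ≠ K) {i : Fin 3}
    (h : ∀ j ≠ i, lo K' j = lo K j ∧ hi K' j = hi K j) : hi K i ≤ lo K' i ∨ hi K' i ≤ lo K i := by
  by_contra hcon
  push Not at hcon
  have l1 := (hbox K hK).lt
  have l2 := (hbox K' hK').lt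
  have hm : max (lo K i) (lo K' i) < min (hi K i) (hi K' i) :=
    max_lt (lt_min (l1 i) hcon.2) (lt_min hcon.1 (l2 i))
  let y : E3 := WithLp.toLp 2 (Function.update (fun m => (lo K m + hi K m) / 2) i
    ((max (lo K i) (lo K' i) + min (hi K i) (hi K' i)) / 2))
  have e : ∀ m, (max (lo K m) (lo K' m) < y m ∧ y m < min (hi K m) (hi K' m)) := by
    intro m
    by_cases hmi : m = i
    · subst hmi
      simp only [y, Function.update_self]
      constructor <;> linarith
    · have := l1 m
      simp only [y, Function.update_of_ne hmi, (h m hmi).1, (h m hmi).2, max_self, min_self]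
      constructor <;> linarith
  refine hne (eq_of_obox_inter_cbox hbox hK hK' ⟨y, fun m => ?_, fun m => ?_⟩).symm
  · exact ⟨(le_max_left _ _).trans_lt (e m).1, (e m).2.trans_le (min_le_left _ _)⟩
  · exact ⟨((le_max_right _ _).trans_lt (e m).1).le, ((e m).2.trans_le (min_le_right _ _)).le⟩

/-- The row through an element in direction `i` crosses the whole cube. -/
theorem exists_in_row (hδ : 0 < δ) (hbox : ∀ K ∈ 𝒯.cells, K.IsBox (lo K) (hi K))
    {K : Parallelepiped} (hK : K ∈ 𝒯.cells) (i : Fin 3) {p : ℝ} (hp : p ∈ Icc (x i) (x i + δ)) :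
    ∃ K' ∈ 𝒯.cells, (∀ j ≠ i, lo K' j = lo K j ∧ hi K' j = hi K j) ∧
      p ∈ Icc (lo K' i) (hi K' i) := by
  classical
  let S := 𝒯.cells.filter fun K' => ∀ j ≠ i, lo K' j = lo K j ∧ hi K' j = hi K j
  have hS : ∀ {L}, L ∈ S ↔ L ∈ 𝒯.cells ∧ ∀ j ≠ i, lo L j = lo K j ∧ hi L j = hi K j := by
    intro L; simp only [S, Finset.mem_filter]
  have trans : ∀ {L L'}, L ∈ S → L' ∈ 𝒯.cells → (∀ j ≠ i, lo L' j = lo L j ∧ hi L' j = hi L j) →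
      L' ∈ S := fun {L L'} hL hL' h => hS.2 ⟨hL', fun j hj =>
        ⟨(h j hj).1.trans ((hS.1 hL).2 j hj).1, (h j hj).2.trans ((hS.1 hL).2 j hj).2⟩⟩
  -- The leftmost element of the row must touch the face of the cube; otherwise its left neighbour
  -- would lie further left.
  obtain ⟨K₀, hK₀, hmin⟩ := S.exists_min_image (fun L => lo L i) ⟨K, hS.2 ⟨hK, fun _ _ => ⟨rfl, rfl⟩⟩⟩
  have h0 : lo K₀ i ≤ x i := by
    by_contra hcon
    push Not at hcon
    have hc := (hS.1 hK₀).1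
    have hlt := (hbox K₀ hc).lt i
    obtain ⟨L, hL, hne, hsame, hv⟩ := exists_neighbour hδ hbox hc (Or.inl rfl)
      ⟨hcon, by linarith [(le_lo_and_hi_le hδ hbox hc i).2]⟩
    have h1 := hmin L (trans hK₀ hL hsame)
    have h2 := (hbox L hL).lt i
    rcases hi_le_lo_of_same_section hbox hc hL hne hsame with h | h <;>
      rcases hv with hv | hv <;> linarith
  let S' := S.filter fun L => lo L i ≤ p
  -- Of the elements that start no later than `p`, take the one reaching furthest. If it ended
  -- before `p`, its right neighbour would start no later than `p` and reach further.
  obtain ⟨K₁, hK₁, hmax⟩ := S'.exists_max_image (fun L => hi L i)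
    ⟨K₀, Finset.mem_filter.2 ⟨hK₀, h0.trans hp.1⟩⟩
  obtain ⟨hK₁S, hK₁p⟩ := Finset.mem_filter.1 hK₁
  refine ⟨K₁, (hS.1 hK₁S).1, (hS.1 hK₁S).2, hK₁p, ?_⟩
  by_contra hcon
  push Not at hcon
  have hc := (hS.1 hK₁S).1
  have hlt := (hbox K₁ hc).lt i
  obtain ⟨L, hL, hne, hsame, hv⟩ := exists_neighbour hδ hbox hc (Or.inr rfl)
    ⟨by linarith [(le_lo_and_hi_le hδ hbox hc i).1], hcon.trans_le hp.2⟩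
  have h2 := (hbox L hL).lt i
  have hlo : lo L i = hi K₁ i := by
    rcases hi_le_lo_of_same_section hbox hc hL hne hsame with h | h <;>
      rcases hv with hv | hv <;> linarith
  have h1 := hmax L (Finset.mem_filter.2 ⟨trans hK₁S hL hsame, by linarith⟩)
  linarith

/-- Following the row of `K'` in direction `i + 1` and then a row in direction `i + 2` leads to a
cell `K₂` with the same `i`-interval as `K'`, facing the centre of `K` in the other two directions.
If `v` were inside the `i`-interval of `K`, then `K₂` would meet the interior of `K` and equal it,
yet `v` is an endpoint of the `i`-interval of `K₂`. -/
theorem endpoint_notMem_Ioo (hδ : 0 < δ) (hbox : ∀ K ∈ 𝒯.cells, K.IsBox (lo K) (hi K))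
    {K K' : Parallelepiped} (hK : K ∈ 𝒯.cells) (hK' : K' ∈ 𝒯.cells) (i : Fin 3) {v : ℝ}
    (hv : v = lo K' i ∨ v = hi K' i) : v ∉ Ioo (lo K i) (hi K i) := by
  intro hvI
  have hp : ∀ j, (lo K j + hi K j) / 2 ∈ Icc (x j) (x j + δ) := fun j => by
    have h1 := le_lo_and_hi_le hδ hbox hK j
    have h2 := (hbox K hK).lt j
    constructor <;> linarith
  have h10 : i + 1 ≠ i := by fin_cases i <;> decide
  have h20 : i + 2 ≠ i := by fin_cases i <;> decide
  have h21 : i + 1 ≠ i + 2 := by fin_cases i <;> decide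
  have hall : ∀ j, j = i ∨ j = i + 1 ∨ j = i + 2 := by
    intro j; fin_cases i <;> fin_cases j <;> decide
  obtain ⟨K₁, hK₁, hs₁, hm₁⟩ := exists_in_row hδ hbox hK' (i + 1) (hp (i + 1))
  obtain ⟨K₂, hK₂, hs₂, hm₂⟩ := exists_in_row hδ hbox hK₁ (i + 2) (hp (i + 2))
  have hlo : lo K₂ i = lo K' i := (hs₂ i h20.symm).1.trans (hs₁ i h10.symm).1
  have hhi : hi K₂ i = hi K' i := (hs₂ i h20.symm).2.trans (hs₁ i h10.symm).2
  have hlt := (hbox K₂ hK₂).lt i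
  have heq : K = K₂ := by
    refine eq_of_obox_inter_cbox hbox hK hK₂
      ⟨WithLp.toLp 2 (Function.update (fun m => (lo K m + hi K m) / 2) i v), fun m => ?_, fun m => ?_⟩
    · by_cases hm : m = i
      · subst hm; simpa using hvI
      · have := (hbox K hK).lt m
        simp only [Function.update_of_ne hm]
        constructor <;> linarith
    · rcases hall m with rfl | rfl | rfl
      · simp only [Function.update_self]
        rcases hv with h | h
        · exact ⟨by linarith, by linarith⟩
        · exact ⟨by linarith, by linarith⟩
      · simp only [Function.update_of_ne h10, (hs₂ _ h21).1, (hs₂ _ h21).2]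
        exact hm₁
      · simp only [Function.update_of_ne h20]
        exact hm₂
  subst heq
  rcases hv with h | h
  · rw [hlo] at hvI; exact absurd hvI.1 (by rw [h]; exact lt_irrefl _)
  · rw [hhi] at hvI; exact absurd hvI.2 (by rw [h]; exact lt_irrefl _)

/-- The triangulation is a tensor product grid: the projections of two elements to a coordinate
axis are equal or do not overlap. -/
theorem interval_eq_or_disjoint (hδ : 0 < δ) (hbox : ∀ K ∈ 𝒯.cells, K.IsBox (lo K) (hi K))
    {K K' : Parallelepiped} (hK : K ∈ 𝒯.cells) (hK' : K' ∈ 𝒯.cells) (i : Fin 3) :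
    (lo K i = lo K' i ∧ hi K i = hi K' i) ∨ hi K i ≤ lo K' i ∨ hi K' i ≤ lo K i := by
  by_contra hcon
  push Not at hcon
  obtain ⟨h0, h1, h2⟩ := hcon
  have a1 := endpoint_notMem_Ioo hδ hbox hK hK' i (Or.inl rfl)
  have a2 := endpoint_notMem_Ioo hδ hbox hK hK' i (Or.inr rfl)
  have a3 := endpoint_notMem_Ioo hδ hbox hK' hK i (Or.inl rfl)
  have a4 := endpoint_notMem_Ioo hδ hbox hK' hK i (Or.inr rfl)
  simp only [mem_Ioo, not_and, not_lt] at a1 a2 a3 a4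
  have e1 : lo K i = lo K' i := by
    rcases lt_trichotomy (lo K i) (lo K' i) with h | h | h
    · linarith [a1 h]
    · exact h
    · linarith [a3 h]
  refine h0 e1 ?_
  rcases lt_trichotomy (hi K i) (hi K' i) with h | h | h
  · linarith [a4 (by linarith [(hbox K hK).lt i])]
  · exact h
  · linarith [a2 (by linarith [(hbox K' hK').lt i])]

end Boxes

end Triangulation

/-! ### Calculus of iterated partial derivatives -/

theorem partialD_add {f g : E3 → ℝ} (hf : Differentiable ℝ f) (hg : Differentiable ℝ g)
    (i : Fin 3) : partialD i (fun y => f y + g y) = fun y => partialD i f y + partialD i g y := by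
  funext y
  simp only [partialD]
  rw [fderiv_fun_add (hf y) (hg y)]
  rfl

theorem partialD_const_mul {f : E3 → ℝ} (hf : Differentiable ℝ f) (c : ℝ)
    (i : Fin 3) : partialD i (fun y => c * f y) = fun y => c * partialD i f y := by
  funext y
  simp only [partialD]
  rw [fderiv_const_mul (hf y)]
  rfl

theorem partialD_mul {f g : E3 → ℝ} (hf : Differentiable ℝ f) (hg : Differentiable ℝ g)
    (i : Fin 3) : partialD i (fun y => f y * g y) =
      fun y => f y * partialD i g y + g y * partialD i f y := by
  funext y
  simp only [partialD]
  rw [fderiv_fun_mul (hf y) (hg y)]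
  rfl

theorem partialD_comm {f : E3 → ℝ} (hf : ContDiff ℝ ∞ f) (i j : Fin 3) :
    partialD i (partialD j f) = partialD j (partialD i f) := by
  have h1 : Differentiable ℝ (fderiv ℝ f) :=
    (hf.fderiv_right (m := ∞) (by simp)).differentiable (by simp)
  have h2 : ∀ a b : Fin 3, ∀ y, partialD a (partialD b f) y =
      fderiv ℝ (fderiv ℝ f) y (EuclideanSpace.single a 1) (EuclideanSpace.single b 1) := by
    intro a b y
    have := fderiv_clm_apply (h1 y) (differentiableAt_const (EuclideanSpace.single b (1 : ℝ)))
    change fderiv ℝ (fun z => fderiv ℝ f z (EuclideanSpace.single b 1)) y _ = _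
    rw [this]
    simp
  funext y
  rw [h2, h2]
  exact (hf.contDiffAt.isSymmSndFDerivAt (by
    rw [minSmoothness_of_isRCLikeNormedField]; exact WithTop.coe_le_coe.2 le_top)) _ _

theorem contDiff_iterate_partialD {f : E3 → ℝ} (hf : ContDiff ℝ ∞ f) (i : Fin 3) (n : ℕ) :
    ContDiff ℝ ∞ ((partialD i)^[n] f) := by
  induction n with
  | zero => exact hf
  | succ n ih => rw [Function.iterate_succ_apply']; exact contDiff_partialD ih i

theorem contDiff_iterPartialD {f : E3 → ℝ} (hf : ContDiff ℝ ∞ f) (β : Fin 3 → ℕ) :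
    ContDiff ℝ ∞ (iterPartialD β f) :=
  contDiff_iterate_partialD (contDiff_iterate_partialD (contDiff_iterate_partialD hf 2 _) 1 _) 0 _

theorem partialD_iterate_comm {f : E3 → ℝ} (hf : ContDiff ℝ ∞ f) (i j : Fin 3) (n : ℕ) :
    partialD i ((partialD j)^[n] f) = (partialD j)^[n] (partialD i f) := by
  induction n with
  | zero => rfl
  | succ n ih =>
    rw [Function.iterate_succ_apply', partialD_comm (contDiff_iterate_partialD hf j n), ih,
      Function.iterate_succ_apply']

/-- `iterPartialD` differentiates in a fixed order, so symmetry of second derivatives is needed to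
append one more derivative. All later identities for multi-indices are inductions over this one. -/
theorem iterPartialD_add_single {f : E3 → ℝ} (hf : ContDiff ℝ ∞ f) (β : Fin 3 → ℕ) (i : Fin 3) :
    iterPartialD (β + Pi.single i 1) f = partialD i (iterPartialD β f) := by
  have h2 := contDiff_iterate_partialD hf 2 (β 2)
  have h1 := contDiff_iterate_partialD h2 1 (β 1)
  fin_cases i
  · simp only [iterPartialD, Fin.zero_eta, Pi.add_apply, Pi.single_eq_same, ne_eq, Fin.isValue,
      one_ne_zero, not_false_eq_true, Pi.single_eq_of_ne, add_zero, Fin.reduceEq]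
    rw [Function.iterate_succ_apply']
  · simp only [iterPartialD, Fin.mk_one, Pi.add_apply, Pi.single_eq_same, ne_eq, Fin.isValue,
      zero_ne_one, not_false_eq_true, Pi.single_eq_of_ne, add_zero, Fin.reduceEq]
    rw [Function.iterate_succ_apply', partialD_iterate_comm h1]
  · simp only [iterPartialD, Fin.reduceFinMk, Pi.add_apply, Pi.single_eq_same, ne_eq, Fin.isValue,
      not_false_eq_true, Pi.single_eq_of_ne, add_zero, Fin.reduceEq]
    rw [Function.iterate_succ_apply', partialD_iterate_comm h1, partialD_iterate_comm h2]

@[simp]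
theorem iterPartialD_zero (f : E3 → ℝ) : iterPartialD 0 f = f := rfl

theorem iterPartialD_single {f : E3 → ℝ} (hf : ContDiff ℝ ∞ f) (i : Fin 3) :
    iterPartialD (Pi.single i 1) f = partialD i f := by
  have := iterPartialD_add_single hf 0 i
  rwa [zero_add, iterPartialD_zero] at this

/-- To show a property of all iterated partial derivatives, it suffices to treat one partial
derivative. -/
theorem iterPartialD_induction {P : (Fin 3 → ℕ) → Prop} (h0 : P 0)
    (hs : ∀ β i, P β → P (β + Pi.single i 1)) (β : Fin 3 → ℕ) : P β := by
  have h : ∀ n (β : Fin 3 → ℕ), ∑ i, β i = n → P β := by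
    intro n
    induction n with
    | zero =>
      intro β hβ
      have : β = 0 := by
        funext i
        exact (Finset.sum_eq_zero_iff.1 hβ) i (Finset.mem_univ i)
      rwa [this]
    | succ n ih =>
      intro β hβ
      have : ∃ i, β i ≠ 0 := by
        by_contra hcon
        push Not at hcon
        simp [hcon] at hβ
      obtain ⟨i, hi⟩ := this
      have hb : β = (β - Pi.single i 1) + Pi.single i 1 := by
        funext j
        by_cases hj : j = i
        · subst hj; simp; omega
        · simp [Pi.single_eq_of_ne hj]
      rw [hb]
      refine hs _ i (ih _ ?_)
      have : ∑ j, β j = ∑ j, (β - Pi.single i 1 : Fin 3 → ℕ) j + 1 := by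
        conv_lhs => rw [hb]
        simp [Finset.sum_add_distrib, Finset.sum_pi_single']
      omega
  exact h _ β rfl

theorem iterPartialD_add {f g : E3 → ℝ} (hf : ContDiff ℝ ∞ f) (hg : ContDiff ℝ ∞ g)
    (β : Fin 3 → ℕ) : iterPartialD β (fun y => f y + g y) =
      fun y => iterPartialD β f y + iterPartialD β g y := by
  induction β using iterPartialD_induction with
  | h0 => rfl
  | hs β i ih =>
    rw [iterPartialD_add_single (hf.add hg), ih, iterPartialD_add_single hf,
      iterPartialD_add_single hg, partialD_add]
    · exact (contDiff_iterPartialD hf β).differentiable (by simp)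
    · exact (contDiff_iterPartialD hg β).differentiable (by simp)

theorem iterPartialD_const_mul {f : E3 → ℝ} (hf : ContDiff ℝ ∞ f) (c : ℝ)
    (β : Fin 3 → ℕ) : iterPartialD β (fun y => c * f y) = fun y => c * iterPartialD β f y := by
  induction β using iterPartialD_induction with
  | h0 => rfl
  | hs β i ih =>
    rw [iterPartialD_add_single (contDiff_const.mul hf), ih, iterPartialD_add_single hf,
      partialD_const_mul]
    exact (contDiff_iterPartialD hf β).differentiable (by simp)

theorem iterPartialD_sum {ι : Type*} (s : Finset ι) {f : ι → E3 → ℝ}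
    (hf : ∀ a, ContDiff ℝ ∞ (f a)) (β : Fin 3 → ℕ) :
    iterPartialD β (fun y => ∑ a ∈ s, f a y) = fun y => ∑ a ∈ s, iterPartialD β (f a) y := by
  classical
  induction s using Finset.induction_on with
  | empty =>
    have := iterPartialD_const_mul (f := fun _ => 0) contDiff_const 0 β
    simpa using this
  | insert a s ha ih =>
    simp only [Finset.sum_insert ha]
    rw [iterPartialD_add (hf a) (ContDiff.sum fun a _ => hf a), ih]

theorem iterPartialD_sub {f g : E3 → ℝ} (hf : ContDiff ℝ ∞ f) (hg : ContDiff ℝ ∞ g)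
    (β : Fin 3 → ℕ) : iterPartialD β (fun y => f y - g y) =
      fun y => iterPartialD β f y - iterPartialD β g y := by
  have := iterPartialD_add hf (contDiff_const (c := (-1 : ℝ)) |>.mul hg) β
  rw [iterPartialD_const_mul hg] at this
  simpa [sub_eq_add_neg] using this

/-- Products of polynomials in one variable. -/
def tensorPoly (p : Fin 3 → Polynomial ℝ) : E3 → ℝ := fun y => ∏ i, (p i).eval (y i)

theorem contDiff_tensorPoly (p : Fin 3 → Polynomial ℝ) : ContDiff ℝ ∞ (tensorPoly p) := by
  apply contDiff_prod
  intro i _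
  have h1 : ContDiff ℝ ∞ fun t : ℝ => (p i).eval t := by
    simpa using (p i).contDiff_aeval (𝕜 := ℝ) ∞
  exact h1.comp (contDiff_piLp_apply (𝕜 := ℝ) (p := 2) (i := i))

theorem partialD_tensorPoly (p : Fin 3 → Polynomial ℝ) (i : Fin 3) :
    partialD i (tensorPoly p) =
      tensorPoly (Function.update p i (Polynomial.derivative (p i))) := by
  classical
  funext y
  have h1 : ∀ j, HasFDerivAt (fun y : E3 => (p j).eval (y j))
      ((Polynomial.derivative (p j)).eval (y j) • (EuclideanSpace.proj j : E3 →L[ℝ] ℝ)) y := by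
    intro j
    have h2 : HasFDerivAt (fun y : E3 => y j) (EuclideanSpace.proj j : E3 →L[ℝ] ℝ) y :=
      (EuclideanSpace.proj j : E3 →L[ℝ] ℝ).hasFDerivAt
    exact ((p j).hasDerivAt (y j)).comp_hasFDerivAt y h2
  have h2 := HasFDerivAt.finsetProd (u := Finset.univ) fun j _ => h1 j
  simp only [partialD]
  rw [show tensorPoly p = fun y => ∏ i, (p i).eval (y i) from rfl, h2.fderiv]
  rw [sum_apply, Finset.sum_eq_single i]
  · simp only [tensorPoly]
    rw [← Finset.prod_erase_mul _ _ (Finset.mem_univ i)]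
    simp only [smul_apply, EuclideanSpace.coe_proj, smul_eq_mul, Function.update_self]
    congr 1
    · refine Finset.prod_congr rfl fun j hj => ?_
      rw [Function.update_of_ne (Finset.ne_of_mem_erase hj)]
    · simp
  · intro j _ hj
    simp [hj]
  · simp

theorem iterPartialD_tensorPoly (p : Fin 3 → Polynomial ℝ) (β : Fin 3 → ℕ) :
    iterPartialD β (tensorPoly p) = tensorPoly fun i => Polynomial.derivative^[β i] (p i) := by
  induction β using iterPartialD_induction with
  | h0 => rfl
  | hs β i ih =>
    rw [iterPartialD_add_single (contDiff_tensorPoly p), ih, partialD_tensorPoly]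
    congr 1
    funext j
    by_cases hj : j = i
    · subst hj; simp [Function.iterate_succ_apply']
    · simp [Function.update_of_ne hj, Pi.single_eq_of_ne hj]

/-! #### Diagonal affine changes of variables -/

/-- The affine map `s ↦ a + (ℓ_i s_i)_i`. -/
def diagMap (a ℓ : Fin 3 → ℝ) (s : E3) : E3 := WithLp.toLp 2 fun i => a i + ℓ i * s i

theorem contDiff_diagMap (a ℓ : Fin 3 → ℝ) : ContDiff ℝ ∞ (diagMap a ℓ) := by
  rw [contDiff_piLp]
  intro i
  exact contDiff_const.add (contDiff_const.mul (contDiff_piLp_apply (𝕜 := ℝ) (p := 2) (i := i)))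

theorem partialD_comp_diagMap {f : E3 → ℝ} (hf : Differentiable ℝ f) (a ℓ : Fin 3 → ℝ)
    (i : Fin 3) : partialD i (fun s => f (diagMap a ℓ s)) =
      fun s => ℓ i * partialD i f (diagMap a ℓ s) := by
  funext s
  have h1 : DifferentiableAt ℝ (diagMap a ℓ) s :=
    (contDiff_diagMap a ℓ).differentiable (by simp) s
  have h2 : fderiv ℝ (diagMap a ℓ) s (EuclideanSpace.single i 1) =
      ℓ i • EuclideanSpace.single i (1 : ℝ) := by
    have h3 : HasDerivAt (fun t : ℝ => diagMap a ℓ (s + t • EuclideanSpace.single i 1))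
        (ℓ i • EuclideanSpace.single i (1 : ℝ)) 0 := by
      have h4 : (fun t : ℝ => diagMap a ℓ (s + t • EuclideanSpace.single i 1)) =
          fun t : ℝ => diagMap a ℓ s + t • (ℓ i • EuclideanSpace.single i (1 : ℝ)) := by
        funext t
        ext j
        simp only [diagMap, PiLp.add_apply, PiLp.smul_apply, smul_eq_mul, EuclideanSpace.single,
          PiLp.single_apply]
        by_cases hj : j = i
        · subst hj; simp; ring
        · simp [hj]
      rw [h4]
      simpa using (hasDerivAt_id (0 : ℝ)).smul_const (ℓ i • EuclideanSpace.single i (1 : ℝ))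
        |>.const_add (diagMap a ℓ s)
    have h5 : HasDerivAt (fun t : ℝ => s + t • (EuclideanSpace.single i 1 : E3))
        (EuclideanSpace.single i 1) 0 := by
      simpa using (hasDerivAt_id (0 : ℝ)).smul_const (EuclideanSpace.single i 1 : E3)
        |>.const_add s
    have h1' : HasFDerivAt (diagMap a ℓ) (fderiv ℝ (diagMap a ℓ) s)
        (s + (0 : ℝ) • (EuclideanSpace.single i 1 : E3)) := by simpa using h1.hasFDerivAt
    have h6 : HasDerivAt (fun t : ℝ => diagMap a ℓ (s + t • EuclideanSpace.single i 1))
        (fderiv ℝ (diagMap a ℓ) s (EuclideanSpace.single i 1)) 0 :=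
      HasFDerivAt.comp_hasDerivAt (f := fun t : ℝ => s + t • (EuclideanSpace.single i 1 : E3))
        (0 : ℝ) h1' h5
    exact h6.unique h3
  simp only [partialD]
  rw [fderiv_fun_comp s (hf _) h1, ContinuousLinearMap.comp_apply, h2, map_smul, smul_eq_mul]

theorem iterPartialD_comp_diagMap {f : E3 → ℝ} (hf : ContDiff ℝ ∞ f) (a ℓ : Fin 3 → ℝ)
    (β : Fin 3 → ℕ) : iterPartialD β (fun s => f (diagMap a ℓ s)) =
      fun s => (∏ i, ℓ i ^ β i) * iterPartialD β f (diagMap a ℓ s) := by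
  induction β using iterPartialD_induction with
  | h0 => simp
  | hs β i ih =>
    have h1 := contDiff_iterPartialD hf β
    have h2 : ContDiff ℝ ∞ fun s => f (diagMap a ℓ s) := hf.comp (contDiff_diagMap a ℓ)
    rw [iterPartialD_add_single h2, ih, partialD_const_mul,
      partialD_comp_diagMap (h1.differentiable (by simp)), iterPartialD_add_single hf]
    · funext s
      simp only [Pi.add_apply, pow_add, Finset.prod_mul_distrib]
      rw [show ∏ j, ℓ j ^ (Pi.single i 1 : Fin 3 → ℕ) j = ℓ i by
        rw [Finset.prod_eq_single i] <;> simp +contextual]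
      ring
    · exact (h1.comp (contDiff_diagMap a ℓ)).differentiable (by simp)

/-! ### Square integrals on convex sets -/

theorem ENNReal.sum_sq_le {ι : Type*} (s : Finset ι) (f : ι → ℝ≥0∞) :
    (∑ i ∈ s, f i) ^ 2 ≤ s.card * ∑ i ∈ s, f i ^ 2 := by
  have h := ENNReal.inner_le_Lp_mul_Lq s f (fun _ => 1) Real.HolderConjugate.two_two
  simp only [mul_one, ENNReal.one_rpow, Finset.sum_const, nsmul_eq_mul] at h
  calc (∑ i ∈ s, f i) ^ 2
      ≤ ((∑ i ∈ s, f i ^ (2 : ℝ)) ^ (1 / 2 : ℝ) * (s.card : ℝ≥0∞) ^ (1 / 2 : ℝ)) ^ 2 := by gcongr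
    _ = s.card * ∑ i ∈ s, f i ^ 2 := by
      rw [mul_pow, ← ENNReal.rpow_natCast, ← ENNReal.rpow_natCast, ← ENNReal.rpow_mul,
        ← ENNReal.rpow_mul]
      norm_num
      rw [mul_comm]

theorem ENNReal.add_sq_le (a b : ℝ≥0∞) : (a + b) ^ 2 ≤ 2 * (a ^ 2 + b ^ 2) := by
  have := ENNReal.sum_sq_le Finset.univ ![a, b]
  simpa using this

theorem sq_lintegral_le {Ω : Type*} [MeasurableSpace Ω] {μ : Measure Ω} [IsProbabilityMeasure μ]
    {f : Ω → ℝ≥0∞} (hf : AEMeasurable f μ) : (∫⁻ y, f y ∂μ) ^ 2 ≤ ∫⁻ y, f y ^ 2 ∂μ := by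
  have h := ENNReal.lintegral_mul_le_Lp_mul_Lq μ Real.HolderConjugate.two_two hf
    (aemeasurable_const (b := (1 : ℝ≥0∞)))
  simp only [Pi.mul_apply, mul_one, ENNReal.one_rpow, lintegral_one, measure_univ] at h
  calc (∫⁻ y, f y ∂μ) ^ 2 ≤ ((∫⁻ y, f y ^ (2 : ℝ) ∂μ) ^ (1 / 2 : ℝ)) ^ 2 := by gcongr
    _ = ∫⁻ y, f y ^ 2 ∂μ := by
      rw [← ENNReal.rpow_natCast, ← ENNReal.rpow_mul]
      norm_num

/-- The integral of `|f|²` over `S`. -/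
def sqL2 (S : Set E3) (f : E3 → ℝ) : ℝ≥0∞ := ∫⁻ y in S, ‖f y‖ₑ ^ 2

theorem sqL2_add_le (S : Set E3) {f g : E3 → ℝ} (hf : AEStronglyMeasurable f (volume.restrict S)) :
    sqL2 S (fun y => f y + g y) ≤ 2 * (sqL2 S f + sqL2 S g) := by
  simp only [sqL2]
  rw [← lintegral_add_left' (hf.enorm.pow_const 2), ← lintegral_const_mul' _ _ (by simp)]
  refine lintegral_mono fun y => ?_
  calc ‖f y + g y‖ₑ ^ 2 ≤ (‖f y‖ₑ + ‖g y‖ₑ) ^ 2 := by gcongr; exact enorm_add_le _ _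
    _ ≤ _ := ENNReal.add_sq_le _ _

theorem sqL2_const_mul (S : Set E3) (c : ℝ) (f : E3 → ℝ) :
    sqL2 S (fun y => c * f y) = ‖c‖ₑ ^ 2 * sqL2 S f := by
  simp only [sqL2, enorm_mul, mul_pow]
  rw [lintegral_const_mul' _ _ (by simp)]

/-- The homothety with centre `p` and ratio `s ≤ 1` of a convex set does not increase volumes by
more than the factor `s⁻³`. -/
theorem map_homothety_restrict_le {S : Set E3} (hS : Convex ℝ S) (hm : MeasurableSet S) {p : E3}
    (hp : p ∈ S) {s : ℝ} (hs : s ∈ Ioc (0 : ℝ) 1) :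
    (volume.restrict S).map (fun y => p + s • (y - p)) ≤
      ENNReal.ofReal ((s ^ 3)⁻¹) • volume.restrict S := by
  have hφ : Measurable fun y : E3 => p + s • (y - p) := by fun_prop
  have hmap : (volume : Measure E3).map (fun y => p + s • (y - p)) =
      ENNReal.ofReal ((s ^ 3)⁻¹) • volume := by
    have h1 := Measure.map_addHaar_smul (volume : Measure E3) hs.1.ne'
    have h2 : (fun y : E3 => p + s • (y - p)) = (fun y => (p - s • p) + y) ∘ (s • ·) := by
      funext y; simp only [Function.comp, smul_sub]; abel
    rw [h2, ← Measure.map_map (by fun_prop) (by fun_prop), h1, Measure.map_smul,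
      map_add_left_eq_self, finrank_euclideanSpace_fin, abs_of_pos (by have := hs.1; positivity)]
  intro A
  refine Measure.le_iff.2 ?_ A
  intro A hA
  rw [Measure.map_apply hφ hA, Measure.smul_apply, Measure.restrict_apply hA,
    Measure.restrict_apply (hφ hA), ← Measure.smul_apply, ← hmap, Measure.map_apply hφ (hA.inter hm)]
  refine measure_mono fun y hy => ⟨hy.1, ?_⟩
  change p + s • (y - p) ∈ S
  have : p + s • (y - p) = (1 - s) • p + s • y := by rw [smul_sub, sub_smul, one_smul]; abel
  rw [this]
  exact hS hp hy.2 (by linarith [hs.2]) hs.1.le (by ring)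

/-- The factor `s⁻³` is harmless for `s ≥ 1/2`, where it is at most `8`; in the Sobolev embedding
its square root `s^(-3/2)` is compensated by a weight `s`. -/
theorem lintegral_homothety_le {S : Set E3} (hS : Convex ℝ S) (hm : MeasurableSet S) {p : E3}
    (hp : p ∈ S) {s : ℝ} (hs : s ∈ Ioc (0 : ℝ) 1) {h : E3 → ℝ≥0∞} (hh : Measurable h) :
    ∫⁻ y in S, h (p + s • (y - p)) ≤ ENNReal.ofReal ((s ^ 3)⁻¹) * ∫⁻ y in S, h y := by
  rw [← lintegral_map hh (by fun_prop : Measurable fun y : E3 => p + s • (y - p)),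
    ← smul_eq_mul, ← lintegral_smul_measure]
  exact lintegral_mono' (map_homothety_restrict_le hS hm hp hs) le_rfl

/-! ### The unit cube -/

/-- The closed unit cube. -/
abbrev unitCube : Set E3 := cbox 0 1

theorem volume_cbox (a b : Fin 3 → ℝ) : volume (cbox a b) = ∏ i, ENNReal.ofReal (b i - a i) := by
  rw [← Real.volume_Icc_pi, ← (PiLp.volume_preserving_ofLp (Fin 3)).measure_preimage
    measurableSet_Icc.nullMeasurableSet]
  congr 1
  ext y
  simp only [cbox, mem_ofPred_eq, mem_Icc, mem_preimage, Pi.le_def, forall_and]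

instance isProbabilityMeasure_unitCube : IsProbabilityMeasure (volume.restrict unitCube) :=
  ⟨by rw [Measure.restrict_apply_univ, volume_cbox]; simp⟩

theorem convex_cbox (a b : Fin 3 → ℝ) : Convex ℝ (cbox a b) := by
  intro y hy z hz s t hs ht hst i
  have h1 := hy i
  have h2 := hz i
  simp only [PiLp.add_apply, PiLp.smul_apply, smul_eq_mul]
  exact (convex_Icc (a i) (b i)) h1 h2 hs ht hst

theorem isCompact_cbox (a b : Fin 3 → ℝ) : IsCompact (cbox a b) := by
  have h := (isCompact_Icc (a := a) (b := b)).image (PiLp.continuous_toLp 2 (fun _ : Fin 3 => ℝ))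
  refine h.of_isClosed_subset (isClosed_cbox a b) fun y hy => ⟨WithLp.ofLp y, ?_, rfl⟩
  exact ⟨fun i => (hy i).1, fun i => (hy i).2⟩

theorem measurableSet_cbox (a b : Fin 3 → ℝ) : MeasurableSet (cbox a b) :=
  (isClosed_cbox a b).measurableSet

theorem abs_sub_le_one_of_mem_unitCube {p y : E3} (hp : p ∈ unitCube) (hy : y ∈ unitCube)
    (i : Fin 3) : |(y - p) i| ≤ 1 := by
  have h1 := hp i
  have h2 := hy i
  simp only [Pi.zero_apply, Pi.one_apply, mem_Icc] at h1 h2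
  rw [PiLp.sub_apply, abs_le]
  constructor <;> linarith

theorem hasDerivAt_line {f : E3 → ℝ} (hf : Differentiable ℝ f) (p v : E3) (s : ℝ) :
    HasDerivAt (fun s : ℝ => f (p + s • v)) (∑ i, v i * partialD i f (p + s • v)) s := by
  have h5 : HasDerivAt (fun t : ℝ => p + t • v) v s := by
    simpa using (hasDerivAt_id s).smul_const v |>.const_add p
  have h6 := HasFDerivAt.comp_hasDerivAt (f := fun t : ℝ => p + t • v) s
    (hf (p + s • v)).hasFDerivAt h5
  refine h6.congr_deriv ?_
  have hv : v = ∑ i, v i • (EuclideanSpace.single i 1 : E3) := by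
    have := (EuclideanSpace.basisFun (Fin 3) ℝ).sum_repr v
    simpa using this.symm
  have hm := congrArg (fderiv ℝ f (p + s • v)) hv
  rw [hm, map_sum]
  refine Finset.sum_congr rfl fun i _ => ?_
  rw [map_smul, smul_eq_mul]
  rfl

theorem continuous_partialD {f : E3 → ℝ} (hf : ContDiff ℝ ∞ f) (i : Fin 3) :
    Continuous (partialD i f) := (contDiff_partialD hf i).continuous

/-- First order Taylor estimate along a segment of the unit cube. -/
theorem enorm_sub_le_lintegral {f : E3 → ℝ} (hf : ContDiff ℝ ∞ f) {p y : E3} (hp : p ∈ unitCube)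
    (hy : y ∈ unitCube) : ‖f p - f y‖ₑ ≤
      ∫⁻ s in Ioc (0 : ℝ) 1, ∑ i, ‖partialD i f (y + s • (p - y))‖ₑ := by
  have hd := fun s => hasDerivAt_line (hf.differentiable (by simp)) y (p - y) s
  have hc : Continuous fun s : ℝ => ∑ i, (p - y) i * partialD i f (y + s • (p - y)) :=
    continuous_finsetSum _ fun i _ => continuous_const.mul
      ((continuous_partialD hf i).comp (by fun_prop))
  have h := intervalIntegral.integral_eq_sub_of_hasDerivAt (a := 0) (b := 1) (fun s _ => hd s)
    (hc.intervalIntegrable 0 1)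
  simp only [one_smul, zero_smul, add_zero, add_sub_cancel] at h
  rw [← h, intervalIntegral.integral_of_le zero_le_one]
  refine (enorm_integral_le_lintegral_enorm _).trans (lintegral_mono fun s => ?_)
  refine (enorm_sum_le _ _).trans (Finset.sum_le_sum fun i _ => ?_)
  rw [enorm_mul]
  refine mul_le_of_le_one_left' ?_
  rw [← ofReal_norm, Real.norm_eq_abs, ENNReal.ofReal_le_one]
  exact abs_sub_le_one_of_mem_unitCube hy hp i

/-- Second order Taylor estimate along a segment of the unit cube. -/
theorem enorm_le_lintegral_second {f : E3 → ℝ} (hf : ContDiff ℝ ∞ f) {p y : E3}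
    (hp : p ∈ unitCube) (hy : y ∈ unitCube) : ‖f p‖ₑ ≤ ‖f y‖ₑ + ∑ i, ‖partialD i f y‖ₑ +
      ∑ i, ∑ j, ∫⁻ s in Ioc (0 : ℝ) 1,
        ENNReal.ofReal s * ‖partialD j (partialD i f) (p + s • (y - p))‖ₑ := by
  set v := y - p with hv
  have hd1 := fun s => hasDerivAt_line (hf.differentiable (by simp)) p v s
  have hd2 := fun i s => hasDerivAt_line ((contDiff_partialD hf i).differentiable (by simp)) p v s
  -- In `f - s f'` along the segment the first derivatives cancel upon differentiation. The second
  -- derivatives then carry the weight `s`, which tames the singularity at `p`.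
  have hd3 : ∀ s : ℝ, HasDerivAt
      (fun s : ℝ => f (p + s • v) - s * ∑ i, v i * partialD i f (p + s • v))
      (-(∑ i, ∑ j, s * (v i * (v j * partialD j (partialD i f) (p + s • v))))) s := by
    intro s
    have h1 := HasDerivAt.fun_sum (u := Finset.univ) fun i _ => (hd2 i s).const_mul (v i)
    have h2 := (hd1 s).sub ((hasDerivAt_id s).mul h1)
    refine h2.congr_deriv ?_
    simp only [id, Fin.sum_univ_three]
    ring
  have hc : ∀ i j, Continuous fun s : ℝ =>
      s * (v i * (v j * partialD j (partialD i f) (p + s • v))) := fun i j =>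
    continuous_id.mul (continuous_const.mul (continuous_const.mul
      ((continuous_partialD (contDiff_partialD hf i) j).comp (by fun_prop))))
  have h := intervalIntegral.integral_eq_sub_of_hasDerivAt (a := 0) (b := 1) (fun s _ => hd3 s)
    ((continuous_finsetSum _ fun i _ => continuous_finsetSum _ fun j _ => hc i j).neg
      |>.intervalIntegrable 0 1)
  have hpv : p + v = y := by rw [hv]; abel
  simp only [one_smul, zero_smul, add_zero, zero_mul, sub_zero, one_mul, hpv] at h
  have hfp : f p = f y - ∑ i, v i * partialD i f y -
      ∫ s in (0 : ℝ)..1, -(∑ i, ∑ j, s * (v i * (v j * partialD j (partialD i f) (p + s • v)))) := by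
    rw [h]; ring
  have hv1 : ∀ i, ‖v i‖ₑ ≤ 1 := fun i => by
    rw [← ofReal_norm, Real.norm_eq_abs, ENNReal.ofReal_le_one]
    exact abs_sub_le_one_of_mem_unitCube hp hy i
  rw [hfp]
  refine (enorm_sub_le).trans (add_le_add ((enorm_sub_le).trans (add_le_add le_rfl ?_)) ?_)
  · refine (enorm_sum_le _ _).trans (Finset.sum_le_sum fun i _ => ?_)
    rw [enorm_mul]
    exact mul_le_of_le_one_left' (hv1 i)
  · rw [intervalIntegral.integral_of_le zero_le_one]
    refine (enorm_integral_le_lintegral_enorm _).trans ?_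
    have hmeas : ∀ i j, Measurable fun s : ℝ =>
        ENNReal.ofReal s * ‖partialD j (partialD i f) (p + s • v)‖ₑ := fun i j =>
      ENNReal.measurable_ofReal.mul ((continuous_partialD (contDiff_partialD hf i) j).comp
        (by fun_prop : Continuous fun s : ℝ => p + s • v)).measurable.enorm
    have hsum : ∑ i, ∑ j, ∫⁻ s in Ioc (0 : ℝ) 1,
        ENNReal.ofReal s * ‖partialD j (partialD i f) (p + s • v)‖ₑ =
        ∫⁻ s in Ioc (0 : ℝ) 1, ∑ i, ∑ j,
          ENNReal.ofReal s * ‖partialD j (partialD i f) (p + s • v)‖ₑ := by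
      rw [lintegral_finsetSum _ fun i _ => Finset.measurable_fun_sum _ fun j _ => hmeas i j]
      refine Finset.sum_congr rfl fun i _ => ?_
      rw [lintegral_finsetSum _ fun j _ => hmeas i j]
    rw [hsum]
    refine setLIntegral_mono' measurableSet_Ioc fun s hs => ?_
    rw [enorm_neg]
    refine (enorm_sum_le _ _).trans (Finset.sum_le_sum fun i _ => ?_)
    refine (enorm_sum_le _ _).trans (Finset.sum_le_sum fun j _ => ?_)
    rw [enorm_mul, enorm_mul, enorm_mul, ← mul_assoc ‖v i‖ₑ, Real.enorm_of_nonneg hs.1.le]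
    gcongr
    calc _ ≤ 1 * 1 * ‖partialD j (partialD i f) (p + s • v)‖ₑ := by
          gcongr
          · exact hv1 i
          · exact hv1 j
      _ = _ := by rw [one_mul, one_mul]

/-- The Sobolev embedding `H²(Q) ⊂ C(Q)` for the unit cube `Q`. -/
theorem exists_enorm_sq_le_H2 : ∃ C : ℝ≥0, ∀ f : E3 → ℝ, ContDiff ℝ ∞ f → ∀ S : ℝ≥0∞,
    sqL2 unitCube f ≤ S → (∀ i, sqL2 unitCube (partialD i f) ≤ S) →
    (∀ i j, sqL2 unitCube (partialD j (partialD i f)) ≤ S) →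
    ∀ p ∈ unitCube, ‖f p‖ₑ ^ 2 ≤ C * S := by
  -- The integrand `s^(-1/2)` is the Taylor weight `s` times the homothety factor `s^(-3/2)`; its
  -- integrability is where dimension three enters.
  set C₀ : ℝ≥0∞ := ∫⁻ s in Ioc (0 : ℝ) 1, ENNReal.ofReal (s ^ (-(1 / 2) : ℝ)) with hC₀
  have hfin : C₀ ≠ ⊤ := by
    have h := (intervalIntegral.intervalIntegrable_rpow' (a := 0) (b := 1) (r := -(1 / 2))
      (by norm_num)).1
    have := h.lintegral_lt_top
    exact this.ne
  -- One term for `f`, three for the first derivatives and nine for the second ones.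
  refine ⟨((4 + 9 * C₀) ^ 2).toNNReal, ?_⟩
  intro f hf S h0 h1 h2 p hp
  have hC : (((4 + 9 * C₀) ^ 2).toNNReal : ℝ≥0∞) = (4 + 9 * C₀) ^ 2 :=
    ENNReal.coe_toNNReal (by finiteness)
  rw [hC]
  have hL1 : ∀ g : E3 → ℝ, Continuous g → sqL2 unitCube g ≤ S →
      ∫⁻ y in unitCube, ‖g y‖ₑ ≤ S ^ (1 / 2 : ℝ) := by
    intro g hg hS
    have := (sq_lintegral_le (μ := volume.restrict unitCube) hg.measurable.enorm.aemeasurable).trans hS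
    calc ∫⁻ y in unitCube, ‖g y‖ₑ = ((∫⁻ y in unitCube, ‖g y‖ₑ) ^ 2) ^ (1 / 2 : ℝ) := by
          rw [← ENNReal.rpow_natCast, ← ENNReal.rpow_mul]; norm_num
      _ ≤ _ := by gcongr
  have hD : ∀ i j, ∫⁻ y in unitCube, ∫⁻ s in Ioc (0 : ℝ) 1,
      ENNReal.ofReal s * ‖partialD j (partialD i f) (p + s • (y - p))‖ₑ ≤ C₀ * S ^ (1 / 2 : ℝ) := by
    intro i j
    have hg := continuous_partialD (contDiff_partialD hf i) j
    rw [lintegral_lintegral_swap]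
    · rw [hC₀, ← lintegral_mul_const _ (by fun_prop)]
      refine setLIntegral_mono' measurableSet_Ioc fun s hs => ?_
      rw [lintegral_const_mul' _ _ (by simp)]
      have e1 : ∫⁻ y in unitCube, ‖partialD j (partialD i f) (p + s • (y - p))‖ₑ ≤
          ENNReal.ofReal (s ^ (-(3 / 2) : ℝ)) * S ^ (1 / 2 : ℝ) := by
        have e2 := (sq_lintegral_le (μ := volume.restrict unitCube)
          (f := fun y => ‖partialD j (partialD i f) (p + s • (y - p))‖ₑ)
          (hg.comp (by fun_prop : Continuous fun y => p + s • (y - p))).measurable.enorm.aemeasurable)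
        have e3 := lintegral_homothety_le (convex_cbox 0 1) (measurableSet_cbox 0 1) hp hs
          (h := fun y => ‖partialD j (partialD i f) y‖ₑ ^ 2) (hg.measurable.enorm.pow_const 2)
        have e4 := e2.trans (e3.trans (mul_le_mul_right (h2 i j) _))
        calc _ = ((∫⁻ y in unitCube, ‖partialD j (partialD i f) (p + s • (y - p))‖ₑ) ^ 2)
              ^ (1 / 2 : ℝ) := by
              rw [← ENNReal.rpow_natCast, ← ENNReal.rpow_mul]; norm_num
          _ ≤ (ENNReal.ofReal ((s ^ 3)⁻¹) * S) ^ (1 / 2 : ℝ) := by gcongr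
          _ = _ := by
              rw [ENNReal.mul_rpow_of_nonneg _ _ (by norm_num),
                ENNReal.ofReal_rpow_of_nonneg (by have := hs.1; positivity) (by norm_num)]
              congr 2
              rw [← Real.rpow_natCast, ← Real.rpow_neg hs.1.le, ← Real.rpow_mul hs.1.le]
              norm_num
      calc _ ≤ ENNReal.ofReal s * (ENNReal.ofReal (s ^ (-(3 / 2) : ℝ)) * S ^ (1 / 2 : ℝ)) := by
            gcongr
        _ = _ := by
            rw [← mul_assoc, ← ENNReal.ofReal_mul hs.1.le]
            congr 2
            nth_rewrite 1 [← Real.rpow_one s]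
            rw [← Real.rpow_add hs.1]
            norm_num
    · exact ((ENNReal.measurable_ofReal.comp measurable_snd).mul
        (hg.comp (by fun_prop : Continuous fun q : E3 × ℝ =>
          p + q.2 • (q.1 - p))).measurable.enorm).aemeasurable
  have key : ‖f p‖ₑ ≤ (4 + 9 * C₀) * S ^ (1 / 2 : ℝ) := by
    have hm0 : Measurable fun y => ‖f y‖ₑ := hf.continuous.measurable.enorm
    have hm1 : ∀ i, Measurable fun y => ‖partialD i f y‖ₑ :=
      fun i => (continuous_partialD hf i).measurable.enorm
    have hm2 : ∀ i j, Measurable fun y => ∫⁻ s in Ioc (0 : ℝ) 1,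
        ENNReal.ofReal s * ‖partialD j (partialD i f) (p + s • (y - p))‖ₑ := by
      intro i j
      apply Measurable.lintegral_prod_right'
        (f := fun q : E3 × ℝ => ENNReal.ofReal q.2 *
          ‖partialD j (partialD i f) (p + q.2 • (q.1 - p))‖ₑ)
      exact (ENNReal.measurable_ofReal.comp measurable_snd).mul
        ((continuous_partialD (contDiff_partialD hf i) j).comp
          (by fun_prop : Continuous fun q : E3 × ℝ => p + q.2 • (q.1 - p))).measurable.enorm
    calc ‖f p‖ₑ = ∫⁻ _ in unitCube, ‖f p‖ₑ := by simp
      _ ≤ ∫⁻ y in unitCube, (‖f y‖ₑ + ∑ i, ‖partialD i f y‖ₑ +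
          ∑ i, ∑ j, ∫⁻ s in Ioc (0 : ℝ) 1,
            ENNReal.ofReal s * ‖partialD j (partialD i f) (p + s • (y - p))‖ₑ) :=
          setLIntegral_mono' (measurableSet_cbox 0 1) fun y hy =>
            enorm_le_lintegral_second hf hp hy
      _ = (∫⁻ y in unitCube, ‖f y‖ₑ) + ∑ i, (∫⁻ y in unitCube, ‖partialD i f y‖ₑ) +
          ∑ i, ∑ j, ∫⁻ y in unitCube, ∫⁻ s in Ioc (0 : ℝ) 1,
            ENNReal.ofReal s * ‖partialD j (partialD i f) (p + s • (y - p))‖ₑ := by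
          rw [lintegral_add_left (f := fun y => ‖f y‖ₑ + ∑ i, ‖partialD i f y‖ₑ)
              (hm0.add (Finset.measurable_fun_sum _ fun i _ => hm1 i)),
            lintegral_add_left hm0, lintegral_finsetSum _ fun i _ => hm1 i,
            lintegral_finsetSum _ fun i _ => Finset.measurable_fun_sum _ fun j _ => hm2 i j]
          congr 1
          refine Finset.sum_congr rfl fun i _ => ?_
          rw [lintegral_finsetSum _ fun j _ => hm2 i j]
      _ ≤ S ^ (1 / 2 : ℝ) + ∑ i : Fin 3, S ^ (1 / 2 : ℝ) +
          ∑ i : Fin 3, ∑ j : Fin 3, C₀ * S ^ (1 / 2 : ℝ) := by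
          gcongr with i _ i _ j _
          · exact hL1 f hf.continuous h0
          · exact hL1 _ (continuous_partialD hf i) (h1 i)
          · exact hD i j
      _ = _ := by
          simp only [Finset.sum_const, Finset.card_univ, Fintype.card_fin, nsmul_eq_mul,
            Nat.cast_ofNat]
          ring
  calc ‖f p‖ₑ ^ 2 ≤ ((4 + 9 * C₀) * S ^ (1 / 2 : ℝ)) ^ 2 := by gcongr
    _ = _ := by
      rw [mul_pow, ← ENNReal.rpow_natCast (S ^ (1 / 2 : ℝ)), ← ENNReal.rpow_mul]
      norm_num

/-- Tonelli moves the integral over the segment parameter to the outside, where the bound holds for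
each fixed parameter and `ρ` has mass one. -/
theorem lintegral_triple_sum_le {ι α β γ : Type*} [Fintype ι] [MeasurableSpace α]
    [MeasurableSpace β] [MeasurableSpace γ] {μ : Measure α} {ν : Measure β} {ρ : Measure γ}
    [SFinite μ] [SFinite ν] [IsProbabilityMeasure ρ] {g : ι → α → β → γ → ℝ≥0∞}
    (hg : ∀ i, Measurable fun q : α × β × γ => g i q.1 q.2.1 q.2.2) {B : ι → ℝ≥0∞}
    (h : ∀ i, ∀ᵐ c ∂ρ, ∫⁻ a, ∫⁻ b, g i a b c ∂ν ∂μ ≤ B i) :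
    ∫⁻ a, ∫⁻ b, ∫⁻ c, ∑ i, g i a b c ∂ρ ∂ν ∂μ ≤ ∑ i, B i := by
  have h1 : ∫⁻ a, ∫⁻ b, ∫⁻ c, ∑ i, g i a b c ∂ρ ∂ν ∂μ =
      ∫⁻ q, ∑ i, g i q.1 q.2.1 q.2.2 ∂(μ.prod (ν.prod ρ)) := by
    have hm : Measurable fun q : α × β × γ => ∑ i, g i q.1 q.2.1 q.2.2 :=
      Finset.measurable_fun_sum _ fun i _ => hg i
    rw [lintegral_prod _ hm.aemeasurable]
    refine lintegral_congr fun a => ?_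
    exact (lintegral_prod (fun z : β × γ => ∑ i, g i a z.1 z.2)
      (hm.comp measurable_prodMk_left).aemeasurable).symm
  rw [h1, lintegral_finsetSum _ fun i _ => hg i]
  refine Finset.sum_le_sum fun i _ => ?_
  rw [lintegral_prod _ (hg i).aemeasurable]
  have h2 : ∀ a, ∫⁻ b, g i a b.1 b.2 ∂(ν.prod ρ) = ∫⁻ c, ∫⁻ b, g i a b c ∂ν ∂ρ := fun a =>
    lintegral_prod_symm (fun z : β × γ => g i a z.1 z.2)
      ((hg i).comp measurable_prodMk_left).aemeasurable
  simp_rw [h2]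
  rw [lintegral_lintegral_swap]
  · calc _ ≤ ∫⁻ _, B i ∂ρ := lintegral_mono_ae (h i)
      _ = B i := by simp
  · apply Measurable.aemeasurable
    apply Measurable.lintegral_prod_right' (f := fun q : (α × γ) × β => g i q.1.1 q.2 q.1.2)
    exact (hg i).comp (by fun_prop : Measurable fun q : (α × γ) × β => (q.1.1, q.2, q.1.2))

/-- The point `y + s (p - y)` is a homothety of ratio `s` in `p` and one of ratio `1 - s` in `y`.
One of the ratios is at least `1/2`, which costs the factor `2³`. -/
theorem lintegral_lintegral_segment_le {h : E3 → ℝ≥0∞} (hm : Measurable h) {s : ℝ}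
    (hs : s ∈ Ioc (0 : ℝ) 1) : ∫⁻ p in unitCube, ∫⁻ y in unitCube, h (y + s • (p - y)) ≤
      8 * ∫⁻ y in unitCube, h y := by
  have h8 : ∀ r : ℝ, 1 / 2 ≤ r → ENNReal.ofReal ((r ^ 3)⁻¹) ≤ 8 := by
    intro r hr
    rw [show (8 : ℝ≥0∞) = ENNReal.ofReal 8 by simp]
    apply ENNReal.ofReal_le_ofReal
    rw [inv_le_comm₀ (by positivity) (by norm_num)]
    calc (8 : ℝ)⁻¹ = (1 / 2) ^ 3 := by norm_num
      _ ≤ r ^ 3 := by gcongr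
  rcases le_total (1 / 2) s with hle | hle
  · have hsw := lintegral_lintegral_swap (μ := volume.restrict unitCube)
      (ν := volume.restrict unitCube) (f := fun p y => h (y + s • (p - y)))
      (hm.comp (by fun_prop : Measurable fun q : E3 × E3 => q.2 + s • (q.1 - q.2))).aemeasurable
    rw [hsw]
    calc _ ≤ ∫⁻ _ in unitCube, 8 * ∫⁻ y in unitCube, h y :=
          setLIntegral_mono' (measurableSet_cbox 0 1) fun y hy =>
            (lintegral_homothety_le (convex_cbox 0 1) (measurableSet_cbox 0 1) hy hs hm).trans
              (mul_le_mul_left (h8 s hle) _)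
      _ = _ := by simp
  · calc _ ≤ ∫⁻ _ in unitCube, 8 * ∫⁻ y in unitCube, h y :=
          setLIntegral_mono' (measurableSet_cbox 0 1) fun p hp => by
            have e : ∀ y : E3, y + s • (p - y) = p + (1 - s) • (y - p) := fun y => by
              simp only [smul_sub, sub_smul, one_smul]; abel
            simp_rw [e]
            exact (lintegral_homothety_le (convex_cbox 0 1) (measurableSet_cbox 0 1) hp
              (s := 1 - s) ⟨by linarith, by linarith [hs.1]⟩ hm).trans
                (mul_le_mul_left (h8 (1 - s) (by linarith)) _)
      _ = _ := by simp

theorem enorm_sub_sq_le_lintegral {f : E3 → ℝ} (hf : ContDiff ℝ ∞ f) {p y : E3}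
    (hp : p ∈ unitCube) (hy : y ∈ unitCube) : ‖f p - f y‖ₑ ^ 2 ≤
      ∫⁻ s in Ioc (0 : ℝ) 1, ∑ i, 3 * ‖partialD i f (y + s • (p - y))‖ₑ ^ 2 := by
  have : IsProbabilityMeasure (volume.restrict (Ioc (0 : ℝ) 1)) := ⟨by simp⟩
  calc ‖f p - f y‖ₑ ^ 2
      ≤ (∫⁻ s in Ioc (0 : ℝ) 1, ∑ i, ‖partialD i f (y + s • (p - y))‖ₑ) ^ 2 := by
        gcongr; exact enorm_sub_le_lintegral hf hp hy
    _ ≤ ∫⁻ s in Ioc (0 : ℝ) 1, (∑ i, ‖partialD i f (y + s • (p - y))‖ₑ) ^ 2 := by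
        apply sq_lintegral_le
        apply Measurable.aemeasurable
        exact Finset.measurable_fun_sum _ fun i _ =>
          ((continuous_partialD hf i).comp (by fun_prop)).measurable.enorm
    _ ≤ _ := by
        refine lintegral_mono fun s => ?_
        rw [← Finset.mul_sum]
        simpa using ENNReal.sum_sq_le Finset.univ fun i => ‖partialD i f (y + s • (p - y))‖ₑ

/-- Because `f` has mean zero, `f p` is the mean of `f p - f y`; then apply Jensen's inequality. -/
theorem enorm_sq_le_of_integral_eq_zero {f : E3 → ℝ} (hf : Continuous f)
    (h0 : ∫ y in unitCube, f y = 0) (p : E3) :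
    ‖f p‖ₑ ^ 2 ≤ ∫⁻ y in unitCube, ‖f p - f y‖ₑ ^ 2 := by
  have hfi : Integrable f (volume.restrict unitCube) :=
    hf.continuousOn.integrableOn_compact (isCompact_cbox 0 1)
  have e : f p = ∫ y in unitCube, (f p - f y) := by
    rw [integral_sub (integrable_const _) hfi, h0]; simp
  calc ‖f p‖ₑ ^ 2 = ‖∫ y in unitCube, (f p - f y)‖ₑ ^ 2 := by rw [← e]
    _ ≤ (∫⁻ y in unitCube, ‖f p - f y‖ₑ) ^ 2 := by
        gcongr; exact enorm_integral_le_lintegral_enorm _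
    _ ≤ _ := sq_lintegral_le
        (by fun_prop : Continuous fun y => f p - f y).measurable.enorm.aemeasurable

/-- The Poincaré inequality on the unit cube. -/
theorem sqL2_le_of_integral_eq_zero {f : E3 → ℝ} (hf : ContDiff ℝ ∞ f)
    (h0 : ∫ y in unitCube, f y = 0) :
    sqL2 unitCube f ≤ 24 * ∑ i, sqL2 unitCube (partialD i f) := by
  have hm : ∀ i, Measurable fun y => ‖partialD i f y‖ₑ ^ 2 :=
    fun i => (continuous_partialD hf i).measurable.enorm.pow_const 2
  have : IsProbabilityMeasure (volume.restrict (Ioc (0 : ℝ) 1)) := ⟨by simp⟩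
  -- The factor `3` is Cauchy–Schwarz for three partial derivatives, the factor `8` comes from the
  -- homotheties; together they give `24`.
  have h3 := lintegral_triple_sum_le (μ := volume.restrict unitCube)
    (ν := volume.restrict unitCube) (ρ := volume.restrict (Ioc (0 : ℝ) 1))
    (g := fun i p y s => 3 * ‖partialD i f (y + s • (p - y))‖ₑ ^ 2)
    (B := fun i => 3 * (8 * sqL2 unitCube (partialD i f)))
    (fun i => ((hm i).comp (by fun_prop :
      Measurable fun q : E3 × E3 × ℝ => q.2.1 + q.2.2 • (q.1 - q.2.1))).const_mul 3)
    (fun i => by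
      filter_upwards [ae_restrict_mem measurableSet_Ioc] with s hs
      have h4 : ∀ p : E3, ∫⁻ y in unitCube, 3 * ‖partialD i f (y + s • (p - y))‖ₑ ^ 2 =
          3 * ∫⁻ y in unitCube, ‖partialD i f (y + s • (p - y))‖ₑ ^ 2 := fun p =>
        lintegral_const_mul' _ _ (by simp)
      simp_rw [h4]
      rw [lintegral_const_mul' _ _ (by simp)]
      exact mul_le_mul_right (lintegral_lintegral_segment_le (hm i) hs) 3)
  calc sqL2 unitCube f ≤ ∫⁻ p in unitCube, ∫⁻ y in unitCube, ∫⁻ s in Ioc (0 : ℝ) 1,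
        ∑ i, 3 * ‖partialD i f (y + s • (p - y))‖ₑ ^ 2 :=
        setLIntegral_mono' (measurableSet_cbox 0 1) fun p hp =>
          (enorm_sq_le_of_integral_eq_zero hf.continuous h0 p).trans
          (setLIntegral_mono' (measurableSet_cbox 0 1) fun y hy =>
            enorm_sub_sq_le_lintegral hf hp hy)
    _ ≤ _ := h3
    _ = _ := by rw [← Finset.mul_sum, ← Finset.mul_sum, ← mul_assoc]; norm_num

/-! ### The Bramble–Hilbert lemma on the unit cube -/

/-- The monomial with exponents `γ`. -/
def monom (γ : Fin 3 → ℕ) : E3 → ℝ := tensorPoly fun i => Polynomial.X ^ γ i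

theorem contDiff_monom (γ : Fin 3 → ℕ) : ContDiff ℝ ∞ (monom γ) := contDiff_tensorPoly _

theorem iterPartialD_monom_of_lt {β γ : Fin 3 → ℕ} {i : Fin 3} (h : γ i < β i) :
    iterPartialD β (monom γ) = fun _ => 0 := by
  funext y
  rw [monom, iterPartialD_tensorPoly, tensorPoly, Finset.prod_eq_zero (Finset.mem_univ i)]
  rw [Polynomial.iterate_derivative_eq_zero (by simpa using h), Polynomial.eval_zero]

theorem iterPartialD_monom_self (γ : Fin 3 → ℕ) :
    iterPartialD γ (monom γ) = fun _ => ∏ i, ((γ i).factorial : ℝ) := by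
  funext y
  rw [monom, iterPartialD_tensorPoly, tensorPoly]
  refine Finset.prod_congr rfl fun i _ => ?_
  rw [Polynomial.iterate_derivative_X_pow_eq_smul]
  simp [Nat.descFactorial_self]

/-- The polynomial with coefficients `c`. -/
def multiPoly {k : ℕ} (c : MultiIndex k → ℝ) : E3 → ℝ := fun y => ∑ γ, c γ * monom γ.1 y

theorem contDiff_multiPoly {k : ℕ} (c : MultiIndex k → ℝ) : ContDiff ℝ ∞ (multiPoly c) :=
  ContDiff.sum fun γ _ => contDiff_const.mul (contDiff_monom γ.1)

theorem iterPartialD_multiPoly {k : ℕ} (c : MultiIndex k → ℝ) (β : Fin 3 → ℕ) :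
    iterPartialD β (multiPoly c) = fun y => ∑ γ, c γ * iterPartialD β (monom γ.1) y := by
  have h := iterPartialD_sum Finset.univ (f := fun (γ : MultiIndex k) y => c γ * monom γ.1 y)
    (fun γ => contDiff_const.mul (contDiff_monom γ.1)) β
  rw [show multiPoly c = fun y => ∑ γ, c γ * monom γ.1 y from rfl, h]
  funext y
  refine Finset.sum_congr rfl fun γ _ => ?_
  rw [iterPartialD_const_mul (contDiff_monom γ.1)]

theorem iterPartialD_multiPoly_of_lt {k : ℕ} (c : MultiIndex k → ℝ) {β : Fin 3 → ℕ}
    (h : k < ∑ i, β i) : iterPartialD β (multiPoly c) = fun _ => 0 := by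
  rw [iterPartialD_multiPoly]
  funext y
  refine Finset.sum_eq_zero fun γ _ => ?_
  have : ∃ i, γ.1 i < β i := by
    by_contra hcon
    push Not at hcon
    have := Finset.sum_le_sum fun i (_ : i ∈ Finset.univ) => hcon i
    have := γ.2
    omega
  obtain ⟨i, hi⟩ := this
  rw [iterPartialD_monom_of_lt hi, mul_zero]

theorem integrable_unitCube {f : E3 → ℝ} (hf : Continuous f) :
    Integrable f (volume.restrict unitCube) :=
  hf.continuousOn.integrableOn_compact (isCompact_cbox 0 1)

/-- A polynomial of degree `≤ k` with prescribed mean values of the derivatives of order `≤ k`. -/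
theorem exists_multiPoly_moments {k : ℕ} (b : MultiIndex k → ℝ) :
    ∃ c : MultiIndex k → ℝ, ∀ β : MultiIndex k,
      ∫ y in unitCube, iterPartialD β.1 (multiPoly c) y = b β := by
  have hint : ∀ β γ : MultiIndex k, Integrable (iterPartialD β.1 (monom γ.1))
      (volume.restrict unitCube) := fun β γ =>
    integrable_unitCube (contDiff_iterPartialD (contDiff_monom γ.1) β.1).continuous
  let A : Matrix (MultiIndex k) (MultiIndex k) ℝ :=
    fun β γ => ∫ y in unitCube, iterPartialD β.1 (monom γ.1) y
  have hA : ∀ c β, A.mulVec c β = ∫ y in unitCube, iterPartialD β.1 (multiPoly c) y := by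
    intro c β
    rw [iterPartialD_multiPoly, integral_finsetSum _ fun γ _ => (hint β γ).const_mul _]
    simp only [Matrix.mulVec, dotProduct, A]
    refine Finset.sum_congr rfl fun γ _ => ?_
    rw [integral_const_mul, mul_comm]
  have hinj : Function.Injective A.mulVecLin := by
    rw [← LinearMap.ker_eq_bot, LinearMap.ker_eq_bot']
    intro c hc
    by_contra hne
    have hne' : (Finset.univ.filter fun γ => c γ ≠ 0).Nonempty := by
      obtain ⟨γ, hγ⟩ := Function.ne_iff.1 hne
      exact ⟨γ, by simpa using hγ⟩
    -- For `γ` of maximal order among the nonzero coefficients, `∂^γ` kills every other monomial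
    -- present and leaves a nonzero constant.
    obtain ⟨γ, hγ, hmax⟩ := Finset.exists_max_image _ (fun γ : MultiIndex k => ∑ i, γ.1 i) hne'
    have hγ0 : c γ ≠ 0 := by simpa using hγ
    have h1 : A.mulVec c γ = 0 := congrFun hc γ
    have h2 : iterPartialD γ.1 (multiPoly c) = fun _ => c γ * ∏ i, ((γ.1 i).factorial : ℝ) := by
      rw [iterPartialD_multiPoly]
      funext y
      rw [Finset.sum_eq_single γ, iterPartialD_monom_self]
      · intro γ' _ hγ'
        by_cases h0 : c γ' = 0
        · rw [h0, zero_mul]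
        have hle := hmax γ' (by simpa using h0)
        have : ∃ i, γ'.1 i < γ.1 i := by
          by_contra hcon
          push Not at hcon
          have hs := (Finset.sum_eq_sum_iff_of_le fun i (_ : i ∈ Finset.univ) => hcon i).1
            (le_antisymm (Finset.sum_le_sum fun i _ => hcon i) hle)
          exact hγ' (Subtype.ext (funext fun i => (hs i (Finset.mem_univ i)).symm))
        obtain ⟨i, hi⟩ := this
        rw [iterPartialD_monom_of_lt hi, mul_zero]
      · simp
    rw [hA, h2] at h1
    simp only [integral_const, probReal_univ, one_smul, mul_eq_zero, hγ0, false_or] at h1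
    exact Finset.prod_ne_zero_iff.2 (fun i _ => by positivity) h1
  obtain ⟨c, hc⟩ := (LinearMap.injective_iff_surjective.1 hinj) b
  exact ⟨c, fun β => by rw [← hA]; exact congrFun hc β⟩

/-- The square of the seminorm of order `m` of a smooth function. -/
def sqSeminorm (S : Set E3) (m : ℕ) (f : E3 → ℝ) : ℝ≥0∞ :=
  ∑ β : MultiIndex m, if ∑ i, β.1 i = m then sqL2 S (iterPartialD β.1 f) else 0

theorem sqL2_le_sqSeminorm (S : Set E3) {m : ℕ} (f : E3 → ℝ) {β : Fin 3 → ℕ}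
    (h : ∑ i, β i = m) : sqL2 S (iterPartialD β f) ≤ sqSeminorm S m f := by
  have := Finset.single_le_sum (f := fun β : MultiIndex m =>
    if ∑ i, β.1 i = m then sqL2 S (iterPartialD β.1 f) else 0) (fun _ _ => zero_le)
    (Finset.mem_univ ⟨β, h.le⟩)
  dsimp only at this
  rwa [if_pos h] at this

/-- Poincaré's inequality is iterated from order `k + 1` downwards. Each step costs `72 = 24 · 3`,
with three derivatives of the next order. -/
theorem sqL2_iterPartialD_le_of_moments {k : ℕ} {g : E3 → ℝ} (hg : ContDiff ℝ ∞ g)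
    (h0 : ∀ β : MultiIndex k, ∫ y in unitCube, iterPartialD β.1 g y = 0) (j : ℕ) :
    ∀ β : Fin 3 → ℕ, ∑ i, β i + j = k + 1 →
      sqL2 unitCube (iterPartialD β g) ≤ 72 ^ j * sqSeminorm unitCube (k + 1) g := by
  induction j with
  | zero => intro β hβ; simpa using sqL2_le_sqSeminorm unitCube g hβ
  | succ j ih =>
    intro β hβ
    have h1 := sqL2_le_of_integral_eq_zero (contDiff_iterPartialD hg β) (h0 ⟨β, by omega⟩)
    calc _ ≤ 24 * ∑ i, sqL2 unitCube (partialD i (iterPartialD β g)) := h1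
      _ ≤ 24 * ∑ i : Fin 3, 72 ^ j * sqSeminorm unitCube (k + 1) g := by
        gcongr with i _
        rw [← iterPartialD_add_single hg]
        apply ih
        simp only [Pi.add_apply, Finset.sum_add_distrib, Finset.sum_pi_single', Finset.mem_univ,
          if_true]
        omega
      _ = _ := by
        simp only [Finset.sum_const, Finset.card_univ, Fintype.card_fin, nsmul_eq_mul,
          Nat.cast_ofNat]
        ring

/-- Subtract the polynomial with the same mean derivatives up to order `k`. All lower derivatives of
the difference are then controlled by those of order `k + 1`, and the pointwise bound follows from
the `H²` embedding, as `2 ≤ k + 1`. -/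
theorem exists_bramble_hilbert {k : ℕ} (hk : 1 ≤ k) : ∃ C : ℝ≥0, ∀ f : E3 → ℝ, ContDiff ℝ ∞ f →
    ∃ c : MultiIndex k → ℝ,
      (∀ i, sqL2 unitCube (partialD i fun y => f y - multiPoly c y) ≤
        C * sqSeminorm unitCube (k + 1) f) ∧
      ∀ p ∈ unitCube, ‖f p - multiPoly c p‖ₑ ^ 2 ≤ C * sqSeminorm unitCube (k + 1) f := by
  obtain ⟨C, hC⟩ := exists_enorm_sq_le_H2
  refine ⟨(C + 1) * 72 ^ (k + 1), fun f hf => ?_⟩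
  obtain ⟨c, hc⟩ := exists_multiPoly_moments fun β : MultiIndex k =>
    ∫ y in unitCube, iterPartialD β.1 f y
  refine ⟨c, ?_⟩
  set g : E3 → ℝ := fun y => f y - multiPoly c y with hgdef
  have hq := contDiff_multiPoly c
  have hg : ContDiff ℝ ∞ g := hf.sub hq
  have h0 : ∀ β : MultiIndex k, ∫ y in unitCube, iterPartialD β.1 g y = 0 := by
    intro β
    rw [hgdef, iterPartialD_sub hf hq, integral_sub
      (integrable_unitCube (contDiff_iterPartialD hf β.1).continuous)
      (integrable_unitCube (contDiff_iterPartialD hq β.1).continuous), hc, sub_self]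
  have hS : sqSeminorm unitCube (k + 1) g = sqSeminorm unitCube (k + 1) f := by
    refine Finset.sum_congr rfl fun β _ => ?_
    split_ifs with hβ
    · rw [hgdef, iterPartialD_sub hf hq, iterPartialD_multiPoly_of_lt c (by omega)]
      simp
    · rfl
  have hle : ∀ β : Fin 3 → ℕ, ∑ i, β i ≤ k + 1 → sqL2 unitCube (iterPartialD β g) ≤
      72 ^ (k + 1) * sqSeminorm unitCube (k + 1) f := by
    intro β hβ
    have := sqL2_iterPartialD_le_of_moments hg h0 (k + 1 - ∑ i, β i) β (by omega)
    rw [hS] at this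
    refine this.trans ?_
    gcongr
    · norm_num
    · omega
  have e1 : ∀ i, sqL2 unitCube (partialD i g) ≤ 72 ^ (k + 1) * sqSeminorm unitCube (k + 1) f := by
    intro i
    rw [← iterPartialD_single hg]
    exact hle _ (by simp)
  have e2 : ∀ i j, sqL2 unitCube (partialD j (partialD i g)) ≤
      72 ^ (k + 1) * sqSeminorm unitCube (k + 1) f := by
    intro i j
    rw [← iterPartialD_single hg, ← iterPartialD_add_single hg]
    refine hle _ ?_
    simp only [Pi.add_apply, Finset.sum_add_distrib, Finset.sum_pi_single', Finset.mem_univ,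
      if_true]
    omega
  constructor
  · intro i
    refine (e1 i).trans ?_
    push_cast
    gcongr
    exact le_mul_of_one_le_left' le_add_self
  · intro p hp
    refine (hC g hg _ (hle 0 (by simp)) e1 e2 p hp).trans ?_
    push_cast
    rw [← mul_assoc]
    gcongr
    exact le_self_add

/-! ### Lagrange interpolation on boxes -/

/-- The Lagrange basis polynomials for equidistant nodes in `[0,1]`. -/
def refBasis (k : ℕ) (j : Fin (k + 1)) : Polynomial ℝ :=
  Lagrange.basis Finset.univ (fun j : Fin (k + 1) => (j : ℝ) / k) j

theorem injective_node {k : ℕ} (hk : 1 ≤ k) :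
    Function.Injective fun j : Fin (k + 1) => (j : ℝ) / k := by
  intro a b h
  have hk0 : (k : ℝ) ≠ 0 := by positivity
  have h1 : (a : ℝ) = b := by simpa [div_left_inj' hk0] using h
  exact Fin.ext (by exact_mod_cast h1)

theorem natDegree_refBasis {k : ℕ} (hk : 1 ≤ k) (j : Fin (k + 1)) :
    (refBasis k j).natDegree = k := by
  rw [refBasis, Lagrange.natDegree_basis (injective_node hk).injOn (Finset.mem_univ j)]
  simp

theorem eval_eq_sum_refBasis {k : ℕ} (hk : 1 ≤ k) {p : Polynomial ℝ} (hp : p.natDegree ≤ k)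
    (t : ℝ) : p.eval t = ∑ j : Fin (k + 1), p.eval ((j : ℝ) / k) * (refBasis k j).eval t := by
  have h := Lagrange.eq_interpolate (s := Finset.univ) (f := p) (injective_node hk).injOn (by
    rw [Finset.card_univ, Fintype.card_fin]
    exact (Polynomial.degree_le_natDegree).trans_lt (by exact_mod_cast Nat.lt_succ_of_le hp))
  conv_lhs => rw [h]
  rw [Lagrange.interpolate_apply, Polynomial.eval_finsetSum]
  simp [refBasis]

/-- The Lagrange basis polynomials for equidistant nodes in `[t₀, t₁]`. -/
def intervalBasis (k : ℕ) (t₀ t₁ : ℝ) (j : Fin (k + 1)) : Polynomial ℝ :=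
  (refBasis k j).comp (Polynomial.C (t₁ - t₀)⁻¹ * (Polynomial.X - Polynomial.C t₀))

theorem natDegree_intervalBasis_le {k : ℕ} (hk : 1 ≤ k) (t₀ t₁ : ℝ) (j : Fin (k + 1)) :
    (intervalBasis k t₀ t₁ j).natDegree ≤ k := by
  refine Polynomial.natDegree_comp_le.trans ?_
  rw [natDegree_refBasis hk]
  refine (Nat.mul_le_mul_left k (?_ : _ ≤ 1)).trans_eq (mul_one k)
  exact (Polynomial.natDegree_C_mul_le _ _).trans (Polynomial.natDegree_X_sub_C_le _)

theorem eval_intervalBasis {k : ℕ} (t₀ t₁ t : ℝ) (j : Fin (k + 1)) :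
    (intervalBasis k t₀ t₁ j).eval t = (refBasis k j).eval ((t₁ - t₀)⁻¹ * (t - t₀)) := by
  simp [intervalBasis]

/-- The nodes of the reference cube. -/
def refNode (k : ℕ) (a : Fin 3 → Fin (k + 1)) : E3 := WithLp.toLp 2 fun i => (a i : ℝ) / k

theorem refNode_mem {k : ℕ} (a : Fin 3 → Fin (k + 1)) : refNode k a ∈ unitCube := by
  intro i
  have h : ((a i : ℕ) : ℝ) ≤ k := by exact_mod_cast Nat.le_of_lt_succ (a i).2
  exact ⟨by simp only [refNode, Pi.zero_apply]; positivity, div_le_one_of_le₀ h (by positivity)⟩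

/-- The shape functions of the box with corners `lo`, `hi`. -/
def shapeFn (k : ℕ) (lo hi : Fin 3 → ℝ) (a : Fin 3 → Fin (k + 1)) : E3 → ℝ :=
  tensorPoly fun i => intervalBasis k (lo i) (hi i) (a i)

/-- The Lagrange interpolant on the box with corners `lo`, `hi`. -/
def boxInterp (k : ℕ) (lo hi : Fin 3 → ℝ) (f : E3 → ℝ) : E3 → ℝ :=
  fun y => ∑ a, f (diagMap lo (hi - lo) (refNode k a)) * shapeFn k lo hi a y

theorem contDiff_shapeFn (k : ℕ) (lo hi : Fin 3 → ℝ) (a : Fin 3 → Fin (k + 1)) :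
    ContDiff ℝ ∞ (shapeFn k lo hi a) := contDiff_tensorPoly _

theorem contDiff_boxInterp (k : ℕ) (lo hi : Fin 3 → ℝ) (f : E3 → ℝ) :
    ContDiff ℝ ∞ (boxInterp k lo hi f) :=
  ContDiff.sum fun a _ => contDiff_const.mul (contDiff_shapeFn k lo hi a)

theorem partialD_boxInterp (k : ℕ) (lo hi : Fin 3 → ℝ) (f : E3 → ℝ) (i : Fin 3) :
    partialD i (boxInterp k lo hi f) = fun y =>
      ∑ a, f (diagMap lo (hi - lo) (refNode k a)) * partialD i (shapeFn k lo hi a) y := by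
  have h := iterPartialD_sum Finset.univ (f := fun a y =>
    f (diagMap lo (hi - lo) (refNode k a)) * shapeFn k lo hi a y)
    (fun a => contDiff_const.mul (contDiff_shapeFn k lo hi a)) (Pi.single i 1)
  rw [← iterPartialD_single (contDiff_boxInterp k lo hi f),
    show boxInterp k lo hi f = fun y => ∑ a, f (diagMap lo (hi - lo) (refNode k a)) *
      shapeFn k lo hi a y from rfl, h]
  funext y
  refine Finset.sum_congr rfl fun a _ => ?_
  rw [iterPartialD_const_mul (contDiff_shapeFn k lo hi a),
    iterPartialD_single (contDiff_shapeFn k lo hi a)]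

theorem boxInterp_sub (k : ℕ) (lo hi : Fin 3 → ℝ) (f g : E3 → ℝ) :
    boxInterp k lo hi (fun y => f y - g y) =
      fun y => boxInterp k lo hi f y - boxInterp k lo hi g y := by
  funext y
  simp only [boxInterp, sub_mul, Finset.sum_sub_distrib]

theorem diagMap_zero_one (s : E3) : diagMap 0 1 s = s := by
  ext i
  simp [diagMap]

/-- A monomial of total degree at most `k` has each exponent at most `k`. One-dimensional
interpolation is therefore exact in every factor, and the product of the three sums expands into the
sum over the nodes. -/
theorem boxInterp_multiPoly {k : ℕ} (hk : 1 ≤ k) (c : MultiIndex k → ℝ) :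
    boxInterp k 0 1 (multiPoly c) = multiPoly c := by
  funext y
  have h1 : ∀ γ : MultiIndex k, monom γ.1 y =
      ∑ a, monom γ.1 (refNode k a) * shapeFn k 0 1 a y := by
    intro γ
    have hd : ∀ i, γ.1 i ≤ k := fun i =>
      (Finset.single_le_sum (f := γ.1) (fun _ _ => Nat.zero_le _) (Finset.mem_univ i)).trans γ.2
    calc monom γ.1 y = ∏ i, ∑ j : Fin (k + 1), (Polynomial.X ^ γ.1 i : Polynomial ℝ).eval
          ((j : ℝ) / k) * (refBasis k j).eval (y i) := by
          change ∏ i, (Polynomial.X ^ γ.1 i : Polynomial ℝ).eval (y i) = _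
          refine Finset.prod_congr rfl fun i _ => ?_
          exact eval_eq_sum_refBasis hk (by simpa using hd i) _
      _ = _ := by
          rw [Finset.prod_univ_sum, Fintype.piFinset_univ]
          refine Finset.sum_congr rfl fun a _ => ?_
          rw [Finset.prod_mul_distrib]
          congr 1
          simp only [shapeFn, tensorPoly, eval_intervalBasis]
          simp
  simp only [boxInterp, multiPoly, sub_zero, diagMap_zero_one, Finset.sum_mul]
  rw [Finset.sum_comm]
  refine Finset.sum_congr rfl fun γ _ => ?_
  rw [h1 γ, Finset.mul_sum]
  refine Finset.sum_congr rfl fun a _ => ?_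
  ring

theorem sqL2_lt_top_of_continuous {lo hi : Fin 3 → ℝ} {f : E3 → ℝ} (hf : Continuous f) :
    sqL2 (cbox lo hi) f < ⊤ := by
  have h : IntegrableOn (fun y => f y ^ 2) (cbox lo hi) :=
    (hf.pow 2).continuousOn.integrableOn_compact (isCompact_cbox lo hi)
  have h2 : ∫⁻ y in cbox lo hi, ‖f y ^ 2‖ₑ < ⊤ := h.2
  simpa only [sqL2, enorm_pow] using h2

theorem sqL2_sum_le {ι : Type*} [Fintype ι] (S : Set E3) {f : ι → E3 → ℝ}
    (hf : ∀ a, Continuous (f a)) :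
    sqL2 S (fun y => ∑ a, f a y) ≤ Fintype.card ι * ∑ a, sqL2 S (f a) := by
  simp only [sqL2]
  rw [← lintegral_finsetSum _ fun a _ => (hf a).measurable.enorm.pow_const 2,
    ← lintegral_const_mul' _ _ (by simp)]
  refine lintegral_mono fun y => ?_
  calc ‖∑ a, f a y‖ₑ ^ 2 ≤ (∑ a, ‖f a y‖ₑ) ^ 2 := by gcongr; exact enorm_sum_le _ _
    _ ≤ _ := by simpa using ENNReal.sum_sq_le Finset.univ fun a => ‖f a y‖ₑ

theorem sqL2_sub_le (S : Set E3) {f g : E3 → ℝ} (hf : Continuous f) :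
    sqL2 S (fun y => f y - g y) ≤ 2 * (sqL2 S f + sqL2 S g) := by
  have h := sqL2_add_le S (f := f) (g := fun y => -g y) hf.aestronglyMeasurable
  simpa [sub_eq_add_neg, sqL2] using h

/-- The interpolation error on the reference cube. -/
theorem exists_refInterp_estimate {k : ℕ} (hk : 1 ≤ k) : ∃ C : ℝ≥0, ∀ f : E3 → ℝ,
    ContDiff ℝ ∞ f → ∀ i, sqL2 unitCube (partialD i fun y => f y - boxInterp k 0 1 f y) ≤
      C * sqSeminorm unitCube (k + 1) f := by
  obtain ⟨C, hC⟩ := exists_bramble_hilbert hk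
  set n : ℝ≥0∞ := (Fintype.card (Fin 3 → Fin (k + 1)) : ℝ≥0∞) with hn
  set B : ℝ≥0∞ := ∑ a, ∑ i, sqL2 unitCube (partialD i (shapeFn k 0 1 a)) with hB
  have hBfin : B ≠ ⊤ := (ENNReal.sum_lt_top.2 fun a _ => ENNReal.sum_lt_top.2 fun i _ =>
    sqL2_lt_top_of_continuous (continuous_partialD (contDiff_shapeFn k 0 1 a) i)).ne
  have hfin : 2 * (1 + n * (n * B)) * C ≠ ⊤ := by
    have : n ≠ ⊤ := by simp [hn]
    finiteness
  refine ⟨(2 * (1 + n * (n * B)) * C).toNNReal, fun f hf i => ?_⟩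
  rw [ENNReal.coe_toNNReal hfin]
  obtain ⟨c, hc1, hc2⟩ := hC f hf
  set g : E3 → ℝ := fun y => f y - multiPoly c y with hgdef
  have hg : ContDiff ℝ ∞ g := hf.sub (contDiff_multiPoly c)
  set S := sqSeminorm unitCube (k + 1) f
  -- Interpolation reproduces the polynomial, so `f` and `g` have the same interpolation error.
  have h1 : (fun y => f y - boxInterp k 0 1 f y) = fun y => g y - boxInterp k 0 1 g y := by
    funext y
    rw [hgdef, boxInterp_sub, boxInterp_multiPoly hk]
    ring
  have h2 : partialD i (fun y => g y - boxInterp k 0 1 g y) =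
      fun y => partialD i g y - partialD i (boxInterp k 0 1 g) y := by
    have := iterPartialD_sub hg (contDiff_boxInterp k 0 1 g) (Pi.single i 1)
    rwa [iterPartialD_single (hg.sub (contDiff_boxInterp k 0 1 g)), iterPartialD_single hg,
      iterPartialD_single (contDiff_boxInterp k 0 1 g)] at this
  -- The interpolant of `g` is a combination of fixed shape functions with the nodal values of `g`
  -- as coefficients, and these are bounded pointwise. One `n` comes from Cauchy–Schwarz, the other
  -- from bounding each summand by the total `B`.
  have h3 : sqL2 unitCube (partialD i (boxInterp k 0 1 g)) ≤ n * (n * B) * (C * S) := by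
    rw [partialD_boxInterp]
    refine (sqL2_sum_le unitCube fun a => continuous_const.mul
      (continuous_partialD (contDiff_shapeFn k 0 1 a) i)).trans ?_
    rw [mul_assoc]
    refine mul_le_mul_right ?_ n
    calc _ ≤ ∑ a : Fin 3 → Fin (k + 1), (C * S) * B := by
          gcongr with a _
          change sqL2 unitCube (fun y => g (diagMap 0 (1 - 0) (refNode k a)) *
            partialD i (shapeFn k 0 1 a) y) ≤ _
          rw [sqL2_const_mul]
          gcongr
          · apply hc2
            simpa [diagMap_zero_one] using refNode_mem a
          · refine (Finset.single_le_sum (f := fun i =>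
              sqL2 unitCube (partialD i (shapeFn k 0 1 a))) (fun _ _ => zero_le)
              (Finset.mem_univ i)).trans ?_
            exact Finset.single_le_sum (f := fun a =>
              ∑ i, sqL2 unitCube (partialD i (shapeFn k 0 1 a))) (fun _ _ => zero_le)
              (Finset.mem_univ a)
      _ = _ := by
          rw [Finset.sum_const, Finset.card_univ, nsmul_eq_mul, ← hn]
          ring
  rw [h1, h2]
  calc _ ≤ 2 * (sqL2 unitCube (partialD i g) + sqL2 unitCube (partialD i (boxInterp k 0 1 g))) :=
        sqL2_sub_le _ (continuous_partialD hg i)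
    _ ≤ 2 * (C * S + n * (n * B) * (C * S)) := by gcongr; exact hc1 i
    _ = _ := by ring

/-! #### Scaling -/

/-- The value of the Jacobian factor is immaterial: it occurs on both sides of the scaled estimates
and only has to be cancelled. -/
theorem exists_map_diagMap_volume (a : Fin 3 → ℝ) {ℓ : Fin 3 → ℝ} (hℓ : ∀ i, ℓ i ≠ 0) :
    ∃ c : ℝ≥0∞, c ≠ 0 ∧ c ≠ ⊤ ∧ (volume : Measure E3).map (diagMap a ℓ) = c • volume := by
  let L : E3 →ₗ[ℝ] E3 :=
    { toFun := fun s => WithLp.toLp 2 fun i => ℓ i * s i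
      map_add' := fun s t => by ext i; simp [mul_add]
      map_smul' := fun r s => by ext i; simp [mul_left_comm] }
  let L' : E3 →ₗ[ℝ] E3 :=
    { toFun := fun s => WithLp.toLp 2 fun i => (ℓ i)⁻¹ * s i
      map_add' := fun s t => by ext i; simp [mul_add]
      map_smul' := fun r s => by ext i; simp [mul_left_comm] }
  have hLL : L ∘ₗ L' = LinearMap.id := by
    ext s i
    simp [L, L', hℓ]
  have hdet : LinearMap.det L ≠ 0 := by
    intro h0
    have := congrArg LinearMap.det hLL
    rw [LinearMap.det_comp, h0, zero_mul, LinearMap.det_id] at this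
    exact zero_ne_one this
  refine ⟨ENNReal.ofReal |(LinearMap.det L)⁻¹|, ?_, ENNReal.ofReal_ne_top, ?_⟩
  · rw [ne_eq, ENNReal.ofReal_eq_zero, not_le]
    positivity
  have h2 : diagMap a ℓ = (fun y => WithLp.toLp 2 a + y) ∘ L := by
    funext s
    ext i
    simp [diagMap, L]
  rw [h2, ← Measure.map_map (by fun_prop) L.continuous_of_finiteDimensional.measurable,
    Measure.map_linearMap_addHaar_eq_smul_addHaar _ hdet, Measure.map_smul,
    map_add_left_eq_self]

theorem diagMap_preimage_cbox {lo hi : Fin 3 → ℝ} (h : ∀ i, lo i < hi i) :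
    diagMap lo (hi - lo) ⁻¹' cbox lo hi = unitCube := by
  ext s
  simp only [mem_preimage, cbox, mem_ofPred_eq]
  refine forall_congr' fun i => ?_
  have hi' : 0 < hi i - lo i := sub_pos.2 (h i)
  simp only [diagMap, Pi.sub_apply, mem_Icc, Pi.zero_apply, Pi.one_apply]
  constructor
  · rintro ⟨h1, h2⟩
    exact ⟨by nlinarith, by nlinarith⟩
  · rintro ⟨h1, h2⟩
    exact ⟨by nlinarith, by nlinarith⟩

theorem diagMap_mem_cbox {lo hi : Fin 3 → ℝ} (h : ∀ i, lo i < hi i) {s : E3}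
    (hs : s ∈ unitCube) : diagMap lo (hi - lo) s ∈ cbox lo hi := by
  rw [← diagMap_preimage_cbox h] at hs
  exact hs

theorem exists_sqL2_comp_diagMap {lo hi : Fin 3 → ℝ} (h : ∀ i, lo i < hi i) :
    ∃ c : ℝ≥0∞, c ≠ 0 ∧ c ≠ ⊤ ∧ ∀ f : E3 → ℝ, Continuous f →
      sqL2 unitCube (fun s => f (diagMap lo (hi - lo) s)) = c * sqL2 (cbox lo hi) f := by
  obtain ⟨c, h0, h1, h2⟩ := exists_map_diagMap_volume lo (ℓ := hi - lo)
    fun i => (sub_pos.2 (h i)).ne'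
  refine ⟨c, h0, h1, fun f hf => ?_⟩
  simp only [sqL2]
  rw [← diagMap_preimage_cbox h, ← setLIntegral_map (f := fun y => ‖f y‖ₑ ^ 2)
    (measurableSet_cbox lo hi) (hf.measurable.enorm.pow_const 2)
    (contDiff_diagMap lo (hi - lo)).continuous.measurable, h2, Measure.restrict_smul,
    lintegral_smul_measure, smul_eq_mul]

theorem boxInterp_comp_diagMap {k : ℕ} {lo hi : Fin 3 → ℝ} (h : ∀ i, lo i < hi i) (f : E3 → ℝ)
    (s : E3) : boxInterp k lo hi f (diagMap lo (hi - lo) s) =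
      boxInterp k 0 1 (fun s => f (diagMap lo (hi - lo) s)) s := by
  simp only [boxInterp, sub_zero, diagMap_zero_one]
  refine Finset.sum_congr rfl fun a _ => ?_
  congr 1
  simp only [shapeFn, tensorPoly, eval_intervalBasis]
  refine Finset.prod_congr rfl fun i _ => ?_
  have hi' : hi i - lo i ≠ 0 := (sub_pos.2 (h i)).ne'
  congr 1
  simp [diagMap, hi']

theorem sqSeminorm_comp_diagMap_le {lo hi : Fin 3 → ℝ} (h : ∀ i, lo i < hi i) {d : ℝ}
    (hd : ∀ i, hi i - lo i ≤ d) {c : ℝ≥0∞} (hc : ∀ f : E3 → ℝ, Continuous f →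
      sqL2 unitCube (fun s => f (diagMap lo (hi - lo) s)) = c * sqL2 (cbox lo hi) f) {f : E3 → ℝ}
    (hf : ContDiff ℝ ∞ f) (m : ℕ) : sqSeminorm unitCube m (fun s => f (diagMap lo (hi - lo) s)) ≤
      c * (ENNReal.ofReal d ^ (2 * m) * sqSeminorm (cbox lo hi) m f) := by
  simp only [sqSeminorm]
  rw [Finset.mul_sum, Finset.mul_sum]
  refine Finset.sum_le_sum fun β _ => ?_
  split_ifs with hβ
  · rw [iterPartialD_comp_diagMap hf, sqL2_const_mul, hc _ (contDiff_iterPartialD hf β.1).continuous]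
    have h1 : ‖∏ i, (hi - lo) i ^ β.1 i‖ₑ ^ 2 ≤ ENNReal.ofReal d ^ (2 * m) := by
      have h0 : ∀ i, 0 ≤ (hi - lo) i := fun i => (sub_pos.2 (h i)).le
      have hd0 : 0 ≤ d := (h0 0).trans (hd 0)
      rw [Real.enorm_of_nonneg (Finset.prod_nonneg fun i _ => pow_nonneg (h0 i) _), mul_comm 2 m,
        pow_mul, ← ENNReal.ofReal_pow hd0]
      gcongr
      calc ∏ i, (hi - lo) i ^ β.1 i ≤ ∏ i, d ^ β.1 i :=
            Finset.prod_le_prod (fun i _ => pow_nonneg (h0 i) _)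
              fun i _ => pow_le_pow_left₀ (h0 i) (hd i) _
        _ = d ^ m := by rw [Finset.prod_pow_eq_pow_sum, hβ]
    calc _ ≤ ENNReal.ofReal d ^ (2 * m) * (c * sqL2 (cbox lo hi) (iterPartialD β.1 f)) := by gcongr
      _ = _ := by ring
  · simp

/-- The interpolation error on a shape regular box. -/
theorem exists_boxInterp_estimate {k : ℕ} (hk : 1 ≤ k) (σ : ℝ) : ∃ C : ℝ≥0,
    ∀ (lo hi : Fin 3 → ℝ) (d : ℝ), (∀ i, lo i < hi i) → (∀ i, hi i - lo i ≤ d) →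
      (∀ i, d ≤ σ * (hi i - lo i)) → ∀ f : E3 → ℝ, ContDiff ℝ ∞ f → ∀ i,
      sqL2 (cbox lo hi) (partialD i fun y => f y - boxInterp k lo hi f y) ≤
        C * (ENNReal.ofReal d ^ (2 * k) * sqSeminorm (cbox lo hi) (k + 1) f) := by
  obtain ⟨C, hC⟩ := exists_refInterp_estimate hk
  -- Scaling produces the squared side length in direction `i` on the left and `d^(2k+2)` on the
  -- right. Shape regularity bounds `d²` by `σ²` times that squared side, leaving `d^(2k)`.
  refine ⟨C * (σ ^ 2).toNNReal, fun lo hi d h hd hσ f hf i => ?_⟩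
  obtain ⟨c, hc0, hc1, hc⟩ := exists_sqL2_comp_diagMap h
  have hF : ContDiff ℝ ∞ fun s => f (diagMap lo (hi - lo) s) := hf.comp (contDiff_diagMap _ _)
  have hE : ContDiff ℝ ∞ fun y => f y - boxInterp k lo hi f y :=
    hf.sub (contDiff_boxInterp k lo hi f)
  have h1 := (hC _ hF i).trans (mul_le_mul_right
    (sqSeminorm_comp_diagMap_le h hd hc hf (k + 1)) (C : ℝ≥0∞))
  have h2 : (fun s => f (diagMap lo (hi - lo) s) - boxInterp k 0 1
      (fun s => f (diagMap lo (hi - lo) s)) s) =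
      fun s => (fun y => f y - boxInterp k lo hi f y) (diagMap lo (hi - lo) s) := by
    funext s
    simp only [boxInterp_comp_diagMap h]
  rw [h2, partialD_comp_diagMap (hE.differentiable (by simp)), sqL2_const_mul,
    hc _ (continuous_partialD hE i)] at h1
  set E := sqL2 (cbox lo hi) (partialD i fun y => f y - boxInterp k lo hi f y)
  set S := sqSeminorm (cbox lo hi) (k + 1) f
  set r := ENNReal.ofReal ((hi - lo) i) with hr
  have hl : 0 < (hi - lo) i := sub_pos.2 (h i)
  have hr0 : r ≠ 0 := by rw [hr, ne_eq, ENNReal.ofReal_eq_zero, not_le]; exact hl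
  have hr1 : r ≠ ⊤ := ENNReal.ofReal_ne_top
  rw [Real.enorm_of_nonneg hl.le, ← hr] at h1
  have hd0 : 0 < d := hl.trans_le (hd i)
  have hσ0 : 0 ≤ σ := by
    have := hσ i
    by_contra hneg
    push Not at hneg
    have h3 : σ * (hi i - lo i) < 0 := mul_neg_of_neg_of_pos hneg hl
    linarith
  have hdr : ENNReal.ofReal d ^ 2 ≤ ENNReal.ofReal (σ ^ 2) * r ^ 2 := by
    rw [hr, ← ENNReal.ofReal_pow hd0.le, ← ENNReal.ofReal_pow hl.le,
      ← ENNReal.ofReal_mul (sq_nonneg σ), ← mul_pow]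
    gcongr
    exact hσ i
  have h3 : (r ^ 2 * c) * E ≤ (r ^ 2 * c) *
      ((C * (σ ^ 2).toNNReal : ℝ≥0) * (ENNReal.ofReal d ^ (2 * k) * S)) := by
    calc (r ^ 2 * c) * E = r ^ 2 * (c * E) := by ring
      _ ≤ _ := h1
      _ = c * C * ENNReal.ofReal d ^ (2 * k) * S * ENNReal.ofReal d ^ 2 := by ring
      _ ≤ c * C * ENNReal.ofReal d ^ (2 * k) * S * (ENNReal.ofReal (σ ^ 2) * r ^ 2) := by gcongr
      _ = _ := by
        push_cast
        rw [show ENNReal.ofReal (σ ^ 2) = ((σ ^ 2).toNNReal : ℝ≥0∞) from rfl]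
        ring
  exact (ENNReal.mul_le_mul_iff_right (mul_ne_zero (pow_ne_zero _ hr0) hc0)
    (ENNReal.mul_ne_top (ENNReal.pow_ne_top hr1) hc1)).1 h3

/-- The Sobolev embedding `H² ⊂ C` for a box. -/
theorem exists_enorm_sq_le_box {lo hi : Fin 3 → ℝ} (h : ∀ i, lo i < hi i) : ∃ C : ℝ≥0,
    ∀ f : E3 → ℝ, ContDiff ℝ ∞ f → ∀ S : ℝ≥0∞,
      (∀ β : Fin 3 → ℕ, ∑ i, β i ≤ 2 → sqL2 (cbox lo hi) (iterPartialD β f) ≤ S) →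
      ∀ p ∈ cbox lo hi, ‖f p‖ₑ ^ 2 ≤ C * S := by
  obtain ⟨C, hC⟩ := exists_enorm_sq_le_H2
  obtain ⟨c, hc0, hc1, hc⟩ := exists_sqL2_comp_diagMap h
  -- The constant may depend on the box here: the result yields only continuity of the limit, not
  -- the rate of convergence.
  have hB : ∃ B : ℝ≥0∞, B ≠ ⊤ ∧ ∀ β : MultiIndex 2, ‖∏ i, (hi - lo) i ^ β.1 i‖ₑ ^ 2 ≤ B := by
    have hgen : ∀ F : MultiIndex 2 → ℝ≥0∞, (∀ β, F β < ⊤) → ∃ B : ℝ≥0∞, B ≠ ⊤ ∧ ∀ β, F β ≤ B :=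
      fun F hF => ⟨∑ β, F β, (ENNReal.sum_lt_top.2 fun β _ => hF β).ne,
        fun β => Finset.single_le_sum (fun _ _ => zero_le) (Finset.mem_univ β)⟩
    exact hgen _ fun β => by finiteness
  obtain ⟨B, hBfin, hB⟩ := hB
  refine ⟨(C * (B * c)).toNNReal, fun f hf S hS p hp => ?_⟩
  rw [ENNReal.coe_toNNReal (by finiteness)]
  have hF : ContDiff ℝ ∞ fun s => f (diagMap lo (hi - lo) s) := hf.comp (contDiff_diagMap _ _)
  have hle : ∀ β : Fin 3 → ℕ, ∑ i, β i ≤ 2 →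
      sqL2 unitCube (iterPartialD β fun s => f (diagMap lo (hi - lo) s)) ≤ B * c * S := by
    intro β hβ
    rw [iterPartialD_comp_diagMap hf, sqL2_const_mul, hc _ (contDiff_iterPartialD hf β).continuous,
      mul_assoc]
    have h6 := hB ⟨β, hβ⟩
    exact mul_le_mul' h6 (mul_le_mul_right (hS β hβ) c)
  have h3 : ∀ s ∈ unitCube, ‖f (diagMap lo (hi - lo) s)‖ₑ ^ 2 ≤ C * (B * c * S) := by
    refine hC _ hF _ (hle 0 (by simp)) (fun i => ?_) fun i j => ?_
    · rw [← iterPartialD_single hF]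
      exact hle _ (by simp)
    · rw [← iterPartialD_single hF, ← iterPartialD_add_single hF]
      refine hle _ ?_
      simp [Finset.sum_add_distrib]
  have h4 : diagMap lo (hi - lo) (WithLp.toLp 2 fun i => (hi i - lo i)⁻¹ * (p i - lo i)) = p := by
    ext i
    have hi' : hi i - lo i ≠ 0 := (sub_pos.2 (h i)).ne'
    simp [diagMap, hi']
  have h5 := h3 (WithLp.toLp 2 fun i => (hi i - lo i)⁻¹ * (p i - lo i)) (by
    rw [← diagMap_preimage_cbox h, mem_preimage, h4]; exact hp)
  rw [h4] at h5
  rw [mul_assoc]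
  exact h5

section Mollification

open scoped Convolution

/-! ### Approximation by smooth functions on convex domains -/

/-- A smooth probability density supported in `D`. -/
structure IsMollifier (D : Set E3) (η : E3 → ℝ) : Prop where
  contDiff : ContDiff ℝ ∞ η
  hasCompactSupport : HasCompactSupport η
  tsupport_subset : tsupport η ⊆ D
  nonneg : ∀ z, 0 ≤ η z
  integral_eq_one : ∫ z, η z = 1

theorem exists_isMollifier {D : Set E3} (hD : IsOpen D) (hne : D.Nonempty) :
    ∃ η, IsMollifier D η := by
  obtain ⟨c, hc⟩ := hne
  obtain ⟨r, hr, hrD⟩ := Metric.isOpen_iff.1 hD c hc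
  let b : ContDiffBump c := ⟨r / 4, r / 2, by positivity, by linarith⟩
  refine ⟨b.normed volume, b.contDiff_normed, b.hasCompactSupport_normed, ?_,
    fun z => b.nonneg_normed z, b.integral_normed⟩
  rw [b.tsupport_normed_eq]
  exact (Metric.closedBall_subset_ball (by change r / 2 < r; linarith)).trans hrD

/-- The average of `g` over the points `(1 - s) y + s z`, `z ∈ D`, with density `η`. -/
def mollify (D : Set E3) (η : E3 → ℝ) (s : ℝ) (g : E3 → ℝ) (y : E3) : ℝ :=
  ∫ z, η z * D.indicator g ((1 - s) • y + s • z)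

/-- The convolution kernel of `mollify`. -/
def mollifyKernel (η : E3 → ℝ) (s : ℝ) (v : E3) : ℝ := (s ^ 3)⁻¹ * η (-s⁻¹ • v)

/-- Substituting `t = (1 - s) y + s z` gives a convolution with a rescaled, reflected copy of `η`,
evaluated at the contracted point `(1 - s) y`. Smoothness and derivatives are read off from this
form. -/
theorem mollify_eq_convolution {D : Set E3} {η : E3 → ℝ} {s : ℝ} (hs : 0 < s) (g : E3 → ℝ)
    (y : E3) : mollify D η s g y =
      (D.indicator g ⋆[ContinuousLinearMap.mul ℝ ℝ, volume] mollifyKernel η s) ((1 - s) • y) := by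
  set x := (1 - s) • y
  set F := D.indicator g
  have h1 : ∀ z, η z * F (x + s • z) = (fun v => η (s⁻¹ • v) * F (x + v)) (s • z) := fun z => by
    simp only [smul_smul, inv_mul_cancel₀ hs.ne', one_smul]
  have h2 := Measure.integral_comp_smul_of_nonneg volume
    (fun v : E3 => η (s⁻¹ • v) * F (x + v)) s (hR := hs.le)
  have h3 := integral_sub_right_eq_self (μ := (volume : Measure E3))
    (fun v => η (s⁻¹ • v) * F (x + v)) x
  calc mollify D η s g y = ∫ z, (fun v => η (s⁻¹ • v) * F (x + v)) (s • z) :=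
        integral_congr_ae (Eventually.of_forall h1)
    _ = (s ^ 3)⁻¹ • ∫ t, η (s⁻¹ • (t - x)) * F (x + (t - x)) := by
        rw [h2, ← h3, finrank_euclideanSpace_fin]
    _ = _ := by
        rw [convolution_def, ← integral_smul]
        refine integral_congr_ae (Eventually.of_forall fun t => ?_)
        simp only [ContinuousLinearMap.mul_apply', mollifyKernel, smul_eq_mul, add_sub_cancel]
        rw [show -s⁻¹ • (x - t) = s⁻¹ • (t - x) by rw [neg_smul, ← smul_neg, neg_sub]]
        ring

theorem contDiff_mollifyKernel {η : E3 → ℝ} (hη : ContDiff ℝ ∞ η) (s : ℝ) :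
    ContDiff ℝ ∞ (mollifyKernel η s) :=
  contDiff_const.mul (hη.comp (contDiff_id.const_smul (-s⁻¹)))

theorem hasCompactSupport_mollifyKernel {η : E3 → ℝ} (hη : HasCompactSupport η) {s : ℝ}
    (hs : 0 < s) : HasCompactSupport (mollifyKernel η s) := by
  refine HasCompactSupport.of_support_subset_isCompact
    (K := (fun z : E3 => -s • z) '' tsupport η) (hη.isCompact.image (by fun_prop)) ?_
  intro v hv
  refine ⟨-s⁻¹ • v, subset_tsupport _ ?_, ?_⟩
  · exact right_ne_zero_of_mul hv
  · simp [smul_smul, hs.ne']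

theorem contDiff_convolution {F κ : E3 → ℝ} (hF : LocallyIntegrable F volume)
    (hκ : ContDiff ℝ ∞ κ) (hc : HasCompactSupport κ) :
    ContDiff ℝ ∞ (F ⋆[ContinuousLinearMap.mul ℝ ℝ, volume] κ) :=
  hc.contDiff_convolution_right _ hF hκ

theorem partialD_convolution {F κ : E3 → ℝ} (hF : LocallyIntegrable F volume)
    (hκ : ContDiff ℝ ∞ κ) (hc : HasCompactSupport κ) (i : Fin 3) :
    partialD i (F ⋆[ContinuousLinearMap.mul ℝ ℝ, volume] κ) =
      F ⋆[ContinuousLinearMap.mul ℝ ℝ, volume] partialD i κ := by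
  funext x
  have h := hc.hasFDerivAt_convolution_right (ContinuousLinearMap.mul ℝ ℝ) hF
    (hκ.of_le (by simp)) x
  simp only [partialD]
  rw [h.fderiv, convolution_precompR_apply _ hF (hc.fderiv (𝕜 := ℝ))
    (hκ.continuous_fderiv (by simp))]
  rfl

theorem iterPartialD_convolution {F κ : E3 → ℝ} (hF : LocallyIntegrable F volume)
    (hκ : ContDiff ℝ ∞ κ) (hc : HasCompactSupport κ) (β : Fin 3 → ℕ) :
    iterPartialD β (F ⋆[ContinuousLinearMap.mul ℝ ℝ, volume] κ) =
      F ⋆[ContinuousLinearMap.mul ℝ ℝ, volume] iterPartialD β κ := by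
  induction β using iterPartialD_induction with
  | h0 => rfl
  | hs β i ih =>
    have h := smooth_iterPartialD ⟨hκ, hc⟩ β
    rw [iterPartialD_add_single (contDiff_convolution hF hκ hc), ih,
      partialD_convolution hF h.1 h.2, iterPartialD_add_single hκ]

theorem locallyIntegrable_indicator {D : Set E3} (hD : IsOpen D) (hfin : volume D ≠ ⊤)
    {g : E3 → ℝ} (hg : MemLp g 2 (volume.restrict D)) :
    LocallyIntegrable (D.indicator g) volume := by
  have : IsFiniteMeasure (volume.restrict D) := ⟨by rw [Measure.restrict_apply_univ]; exact hfin.lt_top⟩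
  exact ((integrable_indicator_iff hD.measurableSet).2
    (hg.integrable (by norm_num))).locallyIntegrable

theorem contDiff_mollify {D : Set E3} (hD : IsOpen D) (hfin : volume D ≠ ⊤) {η : E3 → ℝ}
    (hη : IsMollifier D η) {g : E3 → ℝ} (hg : MemLp g 2 (volume.restrict D)) {s : ℝ} (hs : 0 < s) :
    ContDiff ℝ ∞ (mollify D η s g) := by
  rw [funext (mollify_eq_convolution hs g)]
  exact (contDiff_convolution (locallyIntegrable_indicator hD hfin hg)
    (contDiff_mollifyKernel hη.contDiff s)
    (hasCompactSupport_mollifyKernel hη.hasCompactSupport hs)).comp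
      (contDiff_id.const_smul (1 - s))

/-- Derivatives of the mollification are mollifications of weak derivatives. -/
theorem iterPartialD_mollify {D : Set E3} (hD : IsOpen D) (hconv : Convex ℝ D)
    (hfin : volume D ≠ ⊤) {η : E3 → ℝ} (hη : IsMollifier D η) {g h : E3 → ℝ}
    (hg : MemLp g 2 (volume.restrict D)) {β : Fin 3 → ℕ}
    (hw : ∀ φ : E3 → ℝ, ContDiff ℝ ∞ φ → HasCompactSupport φ → tsupport φ ⊆ D →
      ∫ y in D, iterPartialD β φ y * g y = (-1 : ℝ) ^ (∑ i, β i) * ∫ y in D, φ y * h y)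
    {s : ℝ} (hs : s ∈ Ioo (0 : ℝ) 1) {y : E3} (hy : y ∈ D) :
    iterPartialD β (mollify D η s g) y = (1 - s) ^ (∑ i, β i) * mollify D η s h y := by
  set κ := mollifyKernel η s with hκdef
  have hκ : ContDiff ℝ ∞ κ := contDiff_mollifyKernel hη.contDiff s
  have hκc : HasCompactSupport κ := hasCompactSupport_mollifyKernel hη.hasCompactSupport hs.1
  have hF := locallyIntegrable_indicator hD hfin hg
  set x := (1 - s) • y with hx
  have e1 : mollify D η s g = fun y => (D.indicator g ⋆[ContinuousLinearMap.mul ℝ ℝ, volume] κ)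
      (diagMap 0 (fun _ => 1 - s) y) := by
    funext y
    rw [mollify_eq_convolution hs.1]
    congr 1
    ext i
    simp [diagMap]
  have e2 : diagMap 0 (fun _ => 1 - s) y = x := by
    ext i
    simp [diagMap, hx]
  rw [e1, iterPartialD_comp_diagMap (contDiff_convolution hF hκ hκc),
    iterPartialD_convolution hF hκ hκc]
  simp only [e2]
  rw [Finset.prod_pow_eq_pow_sum, mollify_eq_convolution hs.1, ← hx]
  congr 1
  -- The kernel `t ↦ κ (x - t)` serves as test function for the weak derivative; its reflection
  -- produces the sign `(-1)^|β|` that cancels the one in the definition.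
  have hφ1 : ContDiff ℝ ∞ fun t => κ (diagMap x (fun _ => -1) t) := hκ.comp (contDiff_diagMap _ _)
  have hdiag : ∀ t, diagMap x (fun _ => -1) t = x - t := fun t => by
    ext i
    simp [diagMap, sub_eq_add_neg]
  have hK : IsCompact ((fun z => x + s • z) '' tsupport η) :=
    hη.hasCompactSupport.isCompact.image (by fun_prop)
  have hsupp : Function.support (fun t => κ (diagMap x (fun _ => -1) t)) ⊆
      (fun z => x + s • z) '' tsupport η := by
    intro t ht
    rw [Function.mem_support, hdiag] at ht
    refine ⟨-s⁻¹ • (x - t), subset_tsupport _ (right_ne_zero_of_mul ht), ?_⟩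
    simp [smul_smul, hs.1.ne']
  -- Convexity keeps the support inside `D` for every `y ∈ D`. This is why no extension across the
  -- boundary is required.
  have hKD : (fun z => x + s • z) '' tsupport η ⊆ D := by
    rintro _ ⟨z, hz, rfl⟩
    exact hconv hy (hη.tsupport_subset hz) (by linarith [hs.2]) hs.1.le (by ring)
  have h3 := hw _ hφ1 (HasCompactSupport.of_support_subset_isCompact hK hsupp)
    ((closure_minimal hsupp hK.isClosed).trans hKD)
  rw [iterPartialD_comp_diagMap hκ] at h3
  simp only [hdiag, Finset.prod_pow_eq_pow_sum, mul_assoc] at h3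
  rw [integral_const_mul] at h3
  have h4 := mul_left_cancel₀ (pow_ne_zero _ (by norm_num)) h3
  have h5 : ∀ (ψ f : E3 → ℝ), (D.indicator f ⋆[ContinuousLinearMap.mul ℝ ℝ, volume] ψ) x =
      ∫ t in D, ψ (x - t) * f t := by
    intro ψ f
    rw [convolution_def, ← integral_indicator hD.measurableSet]
    refine integral_congr_ae (Eventually.of_forall fun t => ?_)
    by_cases ht : t ∈ D
    · simp [indicator_of_mem ht, mul_comm]
    · simp [indicator_of_notMem ht]
  rw [h5, h5]
  exact h4

/-- The probability measure with density `η`. -/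
def mollifierMeasure (η : E3 → ℝ) : Measure E3 := volume.withDensity fun z => ENNReal.ofReal (η z)

theorem isProbabilityMeasure_mollifierMeasure {D : Set E3} {η : E3 → ℝ} (hη : IsMollifier D η) :
    IsProbabilityMeasure (mollifierMeasure η) := by
  constructor
  rw [mollifierMeasure, withDensity_apply _ MeasurableSet.univ, Measure.restrict_univ,
    ← ofReal_integral_eq_lintegral_ofReal
      (hη.contDiff.continuous.integrable_of_hasCompactSupport hη.hasCompactSupport)
      (Eventually.of_forall hη.nonneg), hη.integral_eq_one, ENNReal.ofReal_one]

theorem ae_mem_mollifierMeasure {D : Set E3} {η : E3 → ℝ} (hη : IsMollifier D η) :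
    ∀ᵐ z ∂(mollifierMeasure η), z ∈ D := by
  rw [mollifierMeasure, ae_withDensity_iff hη.contDiff.continuous.measurable.ennreal_ofReal]
  refine Eventually.of_forall fun z hz => hη.tsupport_subset (subset_tsupport _ ?_)
  intro h0
  simp [h0] at hz

theorem mollify_eq_integral {D : Set E3} {η : E3 → ℝ} (hη : IsMollifier D η) (s : ℝ) (g : E3 → ℝ)
    (y : E3) : mollify D η s g y =
      ∫ z, D.indicator g ((1 - s) • y + s • z) ∂(mollifierMeasure η) := by
  rw [mollifierMeasure, integral_withDensity_eq_integral_toReal_smul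
    hη.contDiff.continuous.measurable.ennreal_ofReal (Eventually.of_forall fun z =>
      ENNReal.ofReal_lt_top)]
  refine integral_congr_ae (Eventually.of_forall fun z => ?_)
  simp only [smul_eq_mul, ENNReal.toReal_ofReal (hη.nonneg z)]

/-- By Jensen and Tonelli it suffices to fix `z`. Then `y ↦ (1 - s) y + s z` is a homothety with
centre `z ∈ D` and ratio at least `1/2`, which gives a bound uniform in `s`. -/
theorem sqL2_mollify_le {D : Set E3} (hD : IsOpen D) (hconv : Convex ℝ D)
    (hfin : volume D ≠ ⊤) {η : E3 → ℝ} (hη : IsMollifier D η) {g : E3 → ℝ} (hg : Measurable g)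
    {s : ℝ} (hs : s ∈ Ioc (0 : ℝ) (1 / 2)) : sqL2 D (mollify D η s g) ≤ 8 * sqL2 D g := by
  have := isProbabilityMeasure_mollifierMeasure hη
  have hG : Measurable fun y => ‖D.indicator g y‖ₑ ^ 2 :=
    (hg.indicator hD.measurableSet).enorm.pow_const 2
  have h8 : ENNReal.ofReal (((1 - s) ^ 3)⁻¹) ≤ 8 := by
    rw [show (8 : ℝ≥0∞) = ENNReal.ofReal 8 by simp]
    apply ENNReal.ofReal_le_ofReal
    have h2 : 1 / 2 ≤ 1 - s := by linarith [hs.2]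
    rw [inv_le_comm₀ (by positivity) (by norm_num)]
    calc (8 : ℝ)⁻¹ = (1 / 2) ^ 3 := by norm_num
      _ ≤ (1 - s) ^ 3 := by gcongr
  have hGg : ∫⁻ y in D, ‖D.indicator g y‖ₑ ^ 2 = sqL2 D g :=
    setLIntegral_congr_fun hD.measurableSet fun y hy => by
      simp only [indicator_of_mem hy]
  have hfinM : IsFiniteMeasure (volume.restrict D) :=
    ⟨by rw [Measure.restrict_apply_univ]; exact hfin.lt_top⟩
  calc sqL2 D (mollify D η s g)
      ≤ ∫⁻ y in D, ∫⁻ z, ‖D.indicator g ((1 - s) • y + s • z)‖ₑ ^ 2 ∂(mollifierMeasure η) := by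
        refine lintegral_mono fun y => ?_
        rw [mollify_eq_integral hη]
        calc _ ≤ (∫⁻ z, ‖D.indicator g ((1 - s) • y + s • z)‖ₑ ∂(mollifierMeasure η)) ^ 2 := by
              gcongr; exact enorm_integral_le_lintegral_enorm _
          _ ≤ _ := sq_lintegral_le ((hg.indicator hD.measurableSet).comp
              (by fun_prop : Measurable fun z : E3 => (1 - s) • y + s • z)).enorm.aemeasurable
    _ = ∫⁻ z, (∫⁻ y in D, ‖D.indicator g ((1 - s) • y + s • z)‖ₑ ^ 2) ∂(mollifierMeasure η) :=
        lintegral_lintegral_swap (f := fun y z => ‖D.indicator g ((1 - s) • y + s • z)‖ₑ ^ 2)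
          (hG.comp (by fun_prop : Measurable fun q : E3 × E3 =>
          (1 - s) • q.1 + s • q.2)).aemeasurable
    _ ≤ ∫⁻ _, 8 * sqL2 D g ∂(mollifierMeasure η) := by
        refine lintegral_mono_ae ?_
        filter_upwards [ae_mem_mollifierMeasure hη] with z hz
        have e : ∀ y : E3, (1 - s) • y + s • z = z + (1 - s) • (y - z) := fun y => by
          simp only [smul_sub, sub_smul, one_smul]; abel
        simp_rw [e]
        have := lintegral_homothety_le hconv hD.measurableSet hz (s := 1 - s)
          ⟨by linarith [hs.2], by linarith [hs.1]⟩ hG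
        rw [hGg] at this
        exact this.trans (mul_le_mul_left h8 _)
    _ = _ := by simp

theorem mollify_sub {D : Set E3} (hD : IsOpen D) (hfin : volume D ≠ ⊤) {η : E3 → ℝ}
    (hη : IsMollifier D η) {g h : E3 → ℝ} (hg : MemLp g 2 (volume.restrict D))
    (hh : MemLp h 2 (volume.restrict D)) {s : ℝ} (hs : 0 < s) (y : E3) :
    mollify D η s (fun y => g y - h y) y = mollify D η s g y - mollify D η s h y := by
  have hκ := (contDiff_mollifyKernel hη.contDiff s).continuous
  have hκc := hasCompactSupport_mollifyKernel hη.hasCompactSupport hs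
  have e : ∀ f : E3 → ℝ, MemLp f 2 (volume.restrict D) →
      ConvolutionExistsAt (D.indicator f) (mollifyKernel η s) ((1 - s) • y)
        (ContinuousLinearMap.mul ℝ ℝ) volume := fun f hf =>
    hκc.convolutionExists_right _ (locallyIntegrable_indicator hD hfin hf) hκ _
  rw [mollify_eq_convolution hs, mollify_eq_convolution hs, mollify_eq_convolution hs,
    convolution_def, convolution_def, convolution_def, ← integral_sub (e g hg) (e h hh)]
  refine integral_congr_ae (Eventually.of_forall fun t => ?_)
  by_cases ht : t ∈ D
  · simp [indicator_of_mem ht]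
  · simp [indicator_of_notMem ht]

theorem sqL2_eq_eLpNorm_sq {S : Set E3} (f : E3 → ℝ) :
    sqL2 S f = eLpNorm f 2 (volume.restrict S) ^ 2 := by
  rw [eLpNorm_eq_lintegral_rpow_enorm_toReal (by norm_num) (by norm_num), ← ENNReal.rpow_natCast,
    ← ENNReal.rpow_mul]
  simp [sqL2]

/-- Mollifications of a uniformly continuous function converge uniformly. -/
theorem eventually_sqL2_mollify_sub_le {D : Set E3} (hD : IsOpen D) (hconv : Convex ℝ D)
    (hb : Bornology.IsBounded D) {η : E3 → ℝ} (hη : IsMollifier D η) {φ : E3 → ℝ}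
    (hφ : Continuous φ) (hc : HasCompactSupport φ) {e : ℝ≥0∞} (he : e ≠ 0) :
    ∀ᶠ s in 𝓝[>] (0 : ℝ), sqL2 D (fun y => mollify D η s φ y - φ y) ≤ e := by
  have hpm := isProbabilityMeasure_mollifierMeasure hη
  have hfin : volume D ≠ ⊤ := hb.measure_lt_top.ne
  obtain ⟨r, hr0, hr⟩ : ∃ r : ℝ≥0, 0 < r ∧ (r : ℝ≥0∞) ^ 2 * volume D ≤ e := by
    have h1 : Tendsto (fun r : ℝ≥0 => (r : ℝ≥0∞) ^ 2 * volume D) (𝓝[>] 0) (𝓝 0) := by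
      have h2 : Tendsto (fun r : ℝ≥0 => ((r ^ 2 * (volume D).toNNReal : ℝ≥0) : ℝ≥0∞)) (𝓝[>] 0)
          (𝓝 ((0 ^ 2 * (volume D).toNNReal : ℝ≥0) : ℝ≥0∞)) := by
        refine (ENNReal.tendsto_coe.2 ?_)
        exact ((continuous_id.pow 2).mul continuous_const).tendsto' _ _ rfl |>.mono_left
          nhdsWithin_le_nhds
      simpa [ENNReal.coe_toNNReal hfin] using h2
    have h3 := (ENNReal.tendsto_nhds_zero.1 h1 e (pos_iff_ne_zero.2 he)).and self_mem_nhdsWithin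
    obtain ⟨r, hr1, hr2⟩ := h3.exists
    exact ⟨r, hr2, hr1⟩
  obtain ⟨θ, hθ, huc⟩ := Metric.uniformContinuous_iff.1 (hc.uniformContinuous_of_continuous hφ) r
    (by exact_mod_cast hr0)
  obtain ⟨R, hR⟩ := hb.exists_norm_le
  -- Averaging displaces a point by at most `2 s R`, which has to stay below the modulus of
  -- continuity `θ`; the extra `1` keeps the denominator positive.
  have hev : ∀ᶠ s in 𝓝[>] (0 : ℝ), s ∈ Ioo (0 : ℝ) (min 1 (θ / (2 * |R| + 1))) := by
    apply Ioo_mem_nhdsGT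
    positivity
  filter_upwards [hev] with s hs
  have hs1 : s < 1 := hs.2.trans_le (min_le_left _ _)
  have hs2 : s * (2 * |R| + 1) < θ := by
    have := hs.2.trans_le (min_le_right _ _)
    rwa [lt_div_iff₀ (by positivity)] at this
  refine le_trans ?_ hr
  have hbd : ∀ y ∈ D, ‖mollify D η s φ y - φ y‖ₑ ^ 2 ≤ (r : ℝ≥0∞) ^ 2 := by
    intro y hy
    gcongr
    have hae : ∀ᵐ z ∂(mollifierMeasure η),
        ‖D.indicator φ ((1 - s) • y + s • z) - φ y‖ ≤ r := by
      filter_upwards [ae_mem_mollifierMeasure hη] with z hz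
      have hmem : (1 - s) • y + s • z ∈ D :=
        hconv hy hz (by linarith) hs.1.le (by ring)
      rw [indicator_of_mem hmem, ← dist_eq_norm]
      refine (huc ?_).le
      rw [dist_eq_norm, show (1 - s) • y + s • z - y = s • (z - y) by
        simp only [smul_sub, sub_smul, one_smul]; abel, norm_smul, Real.norm_of_nonneg hs.1.le]
      refine lt_of_le_of_lt ?_ hs2
      have h1 := norm_sub_le z y
      have h2 := hR z hz
      have h3 := hR y hy
      have h4 := le_abs_self R
      exact mul_le_mul_of_nonneg_left (by linarith) hs.1.le
    have hint : Integrable (fun z => D.indicator φ ((1 - s) • y + s • z)) (mollifierMeasure η) := by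
      obtain ⟨M, hM⟩ := hc.exists_bound_of_continuous hφ
      refine Integrable.of_bound (C := M) ?_ ?_
      · exact (((hφ.measurable.indicator hD.measurableSet)).comp
          (by fun_prop : Measurable fun z : E3 => (1 - s) • y + s • z)).aestronglyMeasurable
      · refine Eventually.of_forall fun z => ?_
        exact (norm_indicator_le_norm_self _ _).trans (hM _)
    have e1 : mollify D η s φ y - φ y =
        ∫ z, (D.indicator φ ((1 - s) • y + s • z) - φ y) ∂(mollifierMeasure η) := by
      rw [integral_sub hint (integrable_const _), ← mollify_eq_integral hη]
      simp
    rw [e1]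
    have h5 := norm_integral_le_of_norm_le_const hae
    simp only [probReal_univ, mul_one] at h5
    rw [← ofReal_norm]
    refine (ENNReal.ofReal_le_ofReal h5).trans_eq ?_
    simp
  calc sqL2 D (fun y => mollify D η s φ y - φ y) ≤ ∫⁻ _ in D, (r : ℝ≥0∞) ^ 2 :=
        setLIntegral_mono' hD.measurableSet hbd
    _ = _ := by simp

/-- Mollifications converge in `L²`. -/
theorem tendsto_sqL2_mollify {D : Set E3} (hD : IsOpen D) (hconv : Convex ℝ D)
    (hb : Bornology.IsBounded D) {η : E3 → ℝ} (hη : IsMollifier D η) {g : E3 → ℝ}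
    (hgm : Measurable g) (hg : MemLp g 2 (volume.restrict D)) :
    Tendsto (fun s => sqL2 D (fun y => mollify D η s g y - g y)) (𝓝[>] 0) (𝓝 0) := by
  have hfin : volume D ≠ ⊤ := hb.measure_lt_top.ne
  have hfinM : IsFiniteMeasure (volume.restrict D) :=
    ⟨by rw [Measure.restrict_apply_univ]; exact hfin.lt_top⟩
  rw [ENNReal.tendsto_nhds_zero]
  intro τ hτ
  obtain ⟨e, he0, he⟩ : ∃ e : ℝ≥0∞, e ≠ 0 ∧ 24 * e ≤ τ := by
    refine ⟨τ / 24, (ENNReal.div_pos hτ.ne' (by norm_num)).ne', ?_⟩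
    rw [ENNReal.mul_div_cancel (by norm_num) (by norm_num)]
  have hse : e ^ (1 / 2 : ℝ) ≠ 0 := by
    simp [he0]
  obtain ⟨φ, hφc, hφ1, hφ2, hφ3⟩ := hg.exists_hasCompactSupport_eLpNorm_sub_le (by norm_num) hse
  have hφ4 : sqL2 D (fun y => g y - φ y) ≤ e := by
    rw [sqL2_eq_eLpNorm_sq]
    calc _ ≤ (e ^ (1 / 2 : ℝ)) ^ 2 := by gcongr; exact hφ1
      _ = e := by rw [← ENNReal.rpow_natCast, ← ENNReal.rpow_mul]; norm_num
  filter_upwards [eventually_sqL2_mollify_sub_le hD hconv hb hη hφ2 hφc he0,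
    (Ioc_mem_nhdsGT (by norm_num) : Ioc (0 : ℝ) (1 / 2) ∈ 𝓝[>] 0)] with s h1 hs
  refine le_trans ?_ he
  have hmφ : Continuous (mollify D η s φ) := (contDiff_mollify hD hfin hη hφ3 hs.1).continuous
  have hmg : Continuous (mollify D η s g) := (contDiff_mollify hD hfin hη hg hs.1).continuous
  -- Three terms with the compactly supported continuous approximation `φ` in the middle: uniform
  -- boundedness, uniform convergence and density. They add up to `2 (8 e + 2 (e + e)) = 24 e`.
  have e1 : (fun y => mollify D η s g y - g y) = fun y =>
      mollify D η s (fun y => g y - φ y) y + ((mollify D η s φ y - φ y) + -(g y - φ y)) := by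
    funext y
    rw [mollify_sub hD hfin hη hg hφ3 hs.1]
    ring
  have e2 : mollify D η s (fun y => g y - φ y) =
      fun y => mollify D η s g y - mollify D η s φ y :=
    funext fun y => mollify_sub hD hfin hη hg hφ3 hs.1 y
  have e3 : sqL2 D (fun y => -(g y - φ y)) = sqL2 D (fun y => g y - φ y) := by
    simp only [sqL2, enorm_neg]
  rw [e1]
  calc _ ≤ 2 * (sqL2 D (mollify D η s (fun y => g y - φ y)) +
        sqL2 D (fun y => (mollify D η s φ y - φ y) + -(g y - φ y))) :=
        sqL2_add_le D (by rw [e2]; exact (hmg.sub hmφ).aestronglyMeasurable)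
    _ ≤ 2 * (8 * e + 2 * (e + e)) := by
        gcongr
        · exact (sqL2_mollify_le hD hconv hfin hη (hgm.sub hφ2.measurable) hs).trans
            (mul_le_mul_right hφ4 8)
        · refine (sqL2_add_le D (hmφ.sub hφ2).aestronglyMeasurable).trans ?_
          rw [e3]
          gcongr
          exact h1
    _ = 24 * e := by ring

/-- Functions in Sobolev spaces on convex bounded domains are limits of smooth functions. -/
theorem exists_smooth_tendsto {D : Set E3} (hD : IsOpen D) (hconv : Convex ℝ D)
    (hb : Bornology.IsBounded D) (hne : D.Nonempty) {m : ℕ} {g : MultiIndex m → E3 → ℝ}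
    (hgm : ∀ β, Measurable (g β)) (hg : ∀ β, MemLp (g β) 2 (volume.restrict D))
    (hw : ∀ β : MultiIndex m, ∀ φ : E3 → ℝ, ContDiff ℝ ∞ φ → HasCompactSupport φ →
      tsupport φ ⊆ D → ∫ y in D, iterPartialD β.1 φ y * g (MultiIndex.zero m) y =
        (-1 : ℝ) ^ (∑ i, β.1 i) * ∫ y in D, φ y * g β y) :
    ∃ w : ℕ → E3 → ℝ, (∀ n, ContDiff ℝ ∞ (w n)) ∧ ∀ β : MultiIndex m,
      Tendsto (fun n => sqL2 D fun y => iterPartialD β.1 (w n) y - g β y) atTop (𝓝 0) := by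
  obtain ⟨η, hη⟩ := exists_isMollifier hD hne
  have hfin : volume D ≠ ⊤ := hb.measure_lt_top.ne
  -- The shift by two keeps `s n ≤ 1/2`.
  set s : ℕ → ℝ := fun n => 1 / ((n : ℝ) + 2) with hsdef
  have hs : ∀ n, s n ∈ Ioc (0 : ℝ) (1 / 2) := fun n =>
    ⟨by positivity, one_div_le_one_div_of_le (by norm_num) (by linarith [n.cast_nonneg (α := ℝ)])⟩
  have hs0 : Tendsto s atTop (𝓝 0) :=
    tendsto_const_nhds.div_atTop (tendsto_natCast_atTop_atTop.atTop_add tendsto_const_nhds)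
  have hs1 : Tendsto s atTop (𝓝[>] 0) :=
    tendsto_nhdsWithin_iff.2 ⟨hs0, Eventually.of_forall fun n => (hs n).1⟩
  refine ⟨fun n => mollify D η (s n) (g (MultiIndex.zero m)),
    fun n => contDiff_mollify hD hfin hη (hg _) (hs n).1, fun β => ?_⟩
  set l := ∑ i, β.1 i
  have hfing : sqL2 D (g β) ≠ ⊤ := by
    rw [sqL2_eq_eLpNorm_sq]
    exact ENNReal.pow_ne_top (hg β).eLpNorm_ne_top
  -- The contraction multiplies `∂^β` by `(1 - s)^l`; this factor tends to one and contributes a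
  -- separate error term.
  have hle : ∀ n, sqL2 D (fun y => iterPartialD β.1 (mollify D η (s n) (g (MultiIndex.zero m))) y -
      g β y) ≤ 2 * (sqL2 D (fun y => mollify D η (s n) (g β) y - g β y) +
        ‖(1 - s n) ^ l - 1‖ₑ ^ 2 * sqL2 D (g β)) := by
    intro n
    have hmc := (contDiff_mollify hD hfin hη (hg β) (hs n).1).continuous
    have hmeas : AEStronglyMeasurable (fun y => (1 - s n) ^ l *
        (mollify D η (s n) (g β) y - g β y)) (volume.restrict D) :=
      ((hmc.measurable.sub (hgm β)).const_mul _).aestronglyMeasurable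
    calc _ = sqL2 D (fun y => (1 - s n) ^ l * (mollify D η (s n) (g β) y - g β y) +
          ((1 - s n) ^ l - 1) * g β y) := by
          refine setLIntegral_congr_fun hD.measurableSet fun y hy => ?_
          have hsn := hs n
          simp only
          rw [iterPartialD_mollify hD hconv hfin hη (hg _) (hw β)
            ⟨hsn.1, by linarith [hsn.2]⟩ hy]
          congr 2
          ring
      _ ≤ _ := sqL2_add_le D hmeas
      _ ≤ _ := by
          rw [sqL2_const_mul, sqL2_const_mul]
          gcongr
          refine mul_le_of_le_one_left' (pow_le_one' ?_ 2)
          rw [← ofReal_norm, ENNReal.ofReal_le_one, norm_pow]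
          have hsn := hs n
          refine pow_le_one₀ (norm_nonneg _) ?_
          rw [Real.norm_of_nonneg (by linarith [hsn.2])]
          linarith [hsn.1]
  have hlim1 := (tendsto_sqL2_mollify hD hconv hb hη (hgm β) (hg β)).comp hs1
  have hlim2 : Tendsto (fun n => ‖(1 - s n) ^ l - 1‖ₑ ^ 2) atTop (𝓝 0) := by
    have h1 : Continuous fun t : ℝ => ‖(1 - t) ^ l - 1‖ₑ ^ 2 := by
      have : Continuous fun t : ℝ => (1 - t) ^ l - 1 := by fun_prop
      exact (ENNReal.continuous_pow 2).comp this.enorm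
    have h2 := (h1.tendsto 0).comp hs0
    simpa [Function.comp_def] using h2
  have hlim := ENNReal.Tendsto.const_mul (a := 2)
    (hlim1.add (ENNReal.Tendsto.mul_const (b := sqL2 D (g β)) hlim2 (Or.inr hfing)))
    (Or.inr (by norm_num))
  simp only [zero_mul, add_zero, mul_zero] at hlim
  exact tendsto_of_tendsto_of_tendsto_of_le_of_le tendsto_const_nhds hlim (fun _ => zero_le) hle

end Mollification

/-! ### Integration by parts on boxes -/

/-- The point with `i`-th coordinate `t` and remaining coordinates `z`. -/
def slicePoint (i : Fin 3) (t : ℝ) (z : Fin 2 → ℝ) : E3 := WithLp.toLp 2 (i.insertNth t z)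

@[simp]
theorem slicePoint_same (i : Fin 3) (t : ℝ) (z : Fin 2 → ℝ) : slicePoint i t z i = t := by
  simp [slicePoint]

@[simp]
theorem slicePoint_succAbove (i : Fin 3) (t : ℝ) (z : Fin 2 → ℝ) (j : Fin 2) :
    slicePoint i t z (i.succAbove j) = z j := by
  simp [slicePoint]

theorem slicePoint_eq_add (i : Fin 3) (t : ℝ) (z : Fin 2 → ℝ) :
    slicePoint i t z = slicePoint i 0 z + t • EuclideanSpace.single i (1 : ℝ) := by
  ext j
  rcases Fin.eq_self_or_eq_succAbove i j with rfl | ⟨j, rfl⟩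
  · simp
  · simp

theorem continuous_slicePoint (i : Fin 3) :
    Continuous fun q : ℝ × (Fin 2 → ℝ) => slicePoint i q.1 q.2 := by
  refine (PiLp.continuous_toLp 2 _).comp ?_
  exact Continuous.finInsertNth (A := fun _ : Fin 3 => ℝ) i continuous_fst continuous_snd

/-- The cross section of an open box orthogonal to the `i`-th direction. -/
def crossSection (lo hi : Fin 3 → ℝ) (i : Fin 3) : Set (Fin 2 → ℝ) :=
  univ.pi fun j => Ioo (lo (i.succAbove j)) (hi (i.succAbove j))

theorem slicePoint_mem_obox {lo hi : Fin 3 → ℝ} {i : Fin 3} {t : ℝ} {z : Fin 2 → ℝ} :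
    slicePoint i t z ∈ obox lo hi ↔ t ∈ Ioo (lo i) (hi i) ∧ z ∈ crossSection lo hi i := by
  simp only [obox, mem_ofPred_eq, crossSection, mem_univ_pi]
  rw [Fin.forall_iff_succAbove i]
  simp

theorem measurePreserving_slicePoint (i : Fin 3) :
    MeasurePreserving (fun q : ℝ × (Fin 2 → ℝ) => slicePoint i q.1 q.2) :=
  (PiLp.volume_preserving_toLp (Fin 3)).comp
    (volume_preserving_piFinSuccAbove (fun _ : Fin 3 => ℝ) i).symm

theorem measurableEmbedding_slicePoint (i : Fin 3) :
    MeasurableEmbedding (fun q : ℝ × (Fin 2 → ℝ) => slicePoint i q.1 q.2) :=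
  (MeasurableEquiv.toLp 2 (Fin 3 → ℝ)).measurableEmbedding.comp
    (MeasurableEquiv.piFinSuccAbove (fun _ : Fin 3 => ℝ) i).symm.measurableEmbedding

theorem measurePreserving_slicePoint_obox (lo hi : Fin 3 → ℝ) (i : Fin 3) :
    MeasurePreserving (fun q : ℝ × (Fin 2 → ℝ) => slicePoint i q.1 q.2)
      ((volume.restrict (Ioo (lo i) (hi i))).prod (volume.restrict (crossSection lo hi i)))
      (volume.restrict (obox lo hi)) := by
  have h := (measurePreserving_slicePoint i).restrict_preimage_emb
    (measurableEmbedding_slicePoint i) (obox lo hi)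
  have hset : (fun q : ℝ × (Fin 2 → ℝ) => slicePoint i q.1 q.2) ⁻¹' obox lo hi =
      Ioo (lo i) (hi i) ×ˢ crossSection lo hi i := by
    ext q
    rw [mem_preimage, slicePoint_mem_obox]
    rfl
  rwa [hset, Measure.volume_eq_prod, ← Measure.prod_restrict] at h

theorem integral_obox {lo hi : Fin 3 → ℝ} (i : Fin 3) {h : E3 → ℝ}
    (hh : IntegrableOn h (obox lo hi)) : ∫ y in obox lo hi, h y =
      ∫ z in crossSection lo hi i, ∫ t in Ioo (lo i) (hi i), h (slicePoint i t z) := by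
  have hmp := measurePreserving_slicePoint_obox lo hi i
  rw [← hmp.integral_comp (measurableEmbedding_slicePoint i), integral_prod_symm]
  exact (hmp.integrable_comp_emb (measurableEmbedding_slicePoint i)).2 hh

theorem ae_integrableOn_slice {lo hi : Fin 3 → ℝ} (i : Fin 3) {h : E3 → ℝ}
    (hh : IntegrableOn h (obox lo hi)) : ∀ᵐ z ∂(volume.restrict (crossSection lo hi i)),
      IntegrableOn (fun t => h (slicePoint i t z)) (Ioo (lo i) (hi i)) :=
  (((measurePreserving_slicePoint_obox lo hi i).integrable_comp_emb
    (measurableEmbedding_slicePoint i)).2 hh).prod_left_ae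

theorem measurableSet_crossSection (lo hi : Fin 3 → ℝ) (i : Fin 3) :
    MeasurableSet (crossSection lo hi i) :=
  MeasurableSet.univ_pi fun _ => measurableSet_Ioo

/-- The divergence theorem on a box for a function that is piecewise differentiable along the lines
in the `i`-th direction. -/
theorem integral_obox_eq_boundary {lo hi : Fin 3 → ℝ} (h : ∀ i, lo i < hi i) (i : Fin 3)
    {f f' : E3 → ℝ} {s : Set ℝ} (hs : s.Countable)
    (hc : ∀ z ∈ crossSection lo hi i,
      ContinuousOn (fun t => f (slicePoint i t z)) (Icc (lo i) (hi i)))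
    (hd : ∀ z ∈ crossSection lo hi i, ∀ t ∈ Ioo (lo i) (hi i) \ s,
      HasDerivAt (fun t => f (slicePoint i t z)) (f' (slicePoint i t z)) t)
    (hint : IntegrableOn f' (obox lo hi)) :
    ∫ y in obox lo hi, f' y = ∫ z in crossSection lo hi i,
      (f (slicePoint i (hi i) z) - f (slicePoint i (lo i) z)) := by
  rw [integral_obox i hint]
  refine integral_congr_ae ?_
  filter_upwards [ae_integrableOn_slice i hint,
    ae_restrict_mem (measurableSet_crossSection lo hi i)] with z hz hzB
  rw [← integral_Ioc_eq_integral_Ioo, ← intervalIntegral.integral_of_le (h i).le]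
  -- The fundamental theorem on each line tolerates a countable exceptional set, which will be the
  -- mesh planes crossed by the line.
  refine integral_eq_of_hasDerivAt_off_countable_of_le _ _ (h i).le hs (hc z hzB) (hd z hzB) ?_
  rw [intervalIntegrable_iff_integrableOn_Ioo_of_le (h i).le]
  exact hz

theorem hasDerivAt_slicePoint {f : E3 → ℝ} (hf : Differentiable ℝ f) (i : Fin 3) (z : Fin 2 → ℝ)
    (t : ℝ) : HasDerivAt (fun t => f (slicePoint i t z)) (partialD i f (slicePoint i t z)) t := by
  have h := hasDerivAt_line hf (slicePoint i 0 z) (EuclideanSpace.single i (1 : ℝ)) t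
  simp only [← slicePoint_eq_add] at h
  refine h.congr_deriv ?_
  rw [Finset.sum_eq_single i]
  · simp
  · intro j _ hj
    simp [hj]
  · simp

theorem integrableOn_obox {lo hi : Fin 3 → ℝ} {f : E3 → ℝ} (hf : Continuous f) :
    IntegrableOn f (obox lo hi) :=
  (hf.continuousOn.integrableOn_compact (isCompact_cbox lo hi)).mono_set (obox_subset_cbox lo hi)

theorem integral_partialD_obox {lo hi : Fin 3 → ℝ} (h : ∀ i, lo i < hi i) (i : Fin 3) {f : E3 → ℝ}
    (hf : ContDiff ℝ ∞ f) : ∫ y in obox lo hi, partialD i f y = ∫ z in crossSection lo hi i,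
      (f (slicePoint i (hi i) z) - f (slicePoint i (lo i) z)) :=
  integral_obox_eq_boundary h i countable_empty
    (fun z _ => (hf.continuous.comp ((continuous_slicePoint i).comp
      (continuous_id.prodMk continuous_const))).continuousOn)
    (fun z _ t _ => hasDerivAt_slicePoint (hf.differentiable (by simp)) i z t)
    (integrableOn_obox (continuous_partialD hf i))

/-! ### Periodicity on the faces -/

/-- The squared periodic distance. -/
def sinDist {ι : Type*} [Fintype ι] (δ : ℝ) (p z : ι → ℝ) : ℝ :=
  ∑ j, Real.sin (Real.pi * (z j - p j) / δ) ^ 2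

theorem continuous_sinDist {ι : Type*} [Fintype ι] (δ : ℝ) (p : ι → ℝ) :
    Continuous (sinDist δ p) := by
  unfold sinDist
  fun_prop

/-- The point `p` is interior and `z` in the closed cell, so each argument of the sine lies strictly
between `-π` and `π`, where zero is the only root. -/
theorem eq_of_sinDist_eq_zero {ι : Type*} [Fintype ι] {δ : ℝ} (hδ : 0 < δ) {a p z : ι → ℝ}
    (hp : ∀ j, p j ∈ Ioo (a j) (a j + δ)) (hz : ∀ j, z j ∈ Icc (a j) (a j + δ))
    (h : sinDist δ p z = 0) : z = p := by
  funext j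
  have h1 := (Finset.sum_eq_zero_iff_of_nonneg fun j _ => sq_nonneg _).1 h j (Finset.mem_univ j)
  rw [sq_eq_zero_iff] at h1
  have hpj := hp j
  have hzj := hz j
  have hpi := Real.pi_pos
  rw [Real.sin_eq_zero_iff_of_lt_of_lt] at h1
  · have h2 : Real.pi * (z j - p j) = 0 := by
      rcases div_eq_zero_iff.1 h1 with h3 | h3
      · exact h3
      · exact absurd h3 hδ.ne'
    rcases mul_eq_zero.1 h2 with h3 | h3
    · exact absurd h3 hpi.ne'
    · linarith
  · rw [lt_div_iff₀ hδ]
    nlinarith [hpj.2, hzj.1]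
  · rw [div_lt_iff₀ hδ]
    nlinarith [hpj.1, hzj.2]

/-- The fundamental lemma of the calculus of variations with bumps that are smooth and periodic:
functions of `sinDist` concentrated near `p`. The closed cell is reached by continuity. -/
theorem eqOn_zero_of_forall_integral_sinDist {ι : Type*} [Fintype ι] {δ : ℝ} (hδ : 0 < δ)
    {a : ι → ℝ} {w : (ι → ℝ) → ℝ} (hw : Continuous w)
    (H : ∀ (p : ι → ℝ) (η : ℝ), ∫ z in univ.pi fun j => Ioo (a j) (a j + δ),
      Real.smoothTransition (η - sinDist δ p z) * w z = 0) :
    ∀ z : ι → ℝ, (∀ j, z j ∈ Icc (a j) (a j + δ)) → w z = 0 := by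
  set B : Set (ι → ℝ) := univ.pi fun j => Ioo (a j) (a j + δ) with hB
  have hBo : IsOpen B := isOpen_set_pi finite_univ fun _ _ => isOpen_Ioo
  have hcomp : IsCompact (univ.pi fun j => Icc (a j) (a j + δ)) :=
    isCompact_univ_pi fun _ => isCompact_Icc
  have hB0 : ∀ p ∈ B, w p = 0 := by
    intro p hp
    by_contra hne
    have hp' : ∀ j, p j ∈ Ioo (a j) (a j + δ) := fun j => hp j (mem_univ j)
    have hO : IsOpen {z | 0 < w p * w z} := isOpen_lt continuous_const (continuous_const.mul hw)
    have hK : IsCompact ((univ.pi fun j => Icc (a j) (a j + δ)) \ {z | 0 < w p * w z}) :=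
      hcomp.diff hO
    -- Take `η` below the periodic distance from `p` to the compact set where `w` does not have the
    -- sign of `w p`. The bump vanishes there, so the integrand is nonnegative.
    obtain ⟨η, hη, hmin⟩ : ∃ η > 0, ∀ z ∈ (univ.pi fun j => Icc (a j) (a j + δ)) \
        {z | 0 < w p * w z}, η ≤ sinDist δ p z := by
      rcases ((univ.pi fun j => Icc (a j) (a j + δ)) \ {z | 0 < w p * w z}).eq_empty_or_nonempty
        with he | hne'
      · exact ⟨1, one_pos, fun z hz => by rw [he] at hz; exact hz.elim⟩
      · obtain ⟨z₀, hz₀, hz₀'⟩ := hK.exists_isMinOn hne' (continuous_sinDist δ p).continuousOn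
        refine ⟨sinDist δ p z₀, ?_, fun z hz => hz₀' hz⟩
        refine lt_of_le_of_ne (Finset.sum_nonneg fun j _ => sq_nonneg _) fun h0 => ?_
        have := eq_of_sinDist_eq_zero hδ hp' (fun j => hz₀.1 j (mem_univ j)) h0.symm
        refine hz₀.2 ?_
        rw [this]
        exact mul_self_pos.2 hne
    set f : (ι → ℝ) → ℝ := fun z => Real.smoothTransition (η - sinDist δ p z) * (w p * w z)
    have hf : Continuous f := (Real.smoothTransition.continuous.comp
      (continuous_const.sub (continuous_sinDist δ p))).mul (continuous_const.mul hw)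
    have hf0 : ∀ z ∈ B, 0 ≤ f z := by
      intro z hz
      by_cases hzO : 0 < w p * w z
      · exact mul_nonneg (Real.smoothTransition.nonneg _) hzO.le
      · have := hmin z ⟨fun j _ => Ioo_subset_Icc_self (hz j (mem_univ j)), hzO⟩
        simp only [f]
        rw [Real.smoothTransition.zero_of_nonpos (by linarith), zero_mul]
    have hint : IntegrableOn f B := (hf.continuousOn.integrableOn_compact hcomp).mono_set
      (pi_mono fun _ _ => Ioo_subset_Icc_self)
    have hzero : ∫ z in B, f z = 0 := by
      have := H p η
      calc ∫ z in B, f z = ∫ z in B, w p * (Real.smoothTransition (η - sinDist δ p z) * w z) := by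
            congr 1
            funext z
            simp only [f]
            ring
        _ = 0 := by rw [integral_const_mul, this, mul_zero]
    have hae := (setIntegral_eq_zero_iff_of_nonneg_ae
      (ae_restrict_of_forall_mem hBo.measurableSet hf0) hint).1 hzero
    have hfp := Measure.eqOn_open_of_ae_eq hae hBo hf.continuousOn continuousOn_const hp
    have hpos : 0 < f p := by
      refine mul_pos (Real.smoothTransition.pos_of_pos ?_) (mul_self_pos.2 hne)
      have : sinDist δ p p = 0 := by simp [sinDist]
      rw [this, sub_zero]
      exact hη
    exact hpos.ne' hfp
  intro z hz
  have hcl : closure B ⊆ {z | w z = 0} :=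
    closure_minimal hB0 (isClosed_eq hw continuous_const)
  refine hcl ?_
  rw [hB, closure_pi_set]
  intro j _
  simp only
  rw [closure_Ioo (by linarith : a j ≠ a j + δ)]
  exact hz j

/-- The bump of the cross section is used as a function on space that does not depend on the `i`-th
coordinate. -/
theorem contDiff_sinDist_slice (δ : ℝ) (i : Fin 3) (p : Fin 2 → ℝ) (η : ℝ) :
    ContDiff ℝ ∞ fun y : E3 =>
      Real.smoothTransition (η - sinDist δ p fun j => y (i.succAbove j)) := by
  refine Real.smoothTransition.contDiff.comp (contDiff_const.sub ?_)
  unfold sinDist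
  refine ContDiff.sum fun j _ => ?_
  have h : ContDiff ℝ ∞ fun y : E3 => y (i.succAbove j) :=
    contDiff_piLp_apply (𝕜 := ℝ) (p := 2) (i := i.succAbove j)
  exact (((contDiff_const.mul (h.sub contDiff_const)).div_const _).sin).pow 2

theorem sinDist_slice_periodic {δ : ℝ} (hδ : 0 < δ) (i : Fin 3) (p : Fin 2 → ℝ) (y : E3)
    (l : Fin 3) : (sinDist δ p fun j => (y + EuclideanSpace.single l δ) (i.succAbove j)) =
      sinDist δ p fun j => y (i.succAbove j) := by
  refine Finset.sum_congr rfl fun j _ => ?_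
  simp only [PiLp.add_apply, EuclideanSpace.single, PiLp.single_apply]
  split_ifs with h
  · rw [show Real.pi * (y (i.succAbove j) + δ - p j) / δ =
      Real.pi * (y (i.succAbove j) - p j) / δ + Real.pi by field_simp; ring, Real.sin_add_pi,
      neg_sq]
  · rw [add_zero]

theorem lintegral_enorm_sq_le_sqL2 {S : Set E3} {f : E3 → ℝ}
    (hf : AEStronglyMeasurable f (volume.restrict S)) :
    (∫⁻ y in S, ‖f y‖ₑ) ^ 2 ≤ volume S * sqL2 S f := by
  have h := ENNReal.lintegral_mul_le_Lp_mul_Lq (volume.restrict S) Real.HolderConjugate.two_two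
    hf.enorm (aemeasurable_const (b := (1 : ℝ≥0∞)))
  simp only [Pi.mul_apply, mul_one, ENNReal.one_rpow, lintegral_one,
    Measure.restrict_apply_univ] at h
  calc (∫⁻ y in S, ‖f y‖ₑ) ^ 2 ≤ ((∫⁻ y in S, ‖f y‖ₑ ^ (2 : ℝ)) ^ (1 / 2 : ℝ) *
        volume S ^ (1 / 2 : ℝ)) ^ 2 := by gcongr
    _ = volume S * sqL2 S f := by
      rw [mul_pow, ← ENNReal.rpow_natCast, ← ENNReal.rpow_natCast, ← ENNReal.rpow_mul,
        ← ENNReal.rpow_mul, mul_comm]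
      norm_num [sqL2]

theorem tendsto_integral_mul_of_sqL2 {x : E3} {δ : ℝ} {ψ g : E3 → ℝ} {w : ℕ → E3 → ℝ}
    (hψ : Continuous ψ) (hw : ∀ n, Continuous (w n))
    (hg : MemLp g 2 (volume.restrict (samplingDomain x δ)))
    (h : Tendsto (fun n => sqL2 (samplingDomain x δ) fun y => w n y - g y) atTop (𝓝 0)) :
    Tendsto (fun n => ∫ y in samplingDomain x δ, ψ y * w n y) atTop
      (𝓝 (∫ y in samplingDomain x δ, ψ y * g y)) := by
  obtain ⟨M, hM⟩ := (isBounded_samplingDomain x δ).isCompact_closure.exists_bound_of_continuousOn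
    hψ.continuousOn
  have hfin : volume (samplingDomain x δ) ≠ ⊤ := (isBounded_samplingDomain x δ).measure_lt_top.ne
  have hψ2 : MemLp ψ 2 (volume.restrict (samplingDomain x δ)) := memLp_of_continuous hψ 2
  refine tendsto_integral_of_L1 _ (hg.integrable_mul hψ2 |>.congr (Eventually.of_forall fun y =>
    mul_comm _ _)).aestronglyMeasurable (Eventually.of_forall fun n => (memLp_of_continuous (hψ.mul (hw n)) 1).integrable
      le_rfl) ?_
  have hL1 : Tendsto (fun n => ∫⁻ y in samplingDomain x δ, ‖w n y - g y‖ₑ) atTop (𝓝 0) := by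
    have h2 : Tendsto (fun n => (volume (samplingDomain x δ) *
        sqL2 (samplingDomain x δ) fun y => w n y - g y) ^ (1 / 2 : ℝ)) atTop (𝓝 0) := by
      have h3 := ENNReal.Tendsto.const_mul (a := volume (samplingDomain x δ)) h (Or.inr hfin)
      rw [mul_zero] at h3
      have h4 := (ENNReal.continuous_rpow_const (y := (1 / 2 : ℝ))).tendsto 0 |>.comp h3
      simpa [Function.comp_def] using h4
    refine tendsto_of_tendsto_of_tendsto_of_le_of_le tendsto_const_nhds h2 (fun _ => zero_le)
      fun n => ?_
    have h5 := lintegral_enorm_sq_le_sqL2 (S := samplingDomain x δ) (f := fun y => w n y - g y)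
      ((hw n).aestronglyMeasurable.sub hg.1)
    calc _ = ((∫⁻ y in samplingDomain x δ, ‖w n y - g y‖ₑ) ^ 2) ^ (1 / 2 : ℝ) := by
          rw [← ENNReal.rpow_natCast, ← ENNReal.rpow_mul]; norm_num
      _ ≤ _ := by gcongr
  have h6 := ENNReal.Tendsto.const_mul (a := ENNReal.ofReal M) hL1
    (Or.inr ENNReal.ofReal_ne_top)
  rw [mul_zero] at h6
  refine tendsto_of_tendsto_of_tendsto_of_le_of_le tendsto_const_nhds h6 (fun _ => zero_le)
    fun n => ?_
  rw [← lintegral_const_mul' _ _ ENNReal.ofReal_ne_top]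
  refine setLIntegral_mono' (isOpen_samplingDomain x δ).measurableSet fun y hy => ?_
  rw [← mul_sub, enorm_mul]
  gcongr
  rw [← ofReal_norm]
  exact ENNReal.ofReal_le_ofReal (hM y (subset_closure hy))

/-! ### The continuous representative -/

theorem cbox_ae_eq_obox (lo hi : Fin 3 → ℝ) : (cbox lo hi : Set E3) =ᵐ[volume] obox lo hi := by
  have h1 := (PiLp.volume_preserving_ofLp (Fin 3)).quasiMeasurePreserving.preimage_ae_eq
    (Measure.univ_pi_Ioo_ae_eq_Icc (μ := fun _ : Fin 3 => (volume : Measure ℝ)) (f := lo) (g := hi))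
  refine EventuallyEq.symm ?_
  have e1 : (WithLp.ofLp ⁻¹' univ.pi fun i => Ioo (lo i) (hi i) : Set E3) = obox lo hi := by
    ext y
    simp [obox]
  have e2 : (WithLp.ofLp ⁻¹' Icc lo hi : Set E3) = cbox lo hi := by
    ext y
    simp [cbox, Pi.le_def, forall_and]
  rwa [e1, e2] at h1

theorem sqL2_cbox (lo hi : Fin 3 → ℝ) (f : E3 → ℝ) : sqL2 (cbox lo hi) f = sqL2 (obox lo hi) f :=
  setLIntegral_congr (cbox_ae_eq_obox lo hi)

theorem sqL2_mono_set {S S' : Set E3} (h : S ⊆ S') (f : E3 → ℝ) : sqL2 S f ≤ sqL2 S' f :=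
  lintegral_mono_set h

/-- The nearest point of a box. -/
def clampBox (lo hi : Fin 3 → ℝ) (y : E3) : E3 := WithLp.toLp 2 fun i => max (lo i) (min (hi i) (y i))

theorem continuous_clampBox (lo hi : Fin 3 → ℝ) : Continuous (clampBox lo hi) := by
  refine (PiLp.continuous_toLp 2 _).comp (continuous_pi fun i => ?_)
  exact continuous_const.max (continuous_const.min (by fun_prop))

theorem clampBox_mem {lo hi : Fin 3 → ℝ} (h : ∀ i, lo i < hi i) (y : E3) :
    clampBox lo hi y ∈ cbox lo hi :=
  fun i => ⟨le_max_left _ _, max_le (h i).le (min_le_left _ _)⟩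

theorem clampBox_of_mem {lo hi : Fin 3 → ℝ} {y : E3} (hy : y ∈ cbox lo hi) :
    clampBox lo hi y = y := by
  ext i
  simp [clampBox, (hy i).1, (hy i).2]

theorem clampBox_slicePoint (lo hi : Fin 3 → ℝ) (i : Fin 3) (t : ℝ) (z : Fin 2 → ℝ) :
    clampBox lo hi (slicePoint i t z) = slicePoint i (max (lo i) (min (hi i) t))
      fun j => max (lo (i.succAbove j)) (min (hi (i.succAbove j)) (z j)) := by
  ext j
  rcases Fin.eq_self_or_eq_succAbove i j with rfl | ⟨j, rfl⟩
  · simp [clampBox]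
  · simp [clampBox]

theorem ENNReal.le_sum_univ {ι : Type*} [Fintype ι] (F : ι → ℝ≥0∞) (a : ι) : F a ≤ ∑ b, F b :=
  Finset.single_le_sum (fun _ _ => zero_le) (Finset.mem_univ a)

/-- Smooth functions that converge in `H²` of a box converge uniformly on the closed box. -/
theorem exists_tendstoUniformlyOn_box {lo hi : Fin 3 → ℝ} (h : ∀ i, lo i < hi i) {m : ℕ}
    (hm : 2 ≤ m) {g : MultiIndex m → E3 → ℝ} (hgm : ∀ β, Measurable (g β)) {w : ℕ → E3 → ℝ}
    (hw : ∀ n, ContDiff ℝ ∞ (w n)) (hlim : ∀ β : MultiIndex m,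
      Tendsto (fun n => sqL2 (obox lo hi) fun y => iterPartialD β.1 (w n) y - g β y)
        atTop (𝓝 0)) :
    ∃ U : E3 → ℝ, Continuous U ∧ (∀ y, U (clampBox lo hi y) = U y) ∧
      TendstoUniformlyOn w U atTop (cbox lo hi) := by
  obtain ⟨C, hC⟩ := exists_enorm_sq_le_box h
  obtain ⟨T, hT0, hTle⟩ : ∃ T : ℕ → ℝ≥0∞, Tendsto T atTop (𝓝 0) ∧ ∀ n, ∀ β : MultiIndex m,
      (sqL2 (obox lo hi) fun y => iterPartialD β.1 (w n) y - g β y) ≤ T n := by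
    have hgen : ∀ F : ℕ → MultiIndex m → ℝ≥0∞, (∀ β, Tendsto (fun n => F n β) atTop (𝓝 0)) →
        ∃ T : ℕ → ℝ≥0∞, Tendsto T atTop (𝓝 0) ∧ ∀ n β, F n β ≤ T n := fun F hF =>
      ⟨fun n => ∑ β, F n β, by simpa using tendsto_finsetSum Finset.univ fun β _ => hF β,
        fun n β => ENNReal.le_sum_univ (F n) β⟩
    exact hgen _ hlim
  -- The `H²` embedding applied to differences turns convergence in `H²` into a uniform Cauchy
  -- property.
  have hle : ∀ n l, ∀ p ∈ cbox lo hi, ‖w n p - w l p‖ₑ ^ 2 ≤ C * (2 * (T n + T l)) := by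
    intro n l p hp
    refine hC (fun y => w n y - w l y) ((hw n).sub (hw l)) _ (fun β hβ => ?_) p hp
    rw [sqL2_cbox, iterPartialD_sub (hw n) (hw l)]
    have e : (fun y => iterPartialD β (w n) y - iterPartialD β (w l) y) = fun y =>
        (iterPartialD β (w n) y - g ⟨β, hβ.trans hm⟩ y) +
          -(iterPartialD β (w l) y - g ⟨β, hβ.trans hm⟩ y) := by
      funext y
      ring
    rw [e]
    refine (sqL2_add_le _ ?_).trans ?_
    · exact ((contDiff_iterPartialD (hw n) β).continuous.measurable.sub
        (hgm _)).aestronglyMeasurable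
    · gcongr
      · exact hTle n ⟨β, hβ.trans hm⟩
      · refine le_trans (le_of_eq ?_) (hTle l ⟨β, hβ.trans hm⟩)
        simp only [sqL2, enorm_neg]
  have hcauchy : UniformCauchySeqOn w atTop (cbox lo hi) := by
    rw [Metric.uniformCauchySeqOn_iff]
    intro ε hε
    have hE : 0 < ENNReal.ofReal ε ^ 2 / 2 := by
      refine ENNReal.div_pos (pow_ne_zero _ ?_) (by norm_num)
      rw [ne_eq, ENNReal.ofReal_eq_zero, not_le]
      exact hε
    have h1 := ENNReal.Tendsto.const_mul (a := (C : ℝ≥0∞) * 2) hT0 (Or.inr (by finiteness))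
    rw [mul_zero] at h1
    obtain ⟨n₀, hn₀⟩ := eventually_atTop.1 (h1.eventually (gt_mem_nhds hE))
    refine ⟨n₀, fun n hn l hl p hp => ?_⟩
    have h2 : ‖w n p - w l p‖ₑ ^ 2 < ENNReal.ofReal ε ^ 2 := by
      refine (hle n l p hp).trans_lt ?_
      rw [← mul_assoc, mul_add]
      calc _ < ENNReal.ofReal ε ^ 2 / 2 + ENNReal.ofReal ε ^ 2 / 2 :=
            ENNReal.add_lt_add (hn₀ n hn) (hn₀ l hl)
        _ = _ := ENNReal.add_halves _
    have h3 : ‖w n p - w l p‖ₑ < ENNReal.ofReal ε := by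
      by_contra hcon
      exact (not_le.2 h2) (by gcongr; exact not_lt.1 hcon)
    rwa [← ofReal_norm, ENNReal.ofReal_lt_ofReal_iff hε, ← dist_eq_norm] at h3
  have hpt : ∀ p ∈ cbox lo hi, ∃ a, Tendsto (fun n => w n p) atTop (𝓝 a) := fun p hp =>
    cauchySeq_tendsto_of_complete (hcauchy.cauchy_map hp)
  choose! U₀ hU₀ using hpt
  have hunif : TendstoUniformlyOn w U₀ atTop (cbox lo hi) :=
    hcauchy.tendstoUniformlyOn_of_tendsto fun p hp => hU₀ p hp
  have hcont : ContinuousOn U₀ (cbox lo hi) := hunif.continuousOn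
    (Eventually.of_forall fun n => (hw n).continuous.continuousOn).frequently
  -- Composing with the nearest-point map extends the limit continuously to the whole space.
  refine ⟨fun y => U₀ (clampBox lo hi y),
    hcont.comp_continuous (continuous_clampBox lo hi) (clampBox_mem h), fun y => ?_, ?_⟩
  · simp only [clampBox_of_mem (clampBox_mem h y)]
  · exact hunif.congr_right fun y hy => by simp only [clampBox_of_mem hy]

theorem slicePoint_add (i : Fin 3) (t s : ℝ) (z : Fin 2 → ℝ) :
    slicePoint i (t + s) z = slicePoint i t z + EuclideanSpace.single i s := by
  ext j
  rcases Fin.eq_self_or_eq_succAbove i j with rfl | ⟨j, rfl⟩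
  · simp
  · simp

/-- The uniform limit of smooth approximations of a periodic `H¹` function takes equal values on
opposite faces. -/
theorem eq_on_opposite_faces {x : E3} {δ : ℝ} (hδ : 0 < δ) (i : Fin 3) {g₀ g₁ : E3 → ℝ}
    (hg₀ : MemLp g₀ 2 (volume.restrict (samplingDomain x δ)))
    (hg₁ : MemLp g₁ 2 (volume.restrict (samplingDomain x δ)))
    (hper : ∀ φ : E3 → ℝ, ContDiff ℝ ∞ φ →
      (∀ (y : E3) (j : Fin 3), φ (y + EuclideanSpace.single j δ) = φ y) →
      ∫ y in samplingDomain x δ, partialD i φ y * g₀ y =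
        -∫ y in samplingDomain x δ, φ y * g₁ y)
    {w : ℕ → E3 → ℝ} (hw : ∀ n, ContDiff ℝ ∞ (w n))
    (h₀ : Tendsto (fun n => sqL2 (samplingDomain x δ) fun y => w n y - g₀ y) atTop (𝓝 0))
    (h₁ : Tendsto (fun n => sqL2 (samplingDomain x δ) fun y => partialD i (w n) y - g₁ y)
      atTop (𝓝 0)) {U : E3 → ℝ} (hU : Continuous U)
    (hclamp : ∀ y, U (clampBox (fun i => x i) (fun i => x i + δ) y) = U y)
    (hunif : TendstoUniformlyOn w U atTop (cbox (fun i => x i) fun i => x i + δ))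
    (z : Fin 2 → ℝ) : U (slicePoint i (x i + δ) z) = U (slicePoint i (x i) z) := by
  have hlt : ∀ i, x i < x i + δ := fun i => by linarith
  set B := crossSection (fun i => x i) (fun i => x i + δ) i with hB
  have hBm : MeasurableSet B := measurableSet_crossSection _ _ i
  have hcs : ∀ t : ℝ, Continuous fun z => slicePoint i t z := fun t =>
    (continuous_slicePoint i).comp (continuous_const.prodMk continuous_id)
  have hmem : ∀ z ∈ B, ∀ t ∈ Icc (x i) (x i + δ),
      slicePoint i t z ∈ cbox (fun i => x i) fun i => x i + δ := by
    intro z hz t ht j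
    rcases Fin.eq_self_or_eq_succAbove i j with rfl | ⟨j, rfl⟩
    · simpa using ht
    · rw [slicePoint_succAbove]
      exact Ioo_subset_Icc_self (hz j (mem_univ j))
  -- For the smooth approximations Green's formula has a boundary term. In the limit the volume
  -- terms cancel by the periodicity of `g₀`, so the boundary term of `U` vanishes.
  have key : ∀ φ : E3 → ℝ, ContDiff ℝ ∞ φ →
      (∀ (y : E3) (j : Fin 3), φ (y + EuclideanSpace.single j δ) = φ y) →
      ∫ z in B, φ (slicePoint i (x i) z) *
        (U (slicePoint i (x i + δ) z) - U (slicePoint i (x i) z)) = 0 := by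
    intro φ hφ hφp
    have hn : ∀ n, (∫ y in samplingDomain x δ, partialD i φ y * w n y) +
        ∫ y in samplingDomain x δ, φ y * partialD i (w n) y =
        ∫ z in B, φ (slicePoint i (x i) z) *
          (w n (slicePoint i (x i + δ) z) - w n (slicePoint i (x i) z)) := by
      intro n
      have h1 := integral_partialD_obox (lo := fun i => x i) (hi := fun i => x i + δ) hlt i
        (hφ.mul (hw n))
      rw [partialD_mul (hφ.differentiable (by simp)) ((hw n).differentiable (by simp)),
        integral_add] at h1
      · rw [add_comm, samplingDomain_eq_obox]
        simp only [mul_comm (partialD i φ _)]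
        rw [h1]
        refine integral_congr_ae (Eventually.of_forall fun z => ?_)
        simp only [slicePoint_add i (x i) δ z, hφp]
        ring
      · exact integrableOn_obox (hφ.continuous.mul (continuous_partialD (hw n) i))
      · exact integrableOn_obox ((hw n).continuous.mul (continuous_partialD hφ i))
    have hl := (tendsto_integral_mul_of_sqL2 (continuous_partialD hφ i)
      (fun n => (hw n).continuous) hg₀ h₀).add (tendsto_integral_mul_of_sqL2 hφ.continuous
        (fun n => continuous_partialD (hw n) i) hg₁ h₁)
    rw [hper φ hφ hφp, neg_add_cancel] at hl
    simp only [hn] at hl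
    refine tendsto_nhds_unique ?_ hl
    -- The `2` in the dominating function allows a uniform error of at most one on each of the two
    -- faces.
    have hbd : IntegrableOn (fun z => |φ (slicePoint i (x i) z)| *
        (|U (slicePoint i (x i + δ) z)| + |U (slicePoint i (x i) z)| + 2)) B := by
      have hc : Continuous fun z => |φ (slicePoint i (x i) z)| *
          (|U (slicePoint i (x i + δ) z)| + |U (slicePoint i (x i) z)| + 2) :=
        (hφ.continuous.comp (hcs _)).abs.mul
          (((hU.comp (hcs _)).abs.add (hU.comp (hcs _)).abs).add continuous_const)
      refine (hc.continuousOn.integrableOn_compact (isCompact_univ_pi fun j : Fin 2 =>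
        isCompact_Icc (a := x (i.succAbove j)) (b := x (i.succAbove j) + δ))).mono_set
          (pi_mono fun _ _ => Ioo_subset_Icc_self)
    refine tendsto_integral_filter_of_dominated_convergence _ (Eventually.of_forall fun n => ?_)
      ?_ hbd ?_
    · exact ((hφ.continuous.comp (hcs _)).mul (((hw n).continuous.comp (hcs _)).sub
        ((hw n).continuous.comp (hcs _)))).aestronglyMeasurable
    · filter_upwards [Metric.tendstoUniformlyOn_iff.1 hunif 1 one_pos] with n hn1
      filter_upwards [ae_restrict_mem hBm] with z hz
      have a1 := hn1 _ (hmem z hz (x i + δ) ⟨by linarith, le_rfl⟩)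
      have a2 := hn1 _ (hmem z hz (x i) ⟨le_rfl, by linarith⟩)
      rw [Real.dist_eq] at a1 a2
      rw [norm_mul, Real.norm_eq_abs, Real.norm_eq_abs]
      refine mul_le_mul_of_nonneg_left ?_ (abs_nonneg _)
      have b1 := abs_sub_abs_le_abs_sub (w n (slicePoint i (x i + δ) z))
        (U (slicePoint i (x i + δ) z))
      have b2 := abs_sub_abs_le_abs_sub (w n (slicePoint i (x i) z)) (U (slicePoint i (x i) z))
      rw [abs_sub_comm] at b1 b2
      have b3 := abs_sub (w n (slicePoint i (x i + δ) z)) (w n (slicePoint i (x i) z))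
      linarith
    · filter_upwards [ae_restrict_mem hBm] with z hz
      exact tendsto_const_nhds.mul
        ((hunif.tendsto_at (hmem z hz (x i + δ) ⟨by linarith, le_rfl⟩)).sub
          (hunif.tendsto_at (hmem z hz (x i) ⟨le_rfl, by linarith⟩)))
  have hzero := eqOn_zero_of_forall_integral_sinDist hδ
    (a := fun j => x (i.succAbove j))
    (w := fun z => U (slicePoint i (x i + δ) z) - U (slicePoint i (x i) z))
    ((hU.comp (hcs _)).sub (hU.comp (hcs _))) (fun p η => by
      have := key _ (contDiff_sinDist_slice δ i p η) fun y l => by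
        simp only [sinDist_slice_periodic hδ]
      simp only [slicePoint_succAbove] at this
      exact this)
  -- Points outside the cross section are first projected to it, where the vanishing is known.
  rw [← hclamp (slicePoint i (x i + δ) z), ← hclamp (slicePoint i (x i) z), clampBox_slicePoint,
    clampBox_slicePoint]
  have h3 := hzero (fun j => max (x (i.succAbove j)) (min (x (i.succAbove j) + δ) (z j)))
    fun j => ⟨le_max_left _ _, max_le (by linarith) (min_le_left _ _)⟩
  simp only [min_self, min_eq_right (hlt i).le, max_self, max_eq_right (hlt i).le]
  exact sub_eq_zero.1 h3

/-! ### Interpolation on the mesh -/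

/-- One-dimensional Lagrange interpolation, evaluated at `t`. -/
def interpAt (k : ℕ) (t₀ t₁ t : ℝ) (g : ℝ → ℝ) : ℝ :=
  ∑ j : Fin (k + 1), g (t₀ + (t₁ - t₀) * ((j : ℝ) / k)) * (intervalBasis k t₀ t₁ j).eval t

theorem eval_refBasis_node {k : ℕ} (hk : 1 ≤ k) (j l : Fin (k + 1)) :
    (refBasis k j).eval ((l : ℝ) / k) = if j = l then 1 else 0 := by
  split_ifs with h
  · subst h
    exact Lagrange.eval_basis_self (v := fun j : Fin (k + 1) => (j : ℝ) / k)
      (injective_node hk).injOn (Finset.mem_univ j)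
  · exact Lagrange.eval_basis_of_ne (v := fun j : Fin (k + 1) => (j : ℝ) / k) h (Finset.mem_univ l)

theorem interpAt_node {k : ℕ} (hk : 1 ≤ k) {t₀ t₁ : ℝ} (h : t₀ < t₁) (l : Fin (k + 1))
    (g : ℝ → ℝ) : interpAt k t₀ t₁ (t₀ + (t₁ - t₀) * ((l : ℝ) / k)) g =
      g (t₀ + (t₁ - t₀) * ((l : ℝ) / k)) := by
  have h1 : t₁ - t₀ ≠ 0 := (sub_pos.2 h).ne'
  rw [interpAt, Finset.sum_eq_single l]
  · rw [eval_intervalBasis, add_sub_cancel_left, inv_mul_cancel_left₀ h1, eval_refBasis_node hk,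
      if_pos rfl, mul_one]
  · intro j _ hj
    rw [eval_intervalBasis, add_sub_cancel_left, inv_mul_cancel_left₀ h1, eval_refBasis_node hk,
      if_neg hj, mul_zero]
  · simp

theorem interpAt_left {k : ℕ} (hk : 1 ≤ k) {t₀ t₁ : ℝ} (h : t₀ < t₁) (g : ℝ → ℝ) :
    interpAt k t₀ t₁ t₀ g = g t₀ := by
  simpa using interpAt_node hk h 0 g

theorem interpAt_right {k : ℕ} (hk : 1 ≤ k) {t₀ t₁ : ℝ} (h : t₀ < t₁) (g : ℝ → ℝ) :
    interpAt k t₀ t₁ t₁ g = g t₁ := by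
  have hk0 : (k : ℝ) ≠ 0 := by positivity
  simpa [hk0] using interpAt_node hk h (Fin.last k) g

/-- If the intervals only touch, then `t` is their common endpoint. Endpoints are nodes, so both
interpolants return `g t`. -/
theorem interpAt_congr_interval {k : ℕ} (hk : 1 ≤ k) {t₀ t₁ s₀ s₁ t : ℝ} (ht : t₀ < t₁)
    (hs : s₀ < s₁) (h : (t₀ = s₀ ∧ t₁ = s₁) ∨ t₁ ≤ s₀ ∨ s₁ ≤ t₀) (h1 : t ∈ Icc t₀ t₁)
    (h2 : t ∈ Icc s₀ s₁) (g : ℝ → ℝ) : interpAt k t₀ t₁ t g = interpAt k s₀ s₁ t g := by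
  rcases h with ⟨rfl, rfl⟩ | h | h
  · rfl
  · obtain rfl : t = t₁ := le_antisymm h1.2 (h.trans h2.1)
    obtain rfl : t = s₀ := le_antisymm h h2.1
    rw [interpAt_right hk ht, interpAt_left hk hs]
  · obtain rfl : t = t₀ := le_antisymm (h2.2.trans h) h1.1
    obtain rfl : t = s₁ := le_antisymm h2.2 h
    rw [interpAt_left hk ht, interpAt_right hk hs]

/-- Viewed as nested one-dimensional interpolations, interpolants on two boxes can be compared one
direction at a time. -/
theorem boxInterp_eq_interpAt (k : ℕ) (lo hi : Fin 3 → ℝ) (f : E3 → ℝ) (y : E3) :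
    boxInterp k lo hi f y = interpAt k (lo 0) (hi 0) (y 0) fun t₀ =>
      interpAt k (lo 1) (hi 1) (y 1) fun t₁ => interpAt k (lo 2) (hi 2) (y 2) fun t₂ =>
        f (WithLp.toLp 2 ![t₀, t₁, t₂]) := by
  let e : (Fin (k + 1) × Fin (k + 1) × Fin (k + 1)) ≃ (Fin 3 → Fin (k + 1)) :=
    { toFun := fun q => ![q.1, q.2.1, q.2.2]
      invFun := fun a => (a 0, a 1, a 2)
      left_inv := fun _ => rfl
      right_inv := fun a => by
        funext i
        fin_cases i <;> rfl }
  rw [boxInterp, ← e.sum_comp, Fintype.sum_prod_type]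
  simp only [Fintype.sum_prod_type, interpAt, Finset.sum_mul]
  refine Finset.sum_congr rfl fun a _ => Finset.sum_congr rfl fun b _ =>
    Finset.sum_congr rfl fun c _ => ?_
  have h1 : diagMap lo (hi - lo) (refNode k (e (a, b, c))) =
      WithLp.toLp 2 ![lo 0 + (hi 0 - lo 0) * ((a : ℝ) / k), lo 1 + (hi 1 - lo 1) * ((b : ℝ) / k),
        lo 2 + (hi 2 - lo 2) * ((c : ℝ) / k)] := by
    ext i
    fin_cases i <;> rfl
  rw [h1, shapeFn, tensorPoly, Fin.prod_univ_three]
  change _ * ((intervalBasis k (lo 0) (hi 0) a).eval (y 0) *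
    (intervalBasis k (lo 1) (hi 1) b).eval (y 1) *
    (intervalBasis k (lo 2) (hi 2) c).eval (y 2)) = _
  ring

/-! ### Continuity, periodicity and Green's formula for piecewise interpolants. -/

namespace Triangulation

variable {x : E3} {δ : ℝ} {𝒯 : Triangulation (samplingDomain x δ)}
  {lo hi : Parallelepiped → Fin 3 → ℝ} {k : ℕ}

/-- In each direction the two intervals coincide or meet at most in an endpoint, because the mesh is
a tensor product grid. This gives continuity across elements. -/
theorem boxInterp_eq_of_mem (hk : 1 ≤ k) (hδ : 0 < δ)
    (hbox : ∀ K ∈ 𝒯.cells, K.IsBox (lo K) (hi K)) {K K' : Parallelepiped} (hK : K ∈ 𝒯.cells)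
    (hK' : K' ∈ 𝒯.cells) {y : E3} (hy : y ∈ cbox (lo K) (hi K)) (hy' : y ∈ cbox (lo K') (hi K'))
    (U : E3 → ℝ) : boxInterp k (lo K) (hi K) U y = boxInterp k (lo K') (hi K') U y := by
  have h : ∀ i, interpAt k (lo K i) (hi K i) (y i) = interpAt k (lo K' i) (hi K' i) (y i) :=
    fun i => funext fun g => interpAt_congr_interval hk ((hbox K hK).lt i) ((hbox K' hK').lt i)
      (interval_eq_or_disjoint hδ hbox hK hK' i) (hy i) (hy' i) g
  rw [boxInterp_eq_interpAt, boxInterp_eq_interpAt, h 0, h 1, h 2]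

/-- In direction `i` both interpolations are evaluated at an endpoint and just restrict `U` to the
face; in the other directions they agree as on adjacent elements. What remains is the periodicity of
`U`. -/
theorem boxInterp_opposite (hk : 1 ≤ k) (hδ : 0 < δ)
    (hbox : ∀ K ∈ 𝒯.cells, K.IsBox (lo K) (hi K)) {U : E3 → ℝ}
    (hU : ∀ i z, U (slicePoint i (x i + δ) z) = U (slicePoint i (x i) z))
    {K K' : Parallelepiped} (hK : K ∈ 𝒯.cells) (hK' : K' ∈ 𝒯.cells) {i : Fin 3} {z : Fin 2 → ℝ}
    (hy : slicePoint i (x i + δ) z ∈ cbox (lo K) (hi K))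
    (hy' : slicePoint i (x i) z ∈ cbox (lo K') (hi K')) :
    boxInterp k (lo K) (hi K) U (slicePoint i (x i + δ) z) =
      boxInterp k (lo K') (hi K') U (slicePoint i (x i) z) := by
  have h : ∀ j, interpAt k (lo K (i.succAbove j)) (hi K (i.succAbove j)) (z j) =
      interpAt k (lo K' (i.succAbove j)) (hi K' (i.succAbove j)) (z j) :=
    fun j => funext fun g => interpAt_congr_interval hk ((hbox K hK).lt _) ((hbox K' hK').lt _)
      (interval_eq_or_disjoint hδ hbox hK hK' _) (by simpa using hy (i.succAbove j))
      (by simpa using hy' (i.succAbove j)) g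
  have hhi : x i + δ = hi K i := by
    have h1 := (hy i).2
    rw [slicePoint_same] at h1
    exact le_antisymm h1 (le_lo_and_hi_le hδ hbox hK i).2
  have hlo : x i = lo K' i := by
    have h1 := (hy' i).1
    rw [slicePoint_same] at h1
    exact le_antisymm (le_lo_and_hi_le hδ hbox hK' i).1 h1
  have hR : interpAt k (lo K i) (hi K i) (x i + δ) = fun g => g (x i + δ) := by
    funext g
    rw [hhi, interpAt_right hk ((hbox K hK).lt i)]
  have hL : interpAt k (lo K' i) (hi K' i) (x i) = fun g => g (x i) := by
    funext g
    rw [hlo, interpAt_left hk ((hbox K' hK').lt i)]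
  have hper := hU i
  have h0 := h 0
  have h1 := h 1
  rw [boxInterp_eq_interpAt, boxInterp_eq_interpAt]
  have hs : ∀ a b c : ℝ, (slicePoint 0 a ![b, c] = WithLp.toLp 2 ![a, b, c]) ∧
      (slicePoint 1 a ![b, c] = WithLp.toLp 2 ![b, a, c]) ∧
      (slicePoint 2 a ![b, c] = WithLp.toLp 2 ![b, c, a]) := by
    intro a b c
    refine ⟨?_, ?_, ?_⟩ <;> ext j <;> fin_cases j <;> rfl
  fin_cases i
  · change interpAt k (lo K 1) (hi K 1) (z 0) = interpAt k (lo K' 1) (hi K' 1) (z 0) at h0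
    change interpAt k (lo K 2) (hi K 2) (z 1) = interpAt k (lo K' 2) (hi K' 2) (z 1) at h1
    change interpAt k (lo K 0) (hi K 0) (x 0 + δ) _ = interpAt k (lo K' 0) (hi K' 0) (x 0) _
    change interpAt k (lo K 0) (hi K 0) (x 0 + δ) = _ at hR
    change interpAt k (lo K' 0) (hi K' 0) (x 0) = _ at hL
    rw [hR, hL]
    change interpAt k (lo K 1) (hi K 1) (z 0) (fun t₁ => interpAt k (lo K 2) (hi K 2) (z 1)
      fun t₂ => U (WithLp.toLp 2 ![x 0 + δ, t₁, t₂])) =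
      interpAt k (lo K' 1) (hi K' 1) (z 0) (fun t₁ => interpAt k (lo K' 2) (hi K' 2) (z 1)
      fun t₂ => U (WithLp.toLp 2 ![x 0, t₁, t₂]))
    rw [h0, h1]
    simp only [← (hs _ _ _).1]
    congr 1
    funext t₁
    congr 1
    funext t₂
    exact hper _
  · change interpAt k (lo K 0) (hi K 0) (z 0) = interpAt k (lo K' 0) (hi K' 0) (z 0) at h0
    change interpAt k (lo K 2) (hi K 2) (z 1) = interpAt k (lo K' 2) (hi K' 2) (z 1) at h1
    change interpAt k (lo K 1) (hi K 1) (x 1 + δ) = _ at hR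
    change interpAt k (lo K' 1) (hi K' 1) (x 1) = _ at hL
    change interpAt k (lo K 0) (hi K 0) (z 0) (fun t₀ => interpAt k (lo K 1) (hi K 1) (x 1 + δ)
      fun t₁ => interpAt k (lo K 2) (hi K 2) (z 1) fun t₂ => U (WithLp.toLp 2 ![t₀, t₁, t₂])) =
      interpAt k (lo K' 0) (hi K' 0) (z 0) (fun t₀ => interpAt k (lo K' 1) (hi K' 1) (x 1)
      fun t₁ => interpAt k (lo K' 2) (hi K' 2) (z 1) fun t₂ => U (WithLp.toLp 2 ![t₀, t₁, t₂]))
    rw [hR, hL, h0, h1]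
    simp only [← (hs _ _ _).2.1]
    congr 1
    funext t₀
    congr 1
    funext t₂
    exact hper _
  · change interpAt k (lo K 0) (hi K 0) (z 0) = interpAt k (lo K' 0) (hi K' 0) (z 0) at h0
    change interpAt k (lo K 1) (hi K 1) (z 1) = interpAt k (lo K' 1) (hi K' 1) (z 1) at h1
    change interpAt k (lo K 2) (hi K 2) (x 2 + δ) = _ at hR
    change interpAt k (lo K' 2) (hi K' 2) (x 2) = _ at hL
    change interpAt k (lo K 0) (hi K 0) (z 0) (fun t₀ => interpAt k (lo K 1) (hi K 1) (z 1)
      fun t₁ => interpAt k (lo K 2) (hi K 2) (x 2 + δ) fun t₂ =>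
        U (WithLp.toLp 2 ![t₀, t₁, t₂])) =
      interpAt k (lo K' 0) (hi K' 0) (z 0) (fun t₀ => interpAt k (lo K' 1) (hi K' 1) (z 1)
      fun t₁ => interpAt k (lo K' 2) (hi K' 2) (x 2) fun t₂ => U (WithLp.toLp 2 ![t₀, t₁, t₂]))
    rw [hR, hL, h0, h1]
    simp only [← (hs _ _ _).2.2]
    congr 1
    funext t₀
    congr 1
    funext t₁
    exact hper _

theorem exists_mem_cbox (hδ : 0 < δ) (hbox : ∀ K ∈ 𝒯.cells, K.IsBox (lo K) (hi K)) {y : E3}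
    (hy : y ∈ cbox (fun i => x i) fun i => x i + δ) :
    ∃ K ∈ 𝒯.cells, y ∈ cbox (lo K) (hi K) := by
  rw [← closure_samplingDomain x hδ, ← 𝒯.cover, mem_iUnion₂] at hy
  obtain ⟨K, hK, hyK⟩ := hy
  exact ⟨K, hK, by rwa [← (hbox K hK).carrier_eq]⟩

theorem ae_exists_mem_obox (hδ : 0 < δ) (hbox : ∀ K ∈ 𝒯.cells, K.IsBox (lo K) (hi K)) :
    ∀ᵐ y ∂(volume.restrict (samplingDomain x δ)), ∃ K ∈ 𝒯.cells, y ∈ obox (lo K) (hi K) := by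
  have h1 : ∀ᵐ y : E3, ∀ K ∈ 𝒯.cells, y ∈ cbox (lo K) (hi K) → y ∈ obox (lo K) (hi K) :=
    (ae_ball_iff 𝒯.cells.countable_toSet).2 fun K _ =>
      (cbox_ae_eq_obox (lo K) (hi K)).le
  filter_upwards [ae_restrict_of_ae h1, ae_restrict_mem (isOpen_samplingDomain x δ).measurableSet]
    with y hy hyD
  rw [samplingDomain_eq_obox] at hyD
  obtain ⟨K, hK, hyK⟩ := exists_mem_cbox hδ hbox (obox_subset_cbox _ _ hyD)
  exact ⟨K, hK, hy K hK hyK⟩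

/-- `V` is the piecewise interpolant of `U`, with piecewise partial derivatives `V'`. -/
structure IsInterp (𝒯 : Triangulation (samplingDomain x δ)) (lo hi : Parallelepiped → Fin 3 → ℝ)
    (k : ℕ) (U V : E3 → ℝ) (V' : Fin 3 → E3 → ℝ) : Prop where
  eq_boxInterp : ∀ K ∈ 𝒯.cells, ∀ y ∈ cbox (lo K) (hi K), V y = boxInterp k (lo K) (hi K) U y
  deriv_eq : ∀ y, (∃ K ∈ 𝒯.cells, y ∈ cbox (lo K) (hi K)) → ∃ K ∈ 𝒯.cells,
    y ∈ cbox (lo K) (hi K) ∧ ∀ i, V' i y = partialD i (boxInterp k (lo K) (hi K) U) y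

/-- A cell is chosen at every point. The value does not depend on the choice, while the derivative
does only on the mesh faces. -/
theorem exists_isInterp (hk : 1 ≤ k) (hδ : 0 < δ)
    (hbox : ∀ K ∈ 𝒯.cells, K.IsBox (lo K) (hi K)) (U : E3 → ℝ) :
    ∃ V V', IsInterp 𝒯 lo hi k U V V' := by
  have h : ∀ y : E3, ∃ a : ℝ × (Fin 3 → ℝ), (∃ K ∈ 𝒯.cells, y ∈ cbox (lo K) (hi K)) →
      ∃ K ∈ 𝒯.cells, y ∈ cbox (lo K) (hi K) ∧ a.1 = boxInterp k (lo K) (hi K) U y ∧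
        ∀ i, a.2 i = partialD i (boxInterp k (lo K) (hi K) U) y := by
    intro y
    by_cases hy : ∃ K ∈ 𝒯.cells, y ∈ cbox (lo K) (hi K)
    · obtain ⟨K, hK, hyK⟩ := hy
      exact ⟨(boxInterp k (lo K) (hi K) U y, fun i => partialD i (boxInterp k (lo K) (hi K) U) y),
        fun _ => ⟨K, hK, hyK, rfl, fun _ => rfl⟩⟩
    · exact ⟨0, fun h => absurd h hy⟩
  choose a ha using h
  refine ⟨fun y => (a y).1, fun i y => (a y).2 i, ?_, ?_⟩
  · intro K hK y hy
    obtain ⟨K', hK', hy', h1, -⟩ := ha y ⟨K, hK, hy⟩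
    rw [h1, boxInterp_eq_of_mem hk hδ hbox hK' hK hy' hy]
  · intro y hy
    obtain ⟨K', hK', hy', -, h2⟩ := ha y hy
    exact ⟨K', hK', hy', h2⟩

namespace IsInterp

variable {U V : E3 → ℝ} {V' : Fin 3 → E3 → ℝ}

theorem deriv_eq_of_mem_obox (h : IsInterp 𝒯 lo hi k U V V')
    (hbox : ∀ K ∈ 𝒯.cells, K.IsBox (lo K) (hi K)) {K : Parallelepiped} (hK : K ∈ 𝒯.cells) {y : E3}
    (hy : y ∈ obox (lo K) (hi K)) (i : Fin 3) :
    V' i y = partialD i (boxInterp k (lo K) (hi K) U) y := by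
  obtain ⟨K', hK', hy', h1⟩ := h.deriv_eq y ⟨K, hK, obox_subset_cbox _ _ hy⟩
  obtain rfl : K = K' := eq_of_obox_inter_cbox hbox hK hK' ⟨y, hy, hy'⟩
  exact h1 i

theorem continuousOn (h : IsInterp 𝒯 lo hi k U V V') (hδ : 0 < δ)
    (hbox : ∀ K ∈ 𝒯.cells, K.IsBox (lo K) (hi K)) :
    ContinuousOn V (cbox (fun i => x i) fun i => x i + δ) := by
  have h1 : ContinuousOn V (⋃ K : 𝒯.cells, cbox (lo K.1) (hi K.1)) := by
    refine LocallyFinite.continuousOn_iUnion (locallyFinite_of_finite _)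
      (fun K => isClosed_cbox _ _) fun K => ?_
    exact (contDiff_boxInterp k (lo K.1) (hi K.1) U).continuous.continuousOn.congr
      fun y hy => h.eq_boxInterp K.1 K.2 y hy
  refine h1.mono fun y hy => ?_
  obtain ⟨K, hK, hyK⟩ := exists_mem_cbox hδ hbox hy
  exact mem_iUnion.2 ⟨⟨K, hK⟩, hyK⟩

theorem memLp_deriv (h : IsInterp 𝒯 lo hi k U V V') (hδ : 0 < δ)
    (hbox : ∀ K ∈ 𝒯.cells, K.IsBox (lo K) (hi K)) (i : Fin 3) :
    MemLp (V' i) 2 (volume.restrict (samplingDomain x δ)) := by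
  have h1 : MemLp (fun y => ∑ K ∈ 𝒯.cells, (obox (lo K) (hi K)).indicator
      (partialD i (boxInterp k (lo K) (hi K) U)) y) 2 (volume.restrict (samplingDomain x δ)) :=
    memLp_finsetSum _ fun K _ => (memLp_of_continuous (continuous_partialD
      (contDiff_boxInterp k (lo K) (hi K) U) i) 2).indicator (isOpen_obox _ _).measurableSet
  refine h1.ae_eq ?_
  filter_upwards [ae_exists_mem_obox hδ hbox] with y hy
  obtain ⟨K, hK, hyK⟩ := hy
  rw [Finset.sum_eq_single K, indicator_of_mem hyK, h.deriv_eq_of_mem_obox hbox hK hyK]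
  · intro K' hK' hne
    refine indicator_of_notMem (fun hy' => hne ?_) _
    exact eq_of_obox_inter_cbox hbox hK' hK ⟨y, hy', obox_subset_cbox _ _ hyK⟩
  · exact fun hn => absurd hK hn

/-- Unless `t` is an endpoint of a cell in direction `i`, the line stays for a while in one closed
cell, even when it runs inside a mesh face parallel to it. -/
theorem hasDerivAt_slice (h : IsInterp 𝒯 lo hi k U V V') (hδ : 0 < δ)
    (hbox : ∀ K ∈ 𝒯.cells, K.IsBox (lo K) (hi K)) {i : Fin 3} {z : Fin 2 → ℝ} {t : ℝ}
    (hmem : slicePoint i t z ∈ obox (fun i => x i) fun i => x i + δ)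
    (ht : t ∉ ⋃ K ∈ 𝒯.cells, ({lo K i, hi K i} : Set ℝ)) :
    HasDerivAt (fun t => V (slicePoint i t z)) (V' i (slicePoint i t z)) t := by
  obtain ⟨K, hK, hyK, hd⟩ := h.deriv_eq _ (exists_mem_cbox hδ hbox (obox_subset_cbox _ _ hmem))
  rw [hd i]
  refine (hasDerivAt_slicePoint ((contDiff_boxInterp k (lo K) (hi K) U).differentiable (by simp))
    i z t).congr_of_eventuallyEq ?_
  have h1 := hyK i
  rw [slicePoint_same] at h1
  have h2 : t ∈ Ioo (lo K i) (hi K i) := by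
    simp only [mem_iUnion, mem_insert_iff, mem_singleton_iff, not_exists, not_or] at ht
    obtain ⟨h3, h4⟩ := ht K hK
    exact ⟨lt_of_le_of_ne h1.1 (Ne.symm h3), lt_of_le_of_ne h1.2 h4⟩
  filter_upwards [Ioo_mem_nhds h2.1 h2.2] with s hs
  refine h.eq_boxInterp K hK _ fun j => ?_
  rcases Fin.eq_self_or_eq_succAbove i j with rfl | ⟨j, rfl⟩
  · rw [slicePoint_same]
    exact Ioo_subset_Icc_self hs
  · have := hyK (i.succAbove j)
    rwa [slicePoint_succAbove] at this ⊢

/-- Integration by parts for the piecewise interpolant of a periodic function. -/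
theorem integral_eq (h : IsInterp 𝒯 lo hi k U V V') (hk : 1 ≤ k) (hδ : 0 < δ)
    (hbox : ∀ K ∈ 𝒯.cells, K.IsBox (lo K) (hi K))
    (hU : ∀ i z, U (slicePoint i (x i + δ) z) = U (slicePoint i (x i) z)) {φ : E3 → ℝ}
    (hφ : ContDiff ℝ ∞ φ) (i : Fin 3)
    (hφi : ∀ z ∈ crossSection (fun i => x i) (fun i => x i + δ) i,
      φ (slicePoint i (x i + δ) z) = φ (slicePoint i (x i) z)) (c : ℝ) :
    ∫ y in samplingDomain x δ, partialD i φ y * (V y - c) =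
      -∫ y in samplingDomain x δ, φ y * V' i y := by
  have hlt : ∀ i, x i < x i + δ := fun i => by linarith
  have hmem : ∀ z ∈ crossSection (fun i => x i) (fun i => x i + δ) i, ∀ t ∈ Icc (x i) (x i + δ),
      slicePoint i t z ∈ cbox (fun i => x i) fun i => x i + δ := by
    intro z hz t ht j
    rcases Fin.eq_self_or_eq_succAbove i j with rfl | ⟨j, rfl⟩
    · simpa using ht
    · rw [slicePoint_succAbove]
      exact Ioo_subset_Icc_self (hz j (mem_univ j))
  have hVc := h.continuousOn hδ hbox
  have i1 : IntegrableOn (fun y => partialD i φ y * (V y - c)) (samplingDomain x δ) := by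
    refine IntegrableOn.mono_set ?_ (samplingDomain_eq_obox x δ ▸ obox_subset_cbox _ _)
    exact ((continuous_partialD hφ i).continuousOn.mul
      (hVc.sub continuousOn_const)).integrableOn_compact (isCompact_cbox _ _)
  have i2 : IntegrableOn (fun y => φ y * V' i y) (samplingDomain x δ) :=
    (memLp_of_continuous hφ.continuous 2).integrable_mul (h.memLp_deriv hδ hbox i)
  have hslice : Continuous fun p : ℝ × (Fin 2 → ℝ) => slicePoint i p.1 p.2 :=
    continuous_slicePoint i
  have hsc : ∀ z, Continuous fun t => slicePoint i t z := fun z =>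
    hslice.comp (continuous_id.prodMk continuous_const)
  -- `V` is continuous along lines, so the interior mesh planes produce no jump terms. The constant
  -- `c` allows the mean value to be subtracted later.
  have hG := integral_obox_eq_boundary (lo := fun i => x i) (hi := fun i => x i + δ) hlt i
    (f := fun y => φ y * (V y - c)) (f' := fun y => partialD i φ y * (V y - c) + φ y * V' i y)
    (s := ⋃ K ∈ 𝒯.cells, {lo K i, hi K i})
    (𝒯.cells.countable_toSet.biUnion fun K _ => (Set.toFinite _).countable) (fun z hz => by
      refine (hφ.continuous.comp (hsc z)).continuousOn.mul (ContinuousOn.sub ?_ continuousOn_const)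
      exact hVc.comp (hsc z).continuousOn fun t ht => hmem z hz t ht)
    (fun z hz t ht => by
      have h1 := hasDerivAt_slicePoint (hφ.differentiable (by simp)) i z t
      have h2 := h.hasDerivAt_slice hδ hbox (slicePoint_mem_obox.2 ⟨ht.1, hz⟩) ht.2
      exact h1.mul (h2.sub_const c)) (i1.add i2)
  rw [← samplingDomain_eq_obox, integral_add i1 i2] at hG
  rw [eq_neg_iff_add_eq_zero]
  refine hG.trans ?_
  refine setIntegral_eq_zero_of_forall_eq_zero fun z hz => ?_
  have e1 := hmem z hz (x i + δ) ⟨by linarith, le_rfl⟩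
  have e2 := hmem z hz (x i) ⟨le_rfl, by linarith⟩
  obtain ⟨K, hK, hyK⟩ := exists_mem_cbox hδ hbox e1
  obtain ⟨K', hK', hyK'⟩ := exists_mem_cbox hδ hbox e2
  rw [h.eq_boxInterp K hK _ hyK, h.eq_boxInterp K' hK' _ hyK', hφi z hz,
    boxInterp_opposite hk hδ hbox hU hK hK' hyK hyK', sub_self]

end IsInterp

end Triangulation

/-! ### Finite element functions from piecewise interpolants -/

theorem integral_smul_Lp_apply {x : E3} {δ : ℝ} {N : ℕ} {ψ : E3 → ℝ} (h : Continuous ψ)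
    (u : Lp (EuclideanSpace ℝ (Fin N)) 2 (volume.restrict (samplingDomain x δ))) (c : Fin N) :
    (∫ y in samplingDomain x δ, ψ y • u y) c = ∫ y in samplingDomain x δ, ψ y * u y c :=
  ((EuclideanSpace.proj c : EuclideanSpace ℝ (Fin N) →L[ℝ] ℝ).integral_comp_comm
    (integrable_continuous_smul_Lp h u)).symm

theorem MultiIndex.eq_zero_or_eq_single (β : MultiIndex 1) :
    β = MultiIndex.zero 1 ∨ ∃ i, β = MultiIndex.single i := by
  by_cases h : ∃ i, β.1 i ≠ 0
  · obtain ⟨i, hi⟩ := h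
    refine Or.inr ⟨i, Subtype.ext (funext fun j => ?_)⟩
    have h1 := β.2
    rcases eq_or_ne j i with rfl | hj
    · have h2 := (Finset.single_le_sum (f := β.1) (fun _ _ => Nat.zero_le _)
        (Finset.mem_univ j)).trans h1
      simp only [MultiIndex.single, Pi.single_eq_same]
      omega
    · have h2 : β.1 i + β.1 j ≤ ∑ l, β.1 l := by
        rw [← Finset.sum_pair hj.symm]
        exact Finset.sum_le_sum_of_subset (Finset.subset_univ _)
      simp only [MultiIndex.single, Pi.single_eq_of_ne hj]
      omega
  · push Not at h
    exact Or.inl (Subtype.ext (funext h))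

/-- A tensor product of polynomials as a polynomial in three variables. -/
def tensorMvPoly (p : Fin 3 → Polynomial ℝ) : MvPolynomial (Fin 3) ℝ :=
  ∏ i, Polynomial.aeval (MvPolynomial.X i) (p i)

theorem eval_tensorMvPoly (p : Fin 3 → Polynomial ℝ) (y : E3) :
    MvPolynomial.eval (fun i => y i) (tensorMvPoly p) = tensorPoly p y := by
  simp only [tensorMvPoly, tensorPoly, map_prod]
  refine Finset.prod_congr rfl fun i _ => ?_
  rw [← MvPolynomial.coe_aeval_eq_eval, RingHom.coe_coe, ← Polynomial.aeval_algHom_apply,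
    MvPolynomial.aeval_X, Polynomial.coe_aeval_eq_eval]

theorem degreeOf_aeval_X_le (p : Polynomial ℝ) (i j : Fin 3) :
    (Polynomial.aeval (MvPolynomial.X i : MvPolynomial (Fin 3) ℝ) p).degreeOf j ≤
      if j = i then p.natDegree else 0 := by
  rw [Polynomial.aeval_eq_sum_range]
  refine (MvPolynomial.degreeOf_sum_le _ _ _).trans (Finset.sup_le fun n hn => ?_)
  rw [MvPolynomial.smul_eq_C_mul]
  refine (MvPolynomial.degreeOf_C_mul_le _ _ _).trans ?_
  refine (MvPolynomial.degreeOf_pow_le _ _ _).trans ?_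
  rw [MvPolynomial.degreeOf_X]
  split_ifs
  · simpa using Nat.lt_succ_iff.1 (Finset.mem_range.1 hn)
  · simp

theorem degreeOf_tensorMvPoly_le {k : ℕ} {p : Fin 3 → Polynomial ℝ}
    (hp : ∀ i, (p i).natDegree ≤ k) (j : Fin 3) : (tensorMvPoly p).degreeOf j ≤ k := by
  refine (MvPolynomial.degreeOf_prod_le _ _ _).trans ?_
  refine (Finset.sum_le_sum fun i _ => degreeOf_aeval_X_le (p i) i j).trans ?_
  simpa using hp j

theorem exists_mvPolynomial_boxInterp {k : ℕ} (hk : 1 ≤ k) (lo hi : Fin 3 → ℝ) (U : E3 → ℝ)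
    (c : ℝ) : ∃ p : MvPolynomial (Fin 3) ℝ, (∀ i, p.degreeOf i ≤ k) ∧
      ∀ y : E3, boxInterp k lo hi U y - c = MvPolynomial.eval (fun i => y i) p := by
  refine ⟨(∑ a : Fin 3 → Fin (k + 1), MvPolynomial.C (U (diagMap lo (hi - lo) (refNode k a))) *
    tensorMvPoly fun i => intervalBasis k (lo i) (hi i) (a i)) - MvPolynomial.C c,
    fun i => ?_, fun y => ?_⟩
  · refine (MvPolynomial.degreeOf_sub_le _ _ _).trans (max_le ?_ (by simp))
    refine (MvPolynomial.degreeOf_sum_le _ _ _).trans (Finset.sup_le fun a _ => ?_)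
    exact (MvPolynomial.degreeOf_C_mul_le _ _ _).trans
      (degreeOf_tensorMvPoly_le (fun i => natDegree_intervalBasis_le hk _ _ _) i)
  · simp only [map_sub, map_sum, map_mul, MvPolynomial.eval_C, eval_tensorMvPoly]
    rfl

namespace Triangulation

variable {x : E3} {δ : ℝ} {𝒯 : Triangulation (samplingDomain x δ)}
  {lo hi : Parallelepiped → Fin 3 → ℝ} {k : ℕ}

/-- Piecewise interpolants of continuous periodic functions are, up to constants, the components
of an element of the periodic Lagrange space. -/
theorem exists_mem_lagrangeSpace (hk : 1 ≤ k) (hδ : 0 < δ)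
    (hbox : ∀ K ∈ 𝒯.cells, K.IsBox (lo K) (hi K)) {N : ℕ} {U V : Fin N → E3 → ℝ}
    {V' : Fin N → Fin 3 → E3 → ℝ} (h : ∀ c, IsInterp 𝒯 lo hi k (U c) (V c) (V' c))
    (hU : ∀ c i z, U c (slicePoint i (x i + δ) z) = U c (slicePoint i (x i) z)) :
    ∃ v ∈ lagrangeSpace 𝒯 k N, ∀ i, ∀ᵐ y ∂(volume.restrict (samplingDomain x δ)),
      ∀ c, weakPartial i v y c = V' c i y := by
  have hVc : ∀ c, MemLp (V c) 2 (volume.restrict (samplingDomain x δ)) := by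
    intro c
    have hcont := (h c).continuousOn hδ hbox
    obtain ⟨C, hC⟩ := (isCompact_cbox _ _).exists_bound_of_continuousOn hcont
    have hsub : samplingDomain x δ ⊆ cbox (fun i => x i) fun i => x i + δ :=
      samplingDomain_eq_obox x δ ▸ obox_subset_cbox _ _
    refine (memLp_top_of_bound ((hcont.mono hsub).aestronglyMeasurable
      (isOpen_samplingDomain x δ).measurableSet) C ?_).mono_exponent le_top
    filter_upwards [ae_restrict_mem (isOpen_samplingDomain x δ).measurableSet] with y hy
    exact hC y (hsub hy)
  -- Subtracting the average enforces mean zero without changing the gradient.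
  let μ : Fin N → ℝ := fun c => ⨍ y in samplingDomain x δ, V c y
  let f : MultiIndex 1 → Fin N → E3 → ℝ := fun β c y =>
    if β.1 = 0 then V c y - μ c else ∑ i, (β.1 i : ℝ) * V' c i y
  have hf0 : ∀ c y, f (MultiIndex.zero 1) c y = V c y - μ c := fun c y => if_pos rfl
  have hf1 : ∀ i c y, f (MultiIndex.single i) c y = V' c i y := by
    intro i c y
    have h1 : (MultiIndex.single i).1 ≠ 0 := by simp [MultiIndex.single]
    simp only [f, if_neg h1]
    rw [Finset.sum_eq_single i] <;> simp +contextual [MultiIndex.single]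
  have hf : ∀ β, MemLp (fun y => (WithLp.toLp 2 fun c => f β c y : EuclideanSpace ℝ (Fin N))) 2
      (volume.restrict (samplingDomain x δ)) := by
    intro β
    refine MemLp.of_eval_piLp (p := 2) fun c => ?_
    rcases β.eq_zero_or_eq_single with rfl | ⟨i, rfl⟩
    · simp only [hf0]
      exact (hVc c).sub (memLp_const _)
    · simp only [hf1]
      exact (h c).memLp_deriv hδ hbox i
  have hF : ∀ β, ∀ᵐ y : E3 ∂(volume.restrict (samplingDomain x δ)),
      ∀ c, (hf β).toLp _ y c = f β c y := by
    intro β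
    filter_upwards [(hf β).coeFn_toLp] with y hy c
    rw [hy]
  have hint : ∀ β c (ψ : E3 → ℝ), Continuous ψ → (∫ y in samplingDomain x δ, ψ y • (hf β).toLp _ y) c
      = ∫ y in samplingDomain x δ, ψ y * f β c y := by
    intro β c ψ hψ
    rw [integral_smul_Lp_apply hψ]
    refine integral_congr_ae ?_
    filter_upwards [hF β] with y hy
    rw [hy]
  -- Only equal values of `φ` on the two faces are required. This covers compactly supported test
  -- functions, giving weak differentiability, and periodic ones, giving membership in the periodic
  -- space.
  have hgreen : ∀ φ : E3 → ℝ, ContDiff ℝ ∞ φ → ∀ i,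
      (∀ z ∈ crossSection (fun i => x i) (fun i => x i + δ) i,
        φ (slicePoint i (x i + δ) z) = φ (slicePoint i (x i) z)) →
      ∫ y in samplingDomain x δ, partialD i φ y • (hf (MultiIndex.zero 1)).toLp _ y =
        -∫ y in samplingDomain x δ, φ y • (hf (MultiIndex.single i)).toLp _ y := by
    intro φ hφ i hφi
    ext c
    rw [PiLp.neg_apply, hint _ _ _ (continuous_partialD hφ i), hint _ _ _ hφ.continuous]
    simp only [hf0, hf1]
    exact (h c).integral_eq hk hδ hbox (hU c) hφ i hφi (μ c)
  let v : SobolevSpace (samplingDomain x δ) 1 N :=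
    ⟨WithLp.toLp 2 fun β => (hf β).toLp _, by
      intro β φ hφ _ hφD
      rcases β.eq_zero_or_eq_single with rfl | ⟨i, rfl⟩
      · simp [MultiIndex.zero, iterPartialD_zero]
      · have hz : ∀ t ∉ Ioo (x i) (x i + δ), ∀ z, φ (slicePoint i t z) = 0 := by
          intro t ht z
          refine image_eq_zero_of_notMem_tsupport fun hmem => ht ?_
          have := hφD hmem
          rw [samplingDomain_eq_obox, slicePoint_mem_obox] at this
          exact this.1
        have h1 := hgreen φ hφ i fun z _ => by rw [hz _ (by simp), hz _ (by simp)]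
        simpa [MultiIndex.single, iterPartialD_single hφ] using h1⟩
  refine ⟨v, ⟨⟨?_, ?_⟩, ?_⟩, fun i => ?_⟩
  · have h1 : ∫ y in samplingDomain x δ, (1 : ℝ) • (hf (MultiIndex.zero 1)).toLp _ y = 0 := by
      ext c
      rw [hint _ _ (fun _ => 1) continuous_const]
      simp only [hf0, one_mul]
      rw [integral_sub ((hVc c).integrable (by norm_num)) (integrable_const _)]
      have := integral_average (volume.restrict (samplingDomain x δ)) (V c)
      rw [← integral_average (volume.restrict (samplingDomain x δ)) (V c)]
      simp [μ]
    simp only [one_smul] at h1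
    exact h1
  · intro φ hφ hper i
    refine hgreen φ hφ i fun z _ => ?_
    rw [slicePoint_add, hper]
  · intro K hK
    choose p hp1 hp2 using fun c => exists_mvPolynomial_boxInterp hk (lo K) (hi K) (U c) (μ c)
    refine ⟨p, hp1, ?_⟩
    filter_upwards [hF (MultiIndex.zero 1)] with y hy hyK c
    rw [(hbox K hK).carrier_eq] at hyK
    refine (hy c).trans ?_
    rw [hf0, (h c).eq_boxInterp K hK y hyK, hp2]
  · filter_upwards [hF (MultiIndex.single i)] with y hy c
    exact (hy c).trans (hf1 i c y)

end Triangulation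

/-! ### The interpolation error for Sobolev functions -/

/-- An interpolant depends only on finitely many nodal values, so pointwise convergence is enough.
-/
theorem tendsto_sqL2_partialD_boxInterp {k : ℕ} {lo hi : Fin 3 → ℝ} (h : ∀ i, lo i < hi i)
    {w : ℕ → E3 → ℝ} {U : E3 → ℝ}
    (hU : ∀ y ∈ cbox lo hi, Tendsto (fun n => w n y) atTop (𝓝 (U y))) (i : Fin 3) :
    Tendsto (fun n => sqL2 (cbox lo hi) fun y =>
      partialD i (boxInterp k lo hi (w n)) y - partialD i (boxInterp k lo hi U) y)
      atTop (𝓝 0) := by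
  let z : (Fin 3 → Fin (k + 1)) → E3 := fun a => diagMap lo (hi - lo) (refNode k a)
  have hz : ∀ a, z a ∈ cbox lo hi := fun a => diagMap_mem_cbox h (refNode_mem a)
  have hS : ∀ a, Continuous (partialD i (shapeFn k lo hi a)) := fun a =>
    continuous_partialD (contDiff_shapeFn k lo hi a) i
  refine tendsto_of_tendsto_of_tendsto_of_le_of_le tendsto_const_nhds
    (h := fun n => Fintype.card (Fin 3 → Fin (k + 1)) * ∑ a, ‖w n (z a) - U (z a)‖ₑ ^ 2 *
      sqL2 (cbox lo hi) (partialD i (shapeFn k lo hi a))) ?_ (fun _ => zero_le) fun n => ?_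
  · have h1 : ∀ a, Tendsto (fun n => ‖w n (z a) - U (z a)‖ₑ ^ 2 *
        sqL2 (cbox lo hi) (partialD i (shapeFn k lo hi a))) atTop (𝓝 0) := by
      intro a
      have h2 : Tendsto (fun n => ‖w n (z a) - U (z a)‖ₑ) atTop (𝓝 0) := by
        have := ((hU (z a) (hz a)).sub_const (U (z a))).enorm
        simpa using this
      have h3 : Tendsto (fun n => ‖w n (z a) - U (z a)‖ₑ ^ 2) atTop (𝓝 0) := by
        have := ((ENNReal.continuous_pow 2).tendsto 0).comp h2
        rwa [zero_pow two_ne_zero] at this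
      simpa using ENNReal.Tendsto.mul_const h3 (Or.inr (sqL2_lt_top_of_continuous (hS a)).ne)
    have h4 := ENNReal.Tendsto.const_mul (tendsto_finsetSum Finset.univ fun a _ => h1 a)
      (Or.inr (ENNReal.natCast_ne_top (Fintype.card (Fin 3 → Fin (k + 1)))))
    simpa using h4
  · have h1 : ∀ y, partialD i (boxInterp k lo hi (w n)) y - partialD i (boxInterp k lo hi U) y =
        ∑ a, (w n (z a) - U (z a)) * partialD i (shapeFn k lo hi a) y := by
      intro y
      simp only [partialD_boxInterp, ← Finset.sum_sub_distrib, sub_mul]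
      rfl
    refine (congrArg (sqL2 _) (funext h1)).le.trans ?_
    refine (sqL2_sum_le _ fun a => continuous_const.mul (hS a)).trans (le_of_eq ?_)
    exact congrArg _ (Finset.sum_congr rfl fun a _ => sqL2_const_mul _ _ _)

/-- The interpolation error on a box, for limits of smooth functions. -/
theorem sqL2_sub_partialD_boxInterp_le {k : ℕ} {lo hi : Fin 3 → ℝ} (h : ∀ i, lo i < hi i)
    {B : ℝ≥0} {w : ℕ → E3 → ℝ} (hw : ∀ n, ContDiff ℝ ∞ (w n))
    (hB : ∀ n i, sqL2 (cbox lo hi) (partialD i fun y => w n y - boxInterp k lo hi (w n) y) ≤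
      B * sqSeminorm (cbox lo hi) (k + 1) (w n)) {g : MultiIndex (k + 1) → E3 → ℝ}
    (hgm : ∀ β, Measurable (g β)) (hlim : ∀ β : MultiIndex (k + 1),
      Tendsto (fun n => sqL2 (cbox lo hi) fun y => iterPartialD β.1 (w n) y - g β y)
        atTop (𝓝 0)) {i : Fin 3} {g' : E3 → ℝ} (hgm' : Measurable g')
    (hlim' : Tendsto (fun n => sqL2 (cbox lo hi) fun y => partialD i (w n) y - g' y)
        atTop (𝓝 0)) {U : E3 → ℝ}
    (hU : ∀ y ∈ cbox lo hi, Tendsto (fun n => w n y) atTop (𝓝 (U y))) :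
    sqL2 (cbox lo hi) (fun y => g' y - partialD i (boxInterp k lo hi U) y) ≤
      8 * B * ∑ β : MultiIndex (k + 1),
        if ∑ i, β.1 i = k + 1 then sqL2 (cbox lo hi) (g β) else 0 := by
  let S : ℕ → ℝ≥0∞ := fun n => ∑ β : MultiIndex (k + 1), if ∑ i, β.1 i = k + 1 then
    2 * ((sqL2 (cbox lo hi) fun y => iterPartialD β.1 (w n) y - g β y) +
      sqL2 (cbox lo hi) (g β)) else 0
  have hS : Tendsto S atTop (𝓝 (∑ β : MultiIndex (k + 1), if ∑ i, β.1 i = k + 1 then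
      2 * (0 + sqL2 (cbox lo hi) (g β)) else 0)) := by
    refine tendsto_finsetSum _ fun β _ => ?_
    split_ifs
    · exact ENNReal.Tendsto.const_mul ((hlim β).add tendsto_const_nhds) (Or.inr (by simp))
    · exact tendsto_const_nhds
  have hSle : ∀ n, sqSeminorm (cbox lo hi) (k + 1) (w n) ≤ S n := by
    intro n
    refine Finset.sum_le_sum fun β _ => ?_
    split_ifs
    · have h1 := sqL2_add_le (cbox lo hi) (f := fun y => iterPartialD β.1 (w n) y - g β y)
        (g := g β) ((contDiff_iterPartialD (hw n) β.1).continuous.measurable.sub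
          (hgm β)).aestronglyMeasurable
      simpa using h1
    · exact le_rfl
  have hT := tendsto_sqL2_partialD_boxInterp (k := k) h hU i
  -- Two applications of the squared triangle inequality give a factor `4`; another `2` comes from
  -- replacing the seminorm of `w n` by that of its limit. Hence the constant `8`.
  have hbd : ∀ n, sqL2 (cbox lo hi) (fun y => g' y - partialD i (boxInterp k lo hi U) y) ≤
      2 * ((sqL2 (cbox lo hi) fun y => partialD i (w n) y - g' y) + 2 * (B * S n +
        sqL2 (cbox lo hi) fun y => partialD i (boxInterp k lo hi (w n)) y -
          partialD i (boxInterp k lo hi U) y)) := by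
    intro n
    have c1 := continuous_partialD (hw n) i
    have c2 := continuous_partialD (contDiff_boxInterp k lo hi (w n)) i
    have h1 : ∀ y, partialD i (fun y => w n y - boxInterp k lo hi (w n) y) y =
        partialD i (w n) y - partialD i (boxInterp k lo hi (w n)) y := by
      intro y
      have h2 := iterPartialD_sub (hw n) (contDiff_boxInterp k lo hi (w n)) (Pi.single i 1)
      rw [iterPartialD_single ((hw n).sub (contDiff_boxInterp k lo hi (w n))),
        iterPartialD_single (hw n), iterPartialD_single (contDiff_boxInterp k lo hi (w n))] at h2
      exact congrFun h2 y
    have e1 := sqL2_add_le (cbox lo hi) (f := fun y => g' y - partialD i (w n) y)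
      (g := fun y => partialD i (w n) y - partialD i (boxInterp k lo hi U) y)
      (hgm'.sub c1.measurable).aestronglyMeasurable
    have e2 := sqL2_add_le (cbox lo hi)
      (f := fun y => partialD i (w n) y - partialD i (boxInterp k lo hi (w n)) y)
      (g := fun y => partialD i (boxInterp k lo hi (w n)) y - partialD i (boxInterp k lo hi U) y)
      (c1.sub c2).aestronglyMeasurable
    simp only [sub_add_sub_cancel] at e1 e2
    have e3 : (sqL2 (cbox lo hi) fun y => g' y - partialD i (w n) y) =
        sqL2 (cbox lo hi) fun y => partialD i (w n) y - g' y := by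
      simp only [sqL2, enorm_sub_rev]
    have e4 := (hB n i).trans (mul_le_mul_right (hSle n) (B : ℝ≥0∞))
    have e5 : (partialD i fun y => w n y - boxInterp k lo hi (w n) y) =
        fun y => partialD i (w n) y - partialD i (boxInterp k lo hi (w n)) y := funext h1
    rw [e5] at e4
    rw [e3] at e1
    refine e1.trans ?_
    gcongr
    refine e2.trans ?_
    gcongr
  refine (ge_of_tendsto' (ENNReal.Tendsto.const_mul (hlim'.add (ENNReal.Tendsto.const_mul
    ((ENNReal.Tendsto.const_mul hS (Or.inr ENNReal.coe_ne_top)).add hT) (Or.inr (by simp))))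
    (Or.inr (by simp))) hbd).trans (le_of_eq ?_)
  simp only [zero_add, add_zero, ← mul_ite_zero, ← Finset.mul_sum]
  ring

namespace Parallelepiped.IsBox

variable {K : Parallelepiped} {lo hi : Fin 3 → ℝ}

theorem sub_le_diam (h : K.IsBox lo hi) (i : Fin 3) : hi i - lo i ≤ Metric.diam K.carrier := by
  have h1 : (WithLp.toLp 2 lo : E3) ∈ K.carrier := by
    rw [h.carrier_eq]
    exact fun j => ⟨le_rfl, (h.lt j).le⟩
  have h2 : (WithLp.toLp 2 hi : E3) ∈ K.carrier := by
    rw [h.carrier_eq]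
    exact fun j => ⟨(h.lt j).le, le_rfl⟩
  have hb : Bornology.IsBounded K.carrier := by
    rw [h.carrier_eq]
    exact (isCompact_cbox lo hi).isBounded
  refine le_trans ?_ (Metric.dist_le_diam_of_mem hb h2 h1)
  rw [dist_eq_norm]
  refine le_trans ?_ (PiLp.norm_apply_le _ i)
  exact le_abs_self _

/-- The two extreme points of the inscribed ball in direction `i` lie in the box. With shape
regularity, every side is thus comparable to the diameter. -/
theorem two_mul_radius_le (h : K.IsBox lo hi) {c : E3} {ρ : ℝ} (hρ : 0 < ρ)
    (hc : Metric.closedBall c ρ ⊆ K.carrier) (i : Fin 3) : 2 * ρ ≤ hi i - lo i := by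
  rw [h.carrier_eq] at hc
  have h1 : ∀ s : ℝ, |s| = ρ → c + EuclideanSpace.single i s ∈ cbox lo hi := fun s hs =>
    hc (by simp [hs])
  have h2 := (h1 ρ (abs_of_pos hρ) i).2
  have h3 := (h1 (-ρ) (by rw [abs_neg, abs_of_pos hρ]) i).1
  simp only [PiLp.add_apply, PiLp.single_apply, if_true] at h2 h3
  linarith

end Parallelepiped.IsBox

theorem Triangulation.diam_le_meshSize {D : Set E3} (𝒯 : Triangulation D) {K : Parallelepiped}
    (hK : K ∈ 𝒯.cells) : Metric.diam K.carrier ≤ 𝒯.meshSize :=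
  le_csSup (𝒯.cells.finite_toSet.image _).bddAbove ⟨K, hK, rfl⟩

namespace Triangulation

variable {x : E3} {δ : ℝ} {𝒯 : Triangulation (samplingDomain x δ)}
  {lo hi : Parallelepiped → Fin 3 → ℝ} {k : ℕ}

theorem sqL2_le_sum_cells (hδ : 0 < δ) (hbox : ∀ K ∈ 𝒯.cells, K.IsBox (lo K) (hi K))
    (f : E3 → ℝ) : sqL2 (samplingDomain x δ) f ≤ ∑ K ∈ 𝒯.cells, sqL2 (cbox (lo K) (hi K)) f := by
  have h1 : samplingDomain x δ ⊆ ⋃ K : 𝒯.cells, cbox (lo K.1) (hi K.1) := by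
    intro y hy
    rw [samplingDomain_eq_obox] at hy
    obtain ⟨K, hK, hyK⟩ := exists_mem_cbox hδ hbox (obox_subset_cbox _ _ hy)
    exact mem_iUnion.2 ⟨⟨K, hK⟩, hyK⟩
  refine (sqL2_mono_set h1 f).trans ((lintegral_iUnion_le _ _).trans (le_of_eq ?_))
  rw [tsum_fintype]
  exact Finset.sum_coe_sort 𝒯.cells fun K => sqL2 (cbox (lo K) (hi K)) f

theorem sum_cells_sqL2_le (hδ : 0 < δ) (hbox : ∀ K ∈ 𝒯.cells, K.IsBox (lo K) (hi K))
    (f : E3 → ℝ) : ∑ K ∈ 𝒯.cells, sqL2 (cbox (lo K) (hi K)) f ≤ sqL2 (samplingDomain x δ) f := by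
  simp only [sqL2_cbox]
  have hdisj : Set.PairwiseDisjoint (𝒯.cells : Set Parallelepiped)
      fun K => obox (lo K) (hi K) := by
    intro K hK K' hK' hne
    refine Set.disjoint_left.2 fun y hy hy' => hne ?_
    exact eq_of_obox_inter_cbox hbox hK hK' ⟨y, hy, obox_subset_cbox _ _ hy'⟩
  have h1 := lintegral_biUnion_finset (μ := volume) hdisj
    (fun K _ => (isOpen_obox (lo K) (hi K)).measurableSet) fun y => ‖f y‖ₑ ^ 2
  simp only [sqL2]
  rw [← h1]
  refine lintegral_mono_set (iUnion₂_subset fun K hK y hy i => ?_)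
  obtain ⟨h2, h3⟩ := le_lo_and_hi_le hδ hbox hK i
  exact ⟨h2.trans_lt (hy i).1, (hy i).2.trans_le h3⟩

/-- The multi-index of `∂_i` among those of order at most `m`. -/
def _root_.MultiIndex.unit {m : ℕ} (h : 1 ≤ m) (i : Fin 3) : MultiIndex m :=
  ⟨(MultiIndex.single i).1, (MultiIndex.single i).2.trans h⟩

/-- Continuity of periodic Sobolev functions, and the error of their piecewise interpolants. -/
theorem exists_interpolant (hk : 1 ≤ k) (hδ : 0 < δ)
    (hbox : ∀ K ∈ 𝒯.cells, K.IsBox (lo K) (hi K)) {σ : ℝ} (hσ : 𝒯.IsShapeRegular σ) {C : ℝ≥0}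
    (hC : ∀ (lo hi : Fin 3 → ℝ) (d : ℝ), (∀ i, lo i < hi i) → (∀ i, hi i - lo i ≤ d) →
      (∀ i, d ≤ σ * (hi i - lo i)) → ∀ f : E3 → ℝ, ContDiff ℝ ∞ f → ∀ i,
      sqL2 (cbox lo hi) (partialD i fun y => f y - boxInterp k lo hi f y) ≤
        C * (ENNReal.ofReal d ^ (2 * k) * sqSeminorm (cbox lo hi) (k + 1) f))
    {g : MultiIndex (k + 1) → E3 → ℝ} (hgm : ∀ β, Measurable (g β))
    (hg : ∀ β, MemLp (g β) 2 (volume.restrict (samplingDomain x δ)))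
    (hw : ∀ β : MultiIndex (k + 1), ∀ φ : E3 → ℝ, ContDiff ℝ ∞ φ → HasCompactSupport φ →
      tsupport φ ⊆ samplingDomain x δ →
      ∫ y in samplingDomain x δ, iterPartialD β.1 φ y * g (MultiIndex.zero (k + 1)) y =
        (-1 : ℝ) ^ (∑ i, β.1 i) * ∫ y in samplingDomain x δ, φ y * g β y)
    (hper : ∀ i, ∀ φ : E3 → ℝ, ContDiff ℝ ∞ φ →
      (∀ (y : E3) (j : Fin 3), φ (y + EuclideanSpace.single j δ) = φ y) →
      ∫ y in samplingDomain x δ, partialD i φ y * g (MultiIndex.zero (k + 1)) y =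
        -∫ y in samplingDomain x δ, φ y * g (MultiIndex.unit (Nat.le_add_left 1 k) i) y) :
    ∃ U V V', IsInterp 𝒯 lo hi k U V V' ∧
      (∀ i z, U (slicePoint i (x i + δ) z) = U (slicePoint i (x i) z)) ∧
      ∀ i, (sqL2 (samplingDomain x δ) fun y =>
          g (MultiIndex.unit (Nat.le_add_left 1 k) i) y - V' i y) ≤
        8 * (C * ENNReal.ofReal 𝒯.meshSize ^ (2 * k)) * ∑ β : MultiIndex (k + 1),
          if ∑ i, β.1 i = k + 1 then sqL2 (samplingDomain x δ) (g β) else 0 := by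
  have hlt : ∀ i, x i < x i + δ := fun i => by linarith
  have hconv : Convex ℝ (samplingDomain x δ) := by
    intro y hy z hz a b ha hb hab i
    exact convex_Ioo (x i) (x i + δ) (hy i) (hz i) ha hb hab
  have hne : (samplingDomain x δ).Nonempty :=
    ⟨WithLp.toLp 2 fun i => x i + δ / 2, fun i => ⟨by simp [hδ], by simp [hδ]⟩⟩
  -- A single sequence, smooth on the whole cube, serves all cells, so the nodal values on different
  -- cells come from one continuous function.
  obtain ⟨w, hws, hlim⟩ := exists_smooth_tendsto (isOpen_samplingDomain x δ) hconv
    (isBounded_samplingDomain x δ) hne hgm hg hw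
  obtain ⟨U, hUc, hclamp, hunif⟩ := exists_tendstoUniformlyOn_box hlt (by omega) hgm hws hlim
  obtain ⟨V, V', hV⟩ := exists_isInterp hk hδ hbox U
  have hlim1 : ∀ i, Tendsto (fun n => sqL2 (samplingDomain x δ) fun y => partialD i (w n) y -
      g (MultiIndex.unit (Nat.le_add_left 1 k) i) y) atTop (𝓝 0) := by
    intro i
    refine (hlim (MultiIndex.unit (Nat.le_add_left 1 k) i)).congr fun n => ?_
    rw [← iterPartialD_single (hws n)]
    rfl
  refine ⟨U, V, V', hV, fun i z => eq_on_opposite_faces hδ i (hg _) (hg _) (hper i) hws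
    (hlim (MultiIndex.zero (k + 1))) (hlim1 i) hUc hclamp hunif z, fun i => ?_⟩
  have hsub : ∀ K ∈ 𝒯.cells, obox (lo K) (hi K) ⊆ samplingDomain x δ := by
    intro K hK y hy i
    obtain ⟨h2, h3⟩ := le_lo_and_hi_le hδ hbox hK i
    exact ⟨h2.trans_lt (hy i).1, (hy i).2.trans_le h3⟩
  have hres : ∀ K ∈ 𝒯.cells, ∀ F : ℕ → E3 → ℝ,
      Tendsto (fun n => sqL2 (samplingDomain x δ) (F n)) atTop (𝓝 0) →
      Tendsto (fun n => sqL2 (cbox (lo K) (hi K)) (F n)) atTop (𝓝 0) := by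
    intro K hK F hF
    refine tendsto_of_tendsto_of_tendsto_of_le_of_le tendsto_const_nhds hF (fun _ => zero_le)
      fun n => ?_
    change sqL2 _ _ ≤ sqL2 _ _
    rw [sqL2_cbox]
    exact sqL2_mono_set (hsub K hK) _
  have hcell : ∀ K ∈ 𝒯.cells, (sqL2 (cbox (lo K) (hi K)) fun y =>
      g (MultiIndex.unit (Nat.le_add_left 1 k) i) y - V' i y) ≤
      8 * (C * ENNReal.ofReal 𝒯.meshSize ^ (2 * k)) * ∑ β : MultiIndex (k + 1),
        if ∑ i, β.1 i = k + 1 then sqL2 (cbox (lo K) (hi K)) (g β) else 0 := by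
    intro K hK
    have hb := hbox K hK
    obtain ⟨c, ρ, hρ, hcρ, hd⟩ := hσ K hK
    have hσ0 : 0 ≤ σ := by
      by_contra! h
      have h1 := hb.sub_le_diam 0
      have h2 := hb.lt 0
      nlinarith
    -- The local estimate is applied with the diameter of the cell itself, which is replaced by the
    -- mesh size only afterwards.
    have h1 := sqL2_sub_partialD_boxInterp_le (k := k) hb.lt
      (B := C * (Metric.diam K.carrier).toNNReal ^ (2 * k)) hws (fun n i => by
        refine (hC (lo K) (hi K) (Metric.diam K.carrier) hb.lt hb.sub_le_diam (fun i => hd.trans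
          (mul_le_mul_of_nonneg_left (hb.two_mul_radius_le hρ hcρ i) hσ0)) (w n) (hws n)
            i).trans (le_of_eq ?_)
        rw [ENNReal.coe_mul, ENNReal.coe_pow, mul_assoc]
        rfl) hgm (fun β => hres K hK _ (hlim β)) (hgm _) (hres K hK _ (hlim1 i))
      (fun y hy => hunif.tendsto_at (closure_samplingDomain x hδ ▸ 𝒯.cover ▸
        mem_iUnion₂.2 ⟨K, hK, by rwa [hb.carrier_eq]⟩))
    have h2 : (sqL2 (cbox (lo K) (hi K)) fun y =>
        g (MultiIndex.unit (Nat.le_add_left 1 k) i) y - V' i y) =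
        sqL2 (cbox (lo K) (hi K)) fun y => g (MultiIndex.unit (Nat.le_add_left 1 k) i) y -
          partialD i (boxInterp k (lo K) (hi K) U) y := by
      rw [sqL2_cbox, sqL2_cbox]
      refine setLIntegral_congr_fun (isOpen_obox _ _).measurableSet fun y hy => ?_
      simp only [hV.deriv_eq_of_mem_obox hbox hK hy i]
    rw [h2]
    refine h1.trans ?_
    gcongr
    rw [ENNReal.coe_mul, ENNReal.coe_pow]
    gcongr
    exact ENNReal.ofReal_le_ofReal (𝒯.diam_le_meshSize hK)
  refine (sqL2_le_sum_cells hδ hbox _).trans ((Finset.sum_le_sum hcell).trans ?_)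
  rw [← Finset.mul_sum, Finset.sum_comm]
  gcongr with β _
  split_ifs
  · exact sum_cells_sqL2_le hδ hbox _
  · simp

end Triangulation

theorem ofReal_norm_sq_Lp {D : Set E3} {N : ℕ}
    (f : Lp (EuclideanSpace ℝ (Fin N)) 2 (volume.restrict D)) :
    ENNReal.ofReal (‖f‖ ^ 2) = ∑ c, sqL2 D fun y => f y c := by
  have h1 : ∀ y, ‖‖f y‖‖ₑ ^ 2 = ∑ c, ‖f y c‖ₑ ^ 2 := by
    intro y
    rw [Real.enorm_of_nonneg (norm_nonneg _), ← ENNReal.ofReal_pow (norm_nonneg _),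
      EuclideanSpace.norm_sq_eq, ENNReal.ofReal_sum_of_nonneg fun _ _ => by positivity]
    refine Finset.sum_congr rfl fun c _ => ?_
    rw [ENNReal.ofReal_pow (norm_nonneg _), ofReal_norm]
  have hm : ∀ c, Measurable fun y => f y c := fun c =>
    (EuclideanSpace.proj c : EuclideanSpace ℝ (Fin N) →L[ℝ] ℝ).measurable.comp
      (Lp.stronglyMeasurable f).measurable
  simp only [sqL2]
  rw [← lintegral_finsetSum _ fun c _ => (hm c).enorm.pow_const 2, ← lintegral_congr h1,
    ENNReal.ofReal_pow (norm_nonneg _), Lp.norm_def, ENNReal.ofReal_toReal (Lp.eLpNorm_ne_top f),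
    ← eLpNorm_norm, ← sqL2_eq_eLpNorm_sq]
  rfl

/-- The components are interpolated separately, and the squared errors add up over components and
cells, so the constant depends neither on `N` nor on `δ`. -/
theorem exists_lagrange_approx {k : ℕ} (hk : 1 ≤ k) (σ : ℝ) : ∃ C : ℝ, 0 < C ∧
    ∀ (N : ℕ) (x : E3) (δ : ℝ), 0 < δ → ∀ u : SobolevSpace (samplingDomain x δ) (k + 1) N,
      sobolevEmbed (Nat.le_add_left 1 k) u ∈ periodicH1 x δ N →
      ∀ 𝒯 : Triangulation (samplingDomain x δ), 𝒯.IsShapeRegular σ →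
      ∃ v ∈ lagrangeSpace 𝒯 k N, ‖gradL (Nat.le_add_left 1 k) u - gradL le_rfl v‖
        ≤ C * 𝒯.meshSize ^ k * sobolevSeminorm u := by
  obtain ⟨C, hC⟩ := exists_boxInterp_estimate hk σ
  -- Three directions with `8 C` each give `24 C`; the `1` ensures a positive constant.
  refine ⟨√(24 * C) + 1, by positivity, fun N x δ hδ u hu 𝒯 hσ => ?_⟩
  obtain ⟨lo, hi, hbox⟩ := 𝒯.exists_boxes hδ
  have hproj : ∀ c : Fin N, Continuous fun z : EuclideanSpace ℝ (Fin N) => z c := fun c =>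
    (EuclideanSpace.proj c : EuclideanSpace ℝ (Fin N) →L[ℝ] ℝ).continuous
  choose U V V' hV hU hest using fun c : Fin N =>
    Triangulation.exists_interpolant hk hδ hbox hσ hC (g := fun β y => u.1 β y c)
      (fun β => (hproj c).measurable.comp (Lp.stronglyMeasurable (u.1 β)).measurable)
      (fun β => (EuclideanSpace.proj c : EuclideanSpace ℝ (Fin N) →L[ℝ] ℝ).comp_memLp'
        (Lp.memLp (u.1 β)))
      (fun β φ hφ hφc hφD => by
        have h1 := congrArg (fun z : EuclideanSpace ℝ (Fin N) => z c) (u.2 β φ hφ hφc hφD)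
        simp only [PiLp.smul_apply, smul_eq_mul] at h1
        rwa [integral_smul_Lp_apply (contDiff_iterPartialD hφ β.1).continuous,
          integral_smul_Lp_apply hφ.continuous] at h1)
      (fun i φ hφ hφp => by
        have h1 := congrArg (fun z : EuclideanSpace ℝ (Fin N) => z c) (hu.2 φ hφ hφp i)
        simp only [PiLp.neg_apply] at h1
        have h2 := integral_smul_Lp_apply (continuous_partialD hφ i)
          (u.1 (MultiIndex.zero (k + 1))) c
        have h3 := integral_smul_Lp_apply hφ.continuous
          (u.1 (MultiIndex.unit (Nat.le_add_left 1 k) i)) c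
        rw [← h2, ← h3]
        exact h1)
  obtain ⟨v, hv, hv'⟩ := Triangulation.exists_mem_lagrangeSpace hk hδ hbox hV hU
  refine ⟨v, hv, ?_⟩
  have hh : 0 ≤ 𝒯.meshSize := Real.sSup_nonneg (by rintro _ ⟨K, -, rfl⟩; exact Metric.diam_nonneg)
  have hsq : sobolevSeminorm u ^ 2 =
      ∑ β : MultiIndex (k + 1), if ∑ i, β.1 i = k + 1 then ‖u.1 β‖ ^ 2 else 0 :=
    Real.sq_sqrt (Finset.sum_nonneg fun β _ => by split_ifs <;> positivity)
  have hcomp : ∀ i, ENNReal.ofReal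
      (‖(gradL (Nat.le_add_left 1 k) u - gradL le_rfl v) i‖ ^ 2) ≤
      ENNReal.ofReal (8 * (C * 𝒯.meshSize ^ (2 * k)) * sobolevSeminorm u ^ 2) := by
    intro i
    rw [ofReal_norm_sq_Lp]
    have h1 : ∀ c, (sqL2 (samplingDomain x δ) fun y =>
        (gradL (Nat.le_add_left 1 k) u - gradL le_rfl v) i y c) =
        sqL2 (samplingDomain x δ) fun y =>
          u.1 (MultiIndex.unit (Nat.le_add_left 1 k) i) y c - V' c i y := by
      intro c
      refine lintegral_congr_ae ?_
      filter_upwards [hv' i, Lp.coeFn_sub (u.1 (MultiIndex.unit (Nat.le_add_left 1 k) i))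
        (v.1 (MultiIndex.single i))] with y hy hy'
      have h2 : (gradL (Nat.le_add_left 1 k) u - gradL le_rfl v) i y c =
          u.1 (MultiIndex.unit (Nat.le_add_left 1 k) i) y c - V' c i y := by
        rw [← hy c]
        exact congrArg (fun z : EuclideanSpace ℝ (Fin N) => z c) hy'
      rw [h2]
    simp only [h1]
    refine (Finset.sum_le_sum fun c _ => hest c i).trans (le_of_eq ?_)
    rw [← Finset.mul_sum, Finset.sum_comm, hsq, ENNReal.ofReal_mul (by positivity),
      ENNReal.ofReal_mul (by norm_num), ENNReal.ofReal_mul (by positivity),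
      ENNReal.ofReal_pow hh, ENNReal.ofReal_coe_nnreal,
      ENNReal.ofReal_sum_of_nonneg fun β _ => by split_ifs <;> positivity]
    congr 1
    · simp
    · refine Finset.sum_congr rfl fun β _ => ?_
      split_ifs
      · rw [ofReal_norm_sq_Lp]
      · simp
  have hF : ‖gradL (Nat.le_add_left 1 k) u - gradL le_rfl v‖ ^ 2 ≤
      24 * C * (𝒯.meshSize ^ k * sobolevSeminorm u) ^ 2 := by
    rw [PiLp.norm_sq_eq_of_L2]
    refine (Finset.sum_le_sum fun i _ => (ENNReal.ofReal_le_ofReal_iff (by positivity)).1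
      (hcomp i)).trans (le_of_eq ?_)
    simp only [Finset.sum_const, Finset.card_univ, Fintype.card_fin]
    rw [pow_mul']
    ring
  have hs : 0 ≤ 𝒯.meshSize ^ k * sobolevSeminorm u :=
    mul_nonneg (pow_nonneg hh k) (Real.sqrt_nonneg _)
  calc ‖gradL (Nat.le_add_left 1 k) u - gradL le_rfl v‖
      ≤ √(24 * C * (𝒯.meshSize ^ k * sobolevSeminorm u) ^ 2) := Real.le_sqrt_of_sq_le hF
    _ = √(24 * C) * (𝒯.meshSize ^ k * sobolevSeminorm u) := by
      rw [Real.sqrt_mul (by positivity), Real.sqrt_sq hs]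
    _ ≤ (√(24 * C) + 1) * (𝒯.meshSize ^ k * sobolevSeminorm u) := by
      gcongr
      linarith
    _ = _ := by ring

/-! ### The main theorem -/

theorem gradForm_eq_of_coeffForm {D : Set E3} {N : ℕ}
    {A : E3 → Matrix (Fin N × Fin 3) (Fin N × Fin 3) ℝ}
    {b : GradSpace D N →L[ℝ] GradSpace D N →L[ℝ] ℝ}
    (hb : ∀ F G, b F G = ∫ y in D, (A y *ᵥ gradFn F y) ⬝ᵥ gradFn G y) (u v : SobolevSpace D 1 N) :
    gradForm A u v = b (gradL le_rfl u) (gradL le_rfl v) := by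
  rw [hb, gradFn_gradL, gradFn_gradL, gradForm]

/-- Polarization: the form at `e_p + e_q` and at `e_p - e_q` lies between `0` and `4 |C|`, and the
difference of the two values is `4 A p q`. The absolute value is there because no sign of `C` is
assumed. -/
theorem abs_entry_le_of_bounds {ι : Type*} [Fintype ι] [DecidableEq ι] {A : Matrix ι ι ℝ} {C : ℝ}
    (hs : A.IsSymm) (h0 : ∀ Φ, 0 ≤ (A *ᵥ Φ) ⬝ᵥ Φ) (h1 : ∀ Φ, (A *ᵥ Φ) ⬝ᵥ Φ ≤ C * (Φ ⬝ᵥ Φ))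
    (p q : ι) : |A p q| ≤ |C| := by
  have hpq : A q p = A p q := hs.apply p q
  have key : ∀ s : ℝ, s = 1 ∨ s = -1 →
      (A *ᵥ (Pi.single p 1 + s • Pi.single q 1)) ⬝ᵥ (Pi.single p 1 + s • Pi.single q 1)
        = A p p + A q q + 2 * s * A p q ∧
      (Pi.single p 1 + s • Pi.single q 1 : ι → ℝ) ⬝ᵥ (Pi.single p 1 + s • Pi.single q 1) ≤ 4 := by
    intro s hs
    have hss : s * s = 1 := by rcases hs with rfl | rfl <;> norm_num
    constructor
    · simp only [Matrix.mulVec_add, Matrix.mulVec_smul, Matrix.mulVec_single_one, dotProduct_add,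
        dotProduct_smul, dotProduct_single_one, smul_eq_mul, Pi.add_apply, Pi.smul_apply,
        Matrix.col_apply]
      rw [hpq]
      linear_combination (A q q) * hss
    · simp only [dotProduct_add, dotProduct_smul, dotProduct_single_one, smul_eq_mul,
        Pi.add_apply, Pi.smul_apply, Pi.single_eq_same]
      by_cases h : p = q
      · subst h; rcases hs with rfl | rfl <;> norm_num
      · rw [Pi.single_eq_of_ne h, Pi.single_eq_of_ne (Ne.symm h)]; linarith
  obtain ⟨e1, f1⟩ := key 1 (Or.inl rfl)
  obtain ⟨e2, f2⟩ := key (-1) (Or.inr rfl)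
  have a1 := h0 (Pi.single p 1 + (1 : ℝ) • Pi.single q 1)
  have a2 := h0 (Pi.single p 1 + (-1 : ℝ) • Pi.single q 1)
  have b1 := h1 (Pi.single p 1 + (1 : ℝ) • Pi.single q 1)
  have b2 := h1 (Pi.single p 1 + (-1 : ℝ) • Pi.single q 1)
  have c : ∀ t : ℝ, 0 ≤ t → t ≤ 4 → C * t ≤ |C| * 4 := fun t ht ht4 =>
    (mul_le_mul_of_nonneg_right (le_abs_self C) ht).trans
      (mul_le_mul_of_nonneg_left ht4 (abs_nonneg C))
  have n : ∀ Φ : ι → ℝ, 0 ≤ Φ ⬝ᵥ Φ := fun Φ => Finset.sum_nonneg fun i _ => mul_self_nonneg _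
  have d1 := c _ (n _) f1
  have d2 := c _ (n _) f2
  rw [e1] at a1 b1
  rw [e2] at a2 b2
  rw [abs_le]
  constructor <;> linarith

theorem abs_entry_le_norm {ι : Type*} [Fintype ι] [DecidableEq ι] (A : Matrix ι ι ℝ) (p q : ι) :
    |A p q| ≤ ‖Matrix.toEuclideanCLM (𝕜 := ℝ) A‖ := by
  have h1 : A p q = inner ℝ (EuclideanSpace.single p (1 : ℝ))
      (Matrix.toEuclideanCLM (𝕜 := ℝ) A (EuclideanSpace.single q 1)) := by
    rw [Matrix.inner_toEuclideanCLM]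
    simp
  rw [h1]
  refine (abs_real_inner_le_norm _ _).trans ?_
  rw [PiLp.norm_single, norm_one, one_mul]
  refine (ContinuousLinearMap.le_opNorm _ _).trans ?_
  rw [PiLp.norm_single, norm_one, mul_one]

theorem continuous_sobolevSeminorm {D : Set E3} {m N : ℕ} :
    Continuous (sobolevSeminorm : SobolevSpace D m N → ℝ) := by
  apply Real.continuous_sqrt.comp
  refine continuous_finsetSum _ fun β _ => ?_
  split_ifs
  · exact ((PiLp.continuous_apply 2 _ β).comp continuous_subtype_val).norm.pow 2
  · exact continuous_const

theorem dotProduct_gradFn_self {D : Set E3} {N : ℕ} (F : GradSpace D N) :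
    Integrable (fun y => gradFn F y ⬝ᵥ gradFn F y) (volume.restrict D) ∧
    ∫ y in D, gradFn F y ⬝ᵥ gradFn F y = ‖F‖ ^ 2 := by
  have h1 : ∀ p, Integrable (fun y => gradFn F y p * gradFn F y p) (volume.restrict D) := fun p =>
    (L2.integrable_inner (𝕜 := ℝ) (gradComp p F) (gradComp p F)).congr (by
      filter_upwards [coeFn_gradComp p F] with y hy
      rw [hy]; simp [sq])
  refine ⟨integrable_finsetSum _ fun p _ => h1 p, ?_⟩
  simp only [dotProduct]
  rw [integral_finsetSum _ fun p _ => h1 p, norm_sq_gradSpace]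
  refine Finset.sum_congr rfl fun p _ => ?_
  rw [← real_inner_self_eq_norm_sq, L2.inner_def]
  apply integral_congr_ae
  filter_upwards [coeFn_gradComp p F] with y hy
  rw [hy]; simp [sq]

theorem error_constant_le {B κ H b a I : ℝ} (hB : 0 ≤ B) (hκ : 0 ≤ κ) (hH : 0 ≤ H) (hb : 0 ≤ b)
    (ha : 0 ≤ a) (hI : 0 ≤ I) :
    B * H * a + κ * (B * H * I) ≤ (B + 1) * (1 + κ) * H * (b + a + I) := by
  have : 0 ≤ B * H * b + B * H * I + κ * (B * H * a) + κ * (B * H * b) +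
    (1 + κ) * H * (b + a + I) := by positivity
  linarith

set_option maxHeartbeats 1000000 in
theorem mainTheorem5 (N k : ℕ) (hk : 1 ≤ k) (α CM CR σ : ℝ) (hα : 0 < α) :
    ∃ C : ℝ, 0 < C ∧
      ∀ (x : E3) (δ : ℝ), 0 < δ →
      ∀ M R : E3 → Matrix (Fin N × Fin 3) (Fin N × Fin 3) ℝ,
        IsEllipticCoeff (samplingDomain x δ) α CM (rescale δ M) →
        IsDampingCoeff (samplingDomain x δ) CR (rescale δ R) →
      ∀ T : ℝ, 0 < T →
      ∀ w : ℝ → SobolevSpace (samplingDomain x δ) (k + 1) N,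
        IsRegularSobolevSolution x δ T (rescale δ M) (rescale δ R) w →
      ∀ 𝒯 : Triangulation (samplingDomain x δ), 𝒯.IsShapeRegular σ →
      ∀ wh : ℝ → SobolevSpace (samplingDomain x δ) 1 N,
        IsSemiDiscreteSolution k T (rescale δ M) (rescale δ R) 𝒯 wh →
        ((∀ v ∈ lagrangeSpace 𝒯 k N,
            gradForm (rescale δ M) (wh 0) v
              = gradForm (rescale δ M) (sobolevEmbed (Nat.le_add_left 1 k) (w 0)) v) →
          ∀ t ∈ Set.Icc 0 T,
            energyNorm (rescale δ M) (sobolevEmbed (Nat.le_add_left 1 k) (w t) - wh t)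
              ≤ C * 𝒯.meshSize ^ k *
                (sobolevSeminorm (w 0) + sobolevSeminorm (w t)
                  + ∫ s in (0 : ℝ)..t, sobolevSeminorm (w s))) ∧
        (∀ t ∈ Set.Icc 0 T,
            energyNorm (rescale δ M) (sobolevEmbed (Nat.le_add_left 1 k) (w t) - wh t)
              ≤ energyNorm (rescale δ M) (sobolevEmbed (Nat.le_add_left 1 k) (w 0) - wh 0)
                + C * 𝒯.meshSize ^ k *
                  (sobolevSeminorm (w 0) + sobolevSeminorm (w t)
                    + ∫ s in (0 : ℝ)..t, sobolevSeminorm (w s))) := by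
  obtain ⟨C₀, hC₀, happ⟩ := exists_lagrange_approx hk σ
  set Bm : ℝ := (N * 3) * (N * 3) * |CM| with hBm
  set K : ℝ := (N * 3) * (N * 3) * |CR| with hK
  have hBm0 : 0 ≤ Bm := by positivity
  have hK0 : 0 ≤ K := by positivity
  -- `√Bm` converts the norm of a field into its energy norm and `K / α` is the factor of the
  -- integral term in the energy estimate. Adding `1` keeps the constant positive.
  refine ⟨(√Bm * C₀ + 1) * (1 + K / α), by positivity, ?_⟩
  intro x δ hδ M R hM hR T hT w hw 𝒯 hσ wh hwh
  obtain ⟨m, hm, hmb⟩ := exists_coeffForm (N := N) hM.1 (abs_nonneg CM) (by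
    filter_upwards [hM.2] with y hy p q
    exact abs_entry_le_of_bounds hy.1 (fun Φ => le_trans (mul_nonneg hα.le
      (Finset.sum_nonneg fun i _ => mul_self_nonneg _)) (hy.2 Φ).1) (fun Φ => (hy.2 Φ).2) p q)
  obtain ⟨r, hr, hrb⟩ := exists_coeffForm (N := N) hR.1 (abs_nonneg CR) (by
    filter_upwards [hR.2] with y hy p q
    exact (abs_entry_le_norm _ p q).trans (hy.1.trans (le_abs_self CR)))
  have hsymm : ∀ F G, m F G = m G F := fun F G => by
    rw [hm, hm]
    apply integral_congr_ae
    filter_upwards [hM.2] with y hy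
    rw [dotProduct_comm, Matrix.dotProduct_mulVec, ← Matrix.mulVec_transpose, hy.1]
  have hint : ∀ F : GradSpace (samplingDomain x δ) N, Integrable
      (fun y => (rescale δ M y *ᵥ gradFn F y) ⬝ᵥ gradFn F y)
        (volume.restrict (samplingDomain x δ)) := by
    intro F
    have hmeas : AEStronglyMeasurable (fun y => (rescale δ M y *ᵥ gradFn F y) ⬝ᵥ gradFn F y)
        (volume.restrict (samplingDomain x δ)) := by
      have hF : ∀ p, AEStronglyMeasurable (fun y => gradFn F y p) (volume.restrict (samplingDomain x δ)) := fun p =>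
        (Lp.aestronglyMeasurable (gradComp p F)).congr (coeFn_gradComp p F)
      simp only [dotProduct, Matrix.mulVec]
      refine Finset.aestronglyMeasurable_fun_sum _ fun p _ => AEStronglyMeasurable.mul ?_ (hF p)
      exact Finset.aestronglyMeasurable_fun_sum _ fun q _ =>
        (hM.1 p q).aestronglyMeasurable.mul (hF q)
    refine Integrable.mono' ((dotProduct_gradFn_self F).1.const_mul CM) hmeas ?_
    filter_upwards [hM.2] with y hy
    rw [Real.norm_eq_abs, abs_of_nonneg]
    · exact (hy.2 _).2
    · exact le_trans (mul_nonneg hα.le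
        (Finset.sum_nonneg fun i _ => mul_self_nonneg _)) (hy.2 _).1
  have hcoer : ∀ F, α * ‖F‖ ^ 2 ≤ m F F := fun F => by
    rw [hm, ← (dotProduct_gradFn_self F).2, ← integral_const_mul]
    refine integral_mono_ae ((dotProduct_gradFn_self F).1.const_mul α) (hint F) ?_
    filter_upwards [hM.2] with y hy
    exact (hy.2 _).1
  have hrpos : ∀ F, 0 ≤ r F F := fun F => by
    rw [hr]
    apply integral_nonneg_of_ae
    filter_upwards [hR.2] with y hy
    exact hy.2 _
  have hWd : ∀ t ∈ Icc 0 T, HasDerivWithinAt (fun t => gradL (Nat.le_add_left 1 k) (w t))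
      (gradL (Nat.le_add_left 1 k) (derivWithin w (Icc 0 T) t)) (Icc 0 T) t := fun t ht =>
    (gradL (Nat.le_add_left 1 k)).hasFDerivAt.comp_hasDerivWithinAt t
      ((hw.1.differentiableOn (by simp)) t ht).hasDerivWithinAt
  have hWhd : ∀ t ∈ Icc 0 T, HasDerivWithinAt (fun t => gradL le_rfl (wh t))
      (gradL le_rfl (derivWithin wh (Icc 0 T) t)) (Icc 0 T) t := fun t ht =>
    (gradL le_rfl).hasFDerivAt.comp_hasDerivWithinAt t (hwh.1 t ht).hasDerivWithinAt
  set h := 𝒯.meshSize with hh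
  have hh0 : 0 ≤ h := by
    apply Real.sSup_nonneg
    rintro _ ⟨K, _, rfl⟩
    exact Metric.diam_nonneg
  have hsn : ContinuousOn (fun s => sobolevSeminorm (w s)) (Icc 0 T) :=
    continuous_sobolevSeminorm.comp_continuousOn hw.1.continuousOn
  have hsn0 : ∀ s, 0 ≤ sobolevSeminorm (w s) := fun s => Real.sqrt_nonneg _
  set g : ℝ → ℝ := fun s => √Bm * C₀ * h ^ k * sobolevSeminorm (w s) with hg
  obtain ⟨ea, eb⟩ := galerkin_energy_estimate (T := T) hα hK0 hsymm hcoer hrpos hrb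
    ((lagrangeSubmodule 𝒯 k N).map (gradL le_rfl).toLinearMap) hWd hWhd
    (by
      -- Conformity of the method: a discrete test function belongs to the periodic space and may be
      -- inserted into the exact equation.
      rintro t ht _ ⟨v, hv, rfl⟩
      have := (hw.2 t ht).2 v hv.1
      rwa [gradForm_eq_of_coeffForm hm, gradForm_eq_of_coeffForm hr, gradL_sobolevEmbed,
        gradL_sobolevEmbed] at this)
    (fun t ht => ⟨wh t, (hwh.2 t ht).1, rfl⟩)
    (by
      rintro t ht _ ⟨v, hv, rfl⟩
      have := (hwh.2 t ht).2 v hv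
      rwa [gradForm_eq_of_coeffForm hm, gradForm_eq_of_coeffForm hr] at this)
    (g := g) (continuousOn_const.mul hsn)
    (by
      intro t ht
      obtain ⟨v, hv, hvb⟩ := happ N x δ hδ (w t) (hw.2 t ht).1 𝒯 hσ
      refine ⟨_, ⟨v, hv, rfl⟩, ?_⟩
      -- The upper bound of `m` turns the approximation estimate for gradients into one for the
      -- energy norm.
      refine (Real.sqrt_le_sqrt ((le_abs_self _).trans (hmb _ _))).trans ?_
      rw [mul_assoc, Real.sqrt_mul hBm0, Real.sqrt_mul_self (norm_nonneg _), hg]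
      simp only [mul_assoc]
      gcongr
      rw [← mul_assoc]
      exact hvb)
  have hfin : ∀ t ∈ Icc 0 T, g t + K / α * ∫ s in (0 : ℝ)..t, g s ≤
      (√Bm * C₀ + 1) * (1 + K / α) * h ^ k * (sobolevSeminorm (w 0) + sobolevSeminorm (w t)
                  + ∫ s in (0 : ℝ)..t, sobolevSeminorm (w s)) := by
    intro t ht
    simp only [hg, intervalIntegral.integral_const_mul]
    exact error_constant_le (by positivity) (by positivity) (by positivity) (hsn0 0) (hsn0 t)
      (intervalIntegral.integral_nonneg ht.1 fun s _ => hsn0 s)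
  have hE : ∀ t, energyNorm (rescale δ M) (sobolevEmbed (Nat.le_add_left 1 k) (w t) - wh t) =
      √(m (gradL (Nat.le_add_left 1 k) (w t) - gradL le_rfl (wh t))
        (gradL (Nat.le_add_left 1 k) (w t) - gradL le_rfl (wh t))) := by
    intro t
    have h1 : gradL le_rfl (sobolevEmbed (Nat.le_add_left 1 k) (w t) - wh t) =
        gradL (Nat.le_add_left 1 k) (w t) - gradL le_rfl (wh t) := by
      rw [← gradL_sobolevEmbed]
      exact ContinuousLinearMap.map_sub _ _ _
    rw [energyNorm, gradForm_eq_of_coeffForm hm, h1]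
  refine ⟨fun h0 t ht => ?_, fun t ht => ?_⟩
  · rw [hE]
    refine (ea ?_ t ht).trans (hfin t ht)
    rintro _ ⟨v, hv, rfl⟩
    have := h0 v hv
    rwa [gradForm_eq_of_coeffForm hm, gradForm_eq_of_coeffForm hm, gradL_sobolevEmbed] at this
  · rw [hE, hE]
    exact (eb t ht).trans (by gcongr; exact hfin t ht)

end
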